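/- Let $(M,g)$ be a spacetime of dimension $n\ge 2$: $M$ is a connected, Hausdorff, second countable smooth $n$-manifold, and $g$ is a time-oriented Lorentzian metric on $M$ of signature $(-,+,\dots,+)$ and class $C^k$, with fixed $2\le k\le\infty$. Let $I^+$ (resp. $J^+$) $\subset M\times M$ be the set of pairs $(x,z)$ such that there is a future directed piecewise $C^1$ timelike curve from $x$ to $z$ (resp. $x=z$ or there is a future directed piecewise $C^1$ causal curve from $x$ to $z$). Let $K^+$ be the smallest closed and transitive subset of $M\times M$ containing $I^+$. Write $g'>g$ if every $g$-causal vector is $g'$-timelike (with $g'$ of class $C^k$ and with the same time orientation), and let $J^+_S=\bigcap_{g'>g}J^+_{g'}$. For $R^+\subset M\times M$ put $R^+(x)=\{y:(x,y)\in R^+\}$ and $R^-(x)=\{y:(y,x)\in R^+\}$; $\bar J^+$ is the closure of $J^+$ in $M\times M$ and $\bar J^\pm(x)$ is the closure of $J^\pm(x)$ in $M$. For $A\subset M$ let $\uparrow\!A$ (resp. $\downarrow\!A$) be the interior of $\{y:(a,y)\in I^+\ \forall a\in A\}$ (resp. $\{y:(y,a)\in I^+\ \forall a\in A\}$). The spacetime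 is *future* (resp. *past*) *reflecting* if $(x,z)\in\bar J^+$ implies $z\in\bar J^+(x)$ (resp. $x\in\bar J^-(z)$); *distinguishing* if $I^+(x)=I^+(z)$ implies $x=z$ and $I^-(x)=I^-(z)$ implies $x=z$; *$K$-causal* if $K^+$ is antisymmetric; *stably causal* if for some $g'>g$ the relation $J^+_{g'}$ is antisymmetric. **Theorem.** The following conditions are equivalent: (i) $(M,g)$ is future (resp. past) reflecting; (ii) for every $x\in M$, $\uparrow\!I^-(x)=I^+(x)$ (resp. $\downarrow\!I^+(x)=I^-(x)$); (iii) for every $x\in M$, $\bar J^+(x)=K^+(x)$ (resp. $\bar J^-(x)=K^-(x)$). Consider also (iv) for every $x\in M$, $\bar J^+(x)=J^+_S(x)$ (resp. $\bar J^-(x)=J^-_S(x)$). Then (iv) implies (i) in the corresponding (future or past) case. Conversely, assume that $K$-causality coincides with stable causality, that is, that every spacetime of the same dimension $n$ and class $C^k$ is $K$-causal if and only if it is stably causal; if $(M,g)$ is distinguishing and (i) holds in the future (resp. past) case, then (iv) holds in the future (resp. past) case. Finally, if (i)–(iii) hold in the past or in the future case, then $\bar J^+=K^+$, while if (iv) holds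 in the past or in the future case, then $\bar J^+=K^+=J^+_S$. -/

import Mathlib

open Set Topology Manifold
open scoped ContDiff

universe u

namespace Causality

/-- A Lorentzian metric of class `C^k` and signature `(-,+,…,+)` on the smooth `n`-dimensional
manifold `M`: a `C^k` field of symmetric bilinear forms on the tangent spaces such that at every
point some vector `v` has negative square and the form is positive definite on the orthogonal
complement of `v`. -/
structure LorentzMetric (n : ℕ) (k : ℕ∞) (M : Type u) [TopologicalSpace M]
    [ChartedSpace (EuclideanSpace ℝ (Fin n)) M]
    [IsManifold (𝓘(ℝ, EuclideanSpace ℝ (Fin n))) ∞ M] where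
  /-- the bilinear form `g_x` -/
  form (x : M) : TangentSpace (𝓘(ℝ, EuclideanSpace ℝ (Fin n))) x →L[ℝ]
    TangentSpace (𝓘(ℝ, EuclideanSpace ℝ (Fin n))) x →L[ℝ] ℝ
  symm (x : M) (v w : TangentSpace (𝓘(ℝ, EuclideanSpace ℝ (Fin n))) x) :
    form x v w = form x w v
  signature (x : M) : ∃ v : TangentSpace (𝓘(ℝ, EuclideanSpace ℝ (Fin n))) x,
    form x v v < 0 ∧ ∀ w, form x v w = 0 → w ≠ 0 → 0 < form x w w
  contMDiff : ContMDiff (𝓘(ℝ, EuclideanSpace ℝ (Fin n)))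
    ((𝓘(ℝ, EuclideanSpace ℝ (Fin n))).prod
      𝓘(ℝ, EuclideanSpace ℝ (Fin n) →L[ℝ] EuclideanSpace ℝ (Fin n) →L[ℝ] ℝ)) (k : ℕ∞ω)
    (fun x ↦ Bundle.TotalSpace.mk'
      (EuclideanSpace ℝ (Fin n) →L[ℝ] EuclideanSpace ℝ (Fin n) →L[ℝ] ℝ) x (form x))

section

variable {n : ℕ} {k : ℕ∞} {M : Type u} [TopologicalSpace M]
  [ChartedSpace (EuclideanSpace ℝ (Fin n)) M]
  [IsManifold (𝓘(ℝ, EuclideanSpace ℝ (Fin n))) ∞ M]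

/-- `v` is a timelike tangent vector. -/
def LorentzMetric.IsTimelike (g : LorentzMetric n k M) {x : M}
    (v : TangentSpace (𝓘(ℝ, EuclideanSpace ℝ (Fin n))) x) : Prop :=
  g.form x v v < 0

/-- `v` is a causal tangent vector: nonzero, and timelike or null. -/
def LorentzMetric.IsCausal (g : LorentzMetric n k M) {x : M}
    (v : TangentSpace (𝓘(ℝ, EuclideanSpace ℝ (Fin n))) x) : Prop :=
  v ≠ 0 ∧ g.form x v v ≤ 0

/-- `g'.IsWiderThan g` is the relation `g' > g`: every `g`-causal vector is `g'`-timelike. -/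
def LorentzMetric.IsWiderThan (g' g : LorentzMetric n k M) : Prop :=
  ∀ (x : M) (v : TangentSpace (𝓘(ℝ, EuclideanSpace ℝ (Fin n))) x),
    g.IsCausal v → g'.IsTimelike v

end

/-- A time-oriented Lorentzian metric on `M`; the time orientation is the one for which the
continuous timelike vector field `timeField` is future directed. -/
structure TimeOrientedMetric (n : ℕ) (k : ℕ∞) (M : Type u) [TopologicalSpace M]
    [ChartedSpace (EuclideanSpace ℝ (Fin n)) M]
    [IsManifold (𝓘(ℝ, EuclideanSpace ℝ (Fin n))) ∞ M] where
  /-- the Lorentzian metric -/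
  metric : LorentzMetric n k M
  /-- a future directed timelike vector field -/
  timeField (x : M) : TangentSpace (𝓘(ℝ, EuclideanSpace ℝ (Fin n))) x
  continuous_timeField : Continuous (fun x ↦
    (⟨x, timeField x⟩ : TangentBundle (𝓘(ℝ, EuclideanSpace ℝ (Fin n))) M))
  timelike_timeField (x : M) : metric.IsTimelike (timeField x)

section Relations

/-- `R⁺(x)` for a relation `R⁺ ⊆ M × M`. -/
def futureOf {M : Type u} (R : Set (M × M)) (x : M) : Set M := {y | (x, y) ∈ R}

/-- `R⁻(x)` for a relation `R⁺ ⊆ M × M`. -/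
def pastOf {M : Type u} (R : Set (M × M)) (x : M) : Set M := {y | (y, x) ∈ R}

end Relations

namespace TimeOrientedMetric

variable {n : ℕ} {k : ℕ∞} {M : Type u} [TopologicalSpace M]
  [ChartedSpace (EuclideanSpace ℝ (Fin n)) M]
  [IsManifold (𝓘(ℝ, EuclideanSpace ℝ (Fin n))) ∞ M]

/-- A future directed timelike vector (recall the signature `(-,+,…,+)`). -/
def IsFutureTimelike (S : TimeOrientedMetric n k M) {x : M}
    (v : TangentSpace (𝓘(ℝ, EuclideanSpace ℝ (Fin n))) x) : Prop :=
  S.metric.IsTimelike v ∧ S.metric.form x v (S.timeField x) < 0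

/-- A future directed causal vector. -/
def IsFutureCausal (S : TimeOrientedMetric n k M) {x : M}
    (v : TangentSpace (𝓘(ℝ, EuclideanSpace ℝ (Fin n))) x) : Prop :=
  S.metric.IsCausal v ∧ S.metric.form x v (S.timeField x) < 0

/-- There is a `C^1` future directed timelike curve `[0,1] → M` from `x` to `z`. -/
def TimelikeSegment (S : TimeOrientedMetric n k M) (x z : M) : Prop :=
  ∃ γ : ℝ → M, ContMDiffOn 𝓘(ℝ, ℝ) (𝓘(ℝ, EuclideanSpace ℝ (Fin n))) 1 γ (Icc 0 1) ∧
    γ 0 = x ∧ γ 1 = z ∧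
    ∀ t ∈ Icc (0 : ℝ) 1, S.IsFutureTimelike
      (mfderivWithin 𝓘(ℝ, ℝ) (𝓘(ℝ, EuclideanSpace ℝ (Fin n))) γ (Icc 0 1) t (1 : ℝ))

/-- There is a `C^1` future directed causal curve `[0,1] → M` from `x` to `z`. -/
def CausalSegment (S : TimeOrientedMetric n k M) (x z : M) : Prop :=
  ∃ γ : ℝ → M, ContMDiffOn 𝓘(ℝ, ℝ) (𝓘(ℝ, EuclideanSpace ℝ (Fin n))) 1 γ (Icc 0 1) ∧
    γ 0 = x ∧ γ 1 = z ∧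
    ∀ t ∈ Icc (0 : ℝ) 1, S.IsFutureCausal
      (mfderivWithin 𝓘(ℝ, ℝ) (𝓘(ℝ, EuclideanSpace ℝ (Fin n))) γ (Icc 0 1) t (1 : ℝ))

/-- The chronological relation `I⁺ ⊆ M × M`: pairs joined by a piecewise `C^1` future directed
timelike curve, i.e. by a concatenation of finitely many (at least one) `C^1` segments. -/
def chronological (S : TimeOrientedMetric n k M) : Set (M × M) :=
  {p | Relation.TransGen S.TimelikeSegment p.1 p.2}

/-- The causal relation `J⁺ ⊆ M × M`: pairs that are equal or joined by a piecewise `C^1` future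
directed causal curve. -/
def causal (S : TimeOrientedMetric n k M) : Set (M × M) :=
  {p | Relation.ReflTransGen S.CausalSegment p.1 p.2}

/-- `K⁺ ⊆ M × M`: the smallest closed transitive relation containing `I⁺`. -/
def sorkinWoolgar (S : TimeOrientedMetric n k M) : Set (M × M) :=
  ⋂₀ {R | IsClosed R ∧ (∀ x y z, (x, y) ∈ R → (y, z) ∈ R → (x, z) ∈ R) ∧ S.chronological ⊆ R}

/-- The spacetime `(M, g')` for a metric `g' > g`, with the time orientation of `(M, g)`. -/
def widen (S : TimeOrientedMetric n k M) (g' : LorentzMetric n k M)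
    (h : g'.IsWiderThan S.metric) : TimeOrientedMetric n k M where
  metric := g'
  timeField := S.timeField
  continuous_timeField := S.continuous_timeField
  timelike_timeField x := h x _ ⟨fun h0 ↦ by
    have := S.timelike_timeField x
    rw [LorentzMetric.IsTimelike, h0, map_zero] at this
    exact lt_irrefl _ this, le_of_lt (S.timelike_timeField x)⟩

/-- Seifert's relation `J⁺_S ⊆ M × M`: the intersection of `J⁺_{g'}` over all metrics `g' > g`. -/
def seifert (S : TimeOrientedMetric n k M) : Set (M × M) :=
  {p | ∀ (g' : LorentzMetric n k M) (h : g'.IsWiderThan S.metric), p ∈ (S.widen g' h).causal}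

/-- The spacetime is causal: `J⁺` is antisymmetric. -/
def IsCausalSpacetime (S : TimeOrientedMetric n k M) : Prop :=
  ∀ x z, (x, z) ∈ S.causal → (z, x) ∈ S.causal → x = z

/-- The spacetime is stably causal: `(M, g')` is causal for some `g' > g`. -/
def IsStablyCausal (S : TimeOrientedMetric n k M) : Prop :=
  ∃ (g' : LorentzMetric n k M) (h : g'.IsWiderThan S.metric), (S.widen g' h).IsCausalSpacetime

/-- The spacetime is `K`-causal: `K⁺` is antisymmetric. -/
def IsKCausal (S : TimeOrientedMetric n k M) : Prop :=
  ∀ x z, (x, z) ∈ S.sorkinWoolgar → (z, x) ∈ S.sorkinWoolgar → x = z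

/-- The spacetime is (future and past) distinguishing. -/
def IsDistinguishing (S : TimeOrientedMetric n k M) : Prop :=
  (∀ x z, futureOf S.chronological x = futureOf S.chronological z → x = z) ∧
  (∀ x z, pastOf S.chronological x = pastOf S.chronological z → x = z)

/-- Future reflectivity: `(x, z) ∈ closure J⁺` implies `z ∈ closure (J⁺(x))`. -/
def IsFutureReflecting (S : TimeOrientedMetric n k M) : Prop :=
  ∀ x z, (x, z) ∈ closure S.causal → z ∈ closure (futureOf S.causal x)

/-- Past reflectivity: `(x, z) ∈ closure J⁺` implies `x ∈ closure (J⁻(z))`. -/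
def IsPastReflecting (S : TimeOrientedMetric n k M) : Prop :=
  ∀ x z, (x, z) ∈ closure S.causal → x ∈ closure (pastOf S.causal z)

/-- The common future `↑A`: the interior of the set of points that are in the chronological future
of every point of `A`. -/
def commonFuture (S : TimeOrientedMetric n k M) (A : Set M) : Set M :=
  interior {y | ∀ a ∈ A, (a, y) ∈ S.chronological}

/-- The common past `↓A`: the interior of the set of points that are in the chronological past
of every point of `A`. -/
def commonPast (S : TimeOrientedMetric n k M) (A : Set M) : Set M :=
  interior {y | ∀ a ∈ A, (y, a) ∈ S.chronological}

end TimeOrientedMetric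

/-- `K`-causality coincides with stable causality: every `n`-dimensional spacetime (connected,
Hausdorff, second countable, with a time-oriented `C^k` Lorentzian metric) is `K`-causal if and
only if it is stably causal. -/
def KCausalityCoincidesWithStableCausality (n : ℕ) (k : ℕ∞) : Prop :=
  ∀ (N : Type u) [TopologicalSpace N] [T2Space N] [SecondCountableTopology N] [ConnectedSpace N]
    [ChartedSpace (EuclideanSpace ℝ (Fin n)) N]
    [IsManifold (𝓘(ℝ, EuclideanSpace ℝ (Fin n))) ∞ N] (S : TimeOrientedMetric n k N),
    S.IsKCausal ↔ S.IsStablyCausal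

end Causality

/-!
The proof treats the chronological relation `I` and the causal relation `J` first as relations on a
topological space. Openness of `I`, the push-up properties `J ∘ I ⊆ I` and `I ∘ J ⊆ I`, and the fact
that every point is a limit of its chronological future and past (`IsCausalPair`) suffice for the
equivalence of the reflectivity conditions (`IsCausalPair.futureReflecting_tfae`): future
reflectivity makes the closure of `J` transitive, hence equal to `K`. Past statements are obtained
by exchanging the factors of `X × X`.

That a spacetime has these properties (`isCausalPair`) is shown without geodesics. In a small
coordinate ball the metric is Lipschitz, and a displacement along a fixed timelike direction whose
size grows exponentially along the cone maps almost causal steps to timelike segments. Chains of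
almost causal steps, in particular the subdivisions of causal curves, are therefore close to
timelike curves with one of the two endpoints prescribed (`GoodChart.exists_perturbation`).

The inclusion of the closure of `J` in Seifert's relation (`closure_causal_subset`) uses that,
when passing to a wider metric, there is room to move a nearby point to a given one by a cut-off
translation in a chart which maps causal curves to causal curves of the wider metric
(`eventually_exists_deformation`); the two endpoints are moved one after the other, with an
intermediate metric in between.

For the opposite inclusion let the spacetime be distinguishing and reflecting. The closure of `J` is
then antisymmetric. For a compactly supported `f ≥ 0`, the supremum of `f` over the chronological
future `I⁺(x)` depends continuously on `x` and does not increase along the closure of `J`; a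
countable weighted sum of functions that are monotone along the closure of `J` gives, for each pair
outside it, a continuous function `t` which strictly increases along the closure of `J` but
decreases on that pair (`exists_strictMono_separating`). Such a `t` cannot decrease along Seifert's relation
(`le_of_mem_seifert`): if the cones are opened by a sufficiently small amount, which varies from
chart to chart (`exists_isWiderThan`), then causal curves of the wider metric are chains of almost
causal steps in each chart. By compactness such a chain lowers `t` by less than a given `δ`, and it
raises `t` whenever it leaves the set where a bump function is at least `1 / 2` after starting where
that function is `1`, so that the losses in different charts do not accumulate.
-/

namespace Causality

/-! ### Chronological and causal relations on a topological space -/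

/-- The properties of the chronological relation `I` and the causal relation `J` of a spacetime
from which the equivalences between reflectivity conditions follow. They are invariant under
exchange of past and future. -/
structure IsCausalPair {X : Type u} [TopologicalSpace X] (I J : Set (X × X)) : Prop where
  isOpen_future : ∀ x, IsOpen (futureOf I x)
  isOpen_past : ∀ x, IsOpen (pastOf I x)
  subset : I ⊆ J
  refl : ∀ x, (x, x) ∈ J
  trans : ∀ {x y z}, (x, y) ∈ J → (y, z) ∈ J → (x, z) ∈ J
  push_left : ∀ {x y z}, (x, y) ∈ J → (y, z) ∈ I → (x, z) ∈ I
  push_right : ∀ {x y z}, (x, y) ∈ I → (y, z) ∈ J → (x, z) ∈ I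
  mem_closure_future : ∀ x, x ∈ closure (futureOf I x)
  mem_closure_past : ∀ x, x ∈ closure (pastOf I x)

/-- The smallest closed and transitive relation containing `I`. -/
def closedTransHull {X : Type u} [TopologicalSpace X] (I : Set (X × X)) : Set (X × X) :=
  ⋂₀ {R | IsClosed R ∧ (∀ x y z, (x, y) ∈ R → (y, z) ∈ R → (x, z) ∈ R) ∧ I ⊆ R}

section

variable {X : Type u} [TopologicalSpace X] {I J : Set (X × X)}

theorem closure_preimage_swap (R : Set (X × X)) :
    closure (Prod.swap ⁻¹' R) = Prod.swap ⁻¹' closure R :=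
  ((Homeomorph.prodComm X X).preimage_closure R).symm

theorem subset_closedTransHull : I ⊆ closedTransHull I :=
  fun _ hp _ hR ↦ hR.2.2 hp

theorem isClosed_closedTransHull : IsClosed (closedTransHull I) :=
  isClosed_sInter fun _ hR ↦ hR.1

theorem closedTransHull_subset {R : Set (X × X)} (h₁ : IsClosed R)
    (h₂ : ∀ x y z, (x, y) ∈ R → (y, z) ∈ R → (x, z) ∈ R) (h₃ : I ⊆ R) :
    closedTransHull I ⊆ R :=
  fun _ hp ↦ hp R ⟨h₁, h₂, h₃⟩

theorem closedTransHull_preimage_swap_subset :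
    closedTransHull (Prod.swap ⁻¹' I) ⊆ Prod.swap ⁻¹' closedTransHull I := by
  refine closedTransHull_subset (isClosed_closedTransHull.preimage continuous_swap) ?_
    (preimage_mono subset_closedTransHull)
  intro x y z hxy hyz R hR
  exact hR.2.1 z y x (hyz R hR) (hxy R hR)

theorem closedTransHull_preimage_swap :
    closedTransHull (Prod.swap ⁻¹' I) = Prod.swap ⁻¹' closedTransHull I := by
  refine closedTransHull_preimage_swap_subset.antisymm ?_
  have := preimage_mono (f := (Prod.swap : X × X → X × X))
    (closedTransHull_preimage_swap_subset (I := Prod.swap ⁻¹' I))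
  simpa [← preimage_comp] using this

namespace IsCausalPair

theorem swap (h : IsCausalPair I J) : IsCausalPair (Prod.swap ⁻¹' I) (Prod.swap ⁻¹' J) where
  isOpen_future := h.isOpen_past
  isOpen_past := h.isOpen_future
  subset := preimage_mono h.subset
  refl := h.refl
  trans := fun h₁ h₂ ↦ h.trans h₂ h₁
  push_left := fun h₁ h₂ ↦ h.push_right h₂ h₁
  push_right := fun h₁ h₂ ↦ h.push_left h₂ h₁
  mem_closure_future := h.mem_closure_past
  mem_closure_past := h.mem_closure_future

theorem closure_future (h : IsCausalPair I J) (x : X) :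
    closure (futureOf J x) = closure (futureOf I x) := by
  refine (closure_minimal ?_ isClosed_closure).antisymm
    (closure_mono fun y hy ↦ h.subset hy)
  intro y hy
  have : futureOf I y ⊆ futureOf I x := fun z hz ↦ h.push_left hy hz
  exact closure_mono this (h.mem_closure_future y)

/-- A point of the closure of `J⁺(x)` has its whole chronological future in `I⁺(x)`. -/
theorem mem_of_mem_closure (h : IsCausalPair I J) {x y z : X}
    (hy : y ∈ closure (futureOf J x)) (hz : (y, z) ∈ I) : (x, z) ∈ I := by
  obtain ⟨w, hw, hxw⟩ := mem_closure_iff.1 hy _ (h.isOpen_past z) hz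
  exact h.push_left hxw hw

theorem mem_closure_trans (h : IsCausalPair I J) {x y z : X}
    (hy : y ∈ closure (futureOf J x)) (hz : z ∈ closure (futureOf J y)) :
    z ∈ closure (futureOf J x) := by
  rw [h.closure_future] at hz ⊢
  have : futureOf I y ⊆ futureOf I x := fun w hw ↦ h.mem_of_mem_closure hy hw
  exact closure_mono this hz

/-- If `(x, z)` is in the closure of `J`, then points in the chronological past of `x` precede
points in the chronological future of `z`. -/
theorem mem_of_mem_closure_prod (h : IsCausalPair I J) {a x z b : X} (ha : (a, x) ∈ I)
    (hxz : (x, z) ∈ closure J) (hb : (z, b) ∈ I) : (a, b) ∈ I := by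
  obtain ⟨⟨x', z'⟩, ⟨hx', hz'⟩, hJ⟩ := mem_closure_iff.1 hxz
    (futureOf I a ×ˢ pastOf I b) ((h.isOpen_future a).prod (h.isOpen_past b)) ⟨ha, hb⟩
  exact h.push_right hx' (h.trans hJ (h.subset hz'))

theorem mem_closure_of_mem_closure_future {x z : X} (hz : z ∈ closure (futureOf J x)) :
    (x, z) ∈ closure J :=
  map_mem_closure (f := fun y ↦ (x, y)) (by fun_prop) hz fun _ hy ↦ hy

theorem subset_closure (h : IsCausalPair I J) : J ⊆ closure I := by
  rintro ⟨x, z⟩ hxz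
  refine mem_closure_of_mem_closure_future ?_
  rw [← h.closure_future]
  exact _root_.subset_closure hxz

theorem closure_subset_closedTransHull (h : IsCausalPair I J) :
    closure J ⊆ closedTransHull I :=
  closure_minimal (h.subset_closure.trans
    (closure_minimal subset_closedTransHull isClosed_closedTransHull)) isClosed_closedTransHull

/-- In the future reflecting case the closure of `J` is transitive, hence equal to `K`. -/
theorem closure_eq_closedTransHull (h : IsCausalPair I J)
    (hr : ∀ x z, (x, z) ∈ closure J → z ∈ closure (futureOf J x)) :
    closure J = closedTransHull I := by
  refine h.closure_subset_closedTransHull.antisymm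
    (closedTransHull_subset isClosed_closure ?_ (h.subset.trans _root_.subset_closure))
  intro x y z hxy hyz
  exact mem_closure_of_mem_closure_future (h.mem_closure_trans (hr _ _ hxy) (hr _ _ hyz))

theorem futureReflecting_tfae (h : IsCausalPair I J) :
    [∀ x z, (x, z) ∈ closure J → z ∈ closure (futureOf J x),
      ∀ x, interior {y | ∀ a ∈ pastOf I x, (a, y) ∈ I} = futureOf I x,
      ∀ x, closure (futureOf J x) = futureOf (closedTransHull I) x].TFAE := by
  tfae_have 1 → 2 := by
    intro hr x
    refine Subset.antisymm ?_ (interior_maximal ?_ (h.isOpen_future x))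
    · intro y hy
      obtain ⟨y', hy', hy'y⟩ :=
        mem_closure_iff.1 (h.mem_closure_past y) _ isOpen_interior hy
      have hxy' : (x, y') ∈ closure J :=
        map_mem_closure (f := fun a ↦ (a, y')) (by fun_prop) (h.mem_closure_past x)
          fun a ha ↦ h.subset (interior_subset hy' a ha)
      exact h.mem_of_mem_closure (hr _ _ hxy') hy'y
    · intro y hy a ha
      exact h.push_left (h.subset ha) hy
  tfae_have 2 → 1 := by
    intro hI x z hxz
    rw [h.closure_future, ← hI x]
    refine closure_mono (interior_maximal ?_ (h.isOpen_future z)) (h.mem_closure_future z)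
    intro b hb a ha
    exact h.mem_of_mem_closure_prod ha hxz hb
  tfae_have 1 → 3 := by
    intro hr x
    ext z
    rw [← h.closure_eq_closedTransHull hr]
    exact ⟨mem_closure_of_mem_closure_future, hr x z⟩
  tfae_have 3 → 1 := by
    intro hK x z hxz
    rw [hK x]
    exact h.closure_subset_closedTransHull hxz
  tfae_finish

/-- In a distinguishing and future reflecting spacetime the closure of `J` is antisymmetric. -/
theorem antisymm_of_futureReflecting (h : IsCausalPair I J)
    (hr : ∀ x z, (x, z) ∈ closure J → z ∈ closure (futureOf J x))
    (hd : ∀ x z, futureOf I x = futureOf I z → x = z) {x z : X}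
    (hxz : (x, z) ∈ closure J) (hzx : (z, x) ∈ closure J) : x = z :=
  hd x z (Subset.antisymm (fun _ hw ↦ h.mem_of_mem_closure (hr _ _ hzx) hw)
    fun _ hw ↦ h.mem_of_mem_closure (hr _ _ hxz) hw)

end IsCausalPair

end

/-! ### Continuous time functions -/

section

variable {X : Type u} [TopologicalSpace X] {I J : Set (X × X)}

namespace IsCausalPair

/-- For a compactly supported continuous `f ≥ 0` the function `x ↦ sup f(I⁺(x))` is continuous in
the future reflecting case: it is lower semicontinuous because `I` is open, and upper
semicontinuous because the sets `closure I⁺(x)` are the sections of a closed relation. -/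
theorem continuous_sSup_image_future (h : IsCausalPair I J)
    (hr : ∀ x z, (x, z) ∈ closure J → z ∈ closure (futureOf J x))
    {f : X → ℝ} (hf : Continuous f) (hc : HasCompactSupport f) (h0 : ∀ x, 0 ≤ f x)
    (h1 : ∀ x, f x ≤ 1) : Continuous fun x ↦ sSup (f '' futureOf I x) := by
  have bdd (x : X) : BddAbove (f '' futureOf I x) := ⟨1, by rintro _ ⟨y, -, rfl⟩; exact h1 y⟩
  have ne (x : X) : (futureOf I x).Nonempty :=
    closure_nonempty_iff.1 ⟨x, h.mem_closure_future x⟩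
  have nonneg (x : X) : 0 ≤ sSup (f '' futureOf I x) :=
    Real.sSup_nonneg (by rintro _ ⟨y, -, rfl⟩; exact h0 y)
  rw [continuous_iff_continuousAt]
  intro x
  refine tendsto_order.2 ⟨fun c hcx ↦ ?_, fun c hcx ↦ ?_⟩
  · obtain ⟨_, ⟨y, hy, rfl⟩, hcy⟩ := exists_lt_of_lt_csSup ((ne x).image f) hcx
    filter_upwards [(h.isOpen_past y).mem_nhds hy] with x' hx'
    exact hcy.trans_le (le_csSup (bdd x') ⟨y, hx', rfl⟩)
  · obtain ⟨c', hxc', hcc'⟩ := exists_between hcx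
    have hK : IsCompact {y | c' ≤ f y} := by
      refine hc.of_isClosed_subset (isClosed_le continuous_const hf) fun y hy ↦ ?_
      exact subset_tsupport f (((nonneg x).trans_lt hxc').trans_le hy).ne'
    have key : ∀ᶠ x' in 𝓝 x, ∀ y ∈ {y | c' ≤ f y}, (x', y) ∉ closure J := by
      refine hK.eventually_forall_of_forall_eventually fun y hy ↦ ?_
      refine isClosed_closure.isOpen_compl.mem_nhds fun hxy ↦ ?_
      have hyI : y ∈ closure (futureOf I x) := by
        rw [← h.closure_future]; exact hr x y hxy
      have : f y ≤ sSup (f '' futureOf I x) := by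
        have hsub : closure (futureOf I x) ⊆ {y | f y ≤ sSup (f '' futureOf I x)} :=
          closure_minimal (fun w hw ↦ le_csSup (bdd x) ⟨w, hw, rfl⟩)
            (isClosed_le hf continuous_const)
        exact hsub hyI
      exact (hxc'.trans_le hy).not_ge this
    filter_upwards [key] with x' hx'
    refine (csSup_le ((ne x').image f) ?_).trans_lt hcc'
    rintro _ ⟨y, hy, rfl⟩
    by_contra hlt
    exact hx' y (not_le.1 hlt).le (_root_.subset_closure (h.subset hy))

/-- In the future reflecting case the closure of `J` is determined by continuous monotone
functions. -/
theorem exists_monotone_separating [LocallyCompactSpace X] [T2Space X] (h : IsCausalPair I J)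
    (hr : ∀ x z, (x, z) ∈ closure J → z ∈ closure (futureOf J x)) {x z : X}
    (hxz : (x, z) ∉ closure J) :
    ∃ s : X → ℝ, Continuous s ∧ (∀ y, s y ∈ Icc (0 : ℝ) 1) ∧
      (∀ a b, (a, b) ∈ closure J → s a ≤ s b) ∧ s z < s x := by
  have hz : z ∉ closure (futureOf J x) := fun hz ↦ hxz (mem_closure_of_mem_closure_future hz)
  obtain ⟨f, hf1, hf0, hfc, hf01⟩ := exists_continuous_one_zero_of_isCompact
    (isCompact_singleton (x := z)) isClosed_closure (disjoint_singleton_left.2 hz)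
  have bdd (x : X) : BddAbove (f '' futureOf I x) :=
    ⟨1, by rintro _ ⟨y, -, rfl⟩; exact (hf01 y).2⟩
  have ne (x : X) : (futureOf I x).Nonempty :=
    closure_nonempty_iff.1 ⟨x, h.mem_closure_future x⟩
  refine ⟨fun y ↦ 1 - sSup (f '' futureOf I y), continuous_const.sub
    (h.continuous_sSup_image_future hr f.continuous hfc (fun y ↦ (hf01 y).1)
      fun y ↦ (hf01 y).2), fun y ↦ ⟨?_, ?_⟩, fun a b hab ↦ ?_, ?_⟩
  · have : sSup (f '' futureOf I y) ≤ 1 := csSup_le ((ne y).image f)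
      (by rintro _ ⟨w, -, rfl⟩; exact (hf01 w).2)
    linarith
  · have : 0 ≤ sSup (f '' futureOf I y) :=
      Real.sSup_nonneg (by rintro _ ⟨w, -, rfl⟩; exact (hf01 w).1)
    linarith
  · have : sSup (f '' futureOf I b) ≤ sSup (f '' futureOf I a) :=
      csSup_le_csSup (bdd a) ((ne b).image f)
        (image_mono fun w hw ↦ h.mem_of_mem_closure (hr a b hab) hw)
    linarith
  · have hx0 : sSup (f '' futureOf I x) ≤ 0 := by
      refine csSup_le ((ne x).image f) ?_
      rintro _ ⟨w, hw, rfl⟩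
      exact (hf0 (_root_.subset_closure (h.subset hw))).le
    have hz1 : (1 : ℝ) / 2 < f z := by rw [hf1 rfl]; norm_num
    obtain ⟨w, hw, hzw⟩ := mem_closure_iff.1 (h.mem_closure_future z) _
      (isOpen_lt continuous_const f.continuous) hz1
    have := le_csSup (bdd z) ⟨w, hzw, rfl⟩
    have hw' : (1 : ℝ) / 2 < f w := hw
    linarith

/-- The past reflecting version of `exists_monotone_separating`. -/
theorem exists_monotone_separating_of_past [LocallyCompactSpace X] [T2Space X]
    (h : IsCausalPair I J) (hr : ∀ x z, (x, z) ∈ closure J → x ∈ closure (pastOf J z)) {x z : X}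
    (hxz : (x, z) ∉ closure J) :
    ∃ s : X → ℝ, Continuous s ∧ (∀ y, s y ∈ Icc (0 : ℝ) 1) ∧
      (∀ a b, (a, b) ∈ closure J → s a ≤ s b) ∧ s z < s x := by
  obtain ⟨s, hs, hs01, hmono, hlt⟩ := h.swap.exists_monotone_separating (x := z) (z := x)
    (fun a b hab ↦ by rw [closure_preimage_swap] at hab; exact hr b a hab)
    (by rw [closure_preimage_swap]; exact hxz)
  refine ⟨fun y ↦ 1 - s y, continuous_const.sub hs, fun y ↦ ?_, fun a b hab ↦ ?_, ?_⟩
  · have := hs01 y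
    exact ⟨by linarith [this.2], by linarith [this.1]⟩
  · have := hmono b a (by rw [closure_preimage_swap]; exact hab)
    linarith
  · linarith

end IsCausalPair

/-- If the complement of an antisymmetric relation `R` is covered by the sets `{s z < s x}` for
continuous monotone functions `s`, then it is covered by those with `s` strictly monotone: add to
`s` a small multiple of a suitable countable sum. -/
theorem exists_strictMono_separating [SecondCountableTopology X] {R : Set (X × X)}
    (hanti : ∀ x z, (x, z) ∈ R → (z, x) ∈ R → x = z)
    (hsep : ∀ x z, (x, z) ∉ R → ∃ s : X → ℝ, Continuous s ∧ (∀ y, s y ∈ Icc (0 : ℝ) 1) ∧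
      (∀ a b, (a, b) ∈ R → s a ≤ s b) ∧ s z < s x) {x z : X} (hxz : (x, z) ∉ R) :
    ∃ t : X → ℝ, Continuous t ∧ (∀ a b, (a, b) ∈ R → a ≠ b → t a < t b) ∧ t z < t x := by
  choose! s hs hs01 hmono hlt using fun p : X × X ↦ hsep p.1 p.2
  obtain ⟨T, hT, hTU⟩ := TopologicalSpace.isOpen_iUnion_countable
    (fun p : {p : X × X // p ∉ R} ↦ {q : X × X | s p.1 q.2 < s p.1 q.1})
    (fun p ↦ isOpen_lt ((hs p.1 p.2).comp continuous_snd) ((hs p.1 p.2).comp continuous_fst))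
  obtain ⟨w, hw, c, hwc, -⟩ := hT.exists_pos_hasSum_le zero_lt_one
  have hbound (y : X) (p : T) : ‖w p * s p.1.1 y‖ ≤ w p := by
    have := hs01 p.1.1 p.1.2 y
    rw [Real.norm_of_nonneg (mul_nonneg (hw _).le this.1)]
    exact mul_le_of_le_one_right (hw _).le this.2
  have hsum (y : X) : Summable fun p : T ↦ w p * s p.1.1 y :=
    Summable.of_norm_bounded hwc.summable (hbound y)
  set S : X → ℝ := fun y ↦ ∑' p : T, w p * s p.1.1 y with hS
  have hScont : Continuous S := continuous_tsum
    (fun p ↦ continuous_const.mul (hs p.1.1 p.1.2)) hwc.summable fun p y ↦ hbound y p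
  have hSmono (a b : X) (hab : (a, b) ∈ R) (hne : a ≠ b) : S a < S b := by
    have hba : (b, a) ∉ R := fun hba ↦ hne (hanti a b hab hba)
    have : (b, a) ∈ ⋃ p : {p : X × X // p ∉ R}, {q : X × X | s p.1 q.2 < s p.1 q.1} :=
      mem_iUnion.2 ⟨⟨(b, a), hba⟩, hlt (b, a) hba⟩
    rw [← hTU] at this
    obtain ⟨p, hp, hlt'⟩ := mem_iUnion₂.1 this
    refine Summable.tsum_lt_tsum (i := (⟨p, hp⟩ : T)) (fun q ↦ ?_) ?_ (hsum a) (hsum b)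
    · exact mul_le_mul_of_nonneg_left (hmono q.1.1 q.1.2 a b hab) (hw _).le
    · exact mul_lt_mul_of_pos_left hlt' (hw _)
  have hd : 0 < s (x, z) x - s (x, z) z := sub_pos.2 (hlt (x, z) hxz)
  have hA : 0 < |S z - S x| + 1 := by positivity
  set δ := (s (x, z) x - s (x, z) z) / (|S z - S x| + 1) with hδ
  have hδ0 : 0 < δ := div_pos hd hA
  refine ⟨fun y ↦ s (x, z) y + δ * S y, (hs (x, z) hxz).add (continuous_const.mul hScont),
    fun a b hab hne ↦ ?_, ?_⟩
  · exact add_lt_add_of_le_of_lt (hmono (x, z) hxz a b hab)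
      (mul_lt_mul_of_pos_left (hSmono a b hab hne) hδ0)
  · have h1 : δ * (|S z - S x| + 1) = s (x, z) x - s (x, z) z := div_mul_cancel₀ _ hA.ne'
    have h2 : δ * (S z - S x) ≤ δ * |S z - S x| :=
      mul_le_mul_of_nonneg_left (le_abs_self _) hδ0.le
    have : s (x, z) z + δ * S z < s (x, z) x + δ * S x := by nlinarith
    exact this

end

/-! ### The metric in a chart -/

section

variable {n : ℕ} {k : ℕ∞} {M : Type u} [TopologicalSpace M]
  [ChartedSpace (EuclideanSpace ℝ (Fin n)) M]
  [IsManifold (𝓘(ℝ, EuclideanSpace ℝ (Fin n))) ∞ M]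

/-- Tangent vectors at `q` read in the chart at `p`. -/
noncomputable def toChart (p q : M) :
    TangentSpace (𝓘(ℝ, EuclideanSpace ℝ (Fin n))) q →L[ℝ] EuclideanSpace ℝ (Fin n) :=
  (trivializationAt (EuclideanSpace ℝ (Fin n))
    (TangentSpace (𝓘(ℝ, EuclideanSpace ℝ (Fin n))) : M → Type _) p).continuousLinearMapAt ℝ q

/-- The tangent vector at `q` with given coordinates in the chart at `p`. -/
noncomputable def ofChart (p q : M) :
    EuclideanSpace ℝ (Fin n) →L[ℝ] TangentSpace (𝓘(ℝ, EuclideanSpace ℝ (Fin n))) q :=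
  (trivializationAt (EuclideanSpace ℝ (Fin n))
    (TangentSpace (𝓘(ℝ, EuclideanSpace ℝ (Fin n))) : M → Type _) p).symmL ℝ q

theorem ofChart_toChart {p q : M} (hq : q ∈ (chartAt (EuclideanSpace ℝ (Fin n)) p).source)
    (v : TangentSpace (𝓘(ℝ, EuclideanSpace ℝ (Fin n))) q) : ofChart p q (toChart p q v) = v :=
  Bundle.Trivialization.symmL_continuousLinearMapAt _ hq v

theorem toChart_ofChart {p q : M} (hq : q ∈ (chartAt (EuclideanSpace ℝ (Fin n)) p).source)
    (v : EuclideanSpace ℝ (Fin n)) : toChart p q (ofChart p q v) = v :=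
  Bundle.Trivialization.continuousLinearMapAt_symmL _ hq v

set_option linter.unusedSectionVars false in
theorem symm_mem_source {p : M} {y : EuclideanSpace ℝ (Fin n)}
    (hy : y ∈ (extChartAt (𝓘(ℝ, EuclideanSpace ℝ (Fin n))) p).target) :
    (extChartAt (𝓘(ℝ, EuclideanSpace ℝ (Fin n))) p).symm y ∈
      (chartAt (EuclideanSpace ℝ (Fin n)) p).source := by
  rw [← extChartAt_source (𝓘(ℝ, EuclideanSpace ℝ (Fin n)))]
  exact (extChartAt _ p).map_target hy

/-- The velocity of a curve read in a chart is the derivative of its coordinate expression. -/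
theorem hasDerivWithinAt_extChartAt_comp {γ : ℝ → M}
    (hγ : ContMDiffOn 𝓘(ℝ, ℝ) (𝓘(ℝ, EuclideanSpace ℝ (Fin n))) 1 γ (Icc 0 1)) {s : ℝ}
    (hs : s ∈ Icc (0 : ℝ) 1) {p : M}
    (hp : γ s ∈ (chartAt (EuclideanSpace ℝ (Fin n)) p).source) :
    HasDerivWithinAt (extChartAt (𝓘(ℝ, EuclideanSpace ℝ (Fin n))) p ∘ γ)
      (toChart p (γ s)
        (mfderivWithin 𝓘(ℝ, ℝ) (𝓘(ℝ, EuclideanSpace ℝ (Fin n))) γ (Icc 0 1) s (1 : ℝ)))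
      (Icc 0 1) s := by
  have : IsManifold (𝓘(ℝ, EuclideanSpace ℝ (Fin n))) 1 M := .of_le (n := ∞) (by simp)
  have h1 := ((hγ s hs).mdifferentiableWithinAt one_ne_zero).hasMFDerivWithinAt
  have h2 := (mdifferentiableAt_extChartAt (I := 𝓘(ℝ, EuclideanSpace ℝ (Fin n))) hp).hasMFDerivAt
  rw [toChart, TangentBundle.continuousLinearMapAt_trivializationAt hp]
  have h3 : HasFDerivWithinAt (extChartAt (𝓘(ℝ, EuclideanSpace ℝ (Fin n))) p ∘ γ)
      (show ℝ →L[ℝ] EuclideanSpace ℝ (Fin n) from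
        (mfderiv (𝓘(ℝ, EuclideanSpace ℝ (Fin n))) 𝓘(ℝ, EuclideanSpace ℝ (Fin n))
          (extChartAt (𝓘(ℝ, EuclideanSpace ℝ (Fin n))) p) (γ s)).comp
        (mfderivWithin 𝓘(ℝ, ℝ) (𝓘(ℝ, EuclideanSpace ℝ (Fin n))) γ (Icc 0 1) s))
      (Icc 0 1) s :=
    hasMFDerivWithinAt_iff_hasFDerivWithinAt.1 (h2.comp_hasMFDerivWithinAt s h1)
  exact h3.hasDerivWithinAt

/-- The velocity of a straight segment in a chart is constant. -/
theorem mfderivWithin_extChartAt_symm_lineMap {p : M} {a b : EuclideanSpace ℝ (Fin n)} {t : ℝ}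
    (ht : t ∈ Icc (0 : ℝ) 1) (hy : AffineMap.lineMap a b t ∈
      (extChartAt (𝓘(ℝ, EuclideanSpace ℝ (Fin n))) p).target) :
    mfderivWithin 𝓘(ℝ, ℝ) (𝓘(ℝ, EuclideanSpace ℝ (Fin n)))
      ((extChartAt (𝓘(ℝ, EuclideanSpace ℝ (Fin n))) p).symm ∘ AffineMap.lineMap a b)
      (Icc 0 1) t (1 : ℝ) =
    ofChart p ((extChartAt (𝓘(ℝ, EuclideanSpace ℝ (Fin n))) p).symm (AffineMap.lineMap a b t))
      (b - a) := by
  have : IsManifold (𝓘(ℝ, EuclideanSpace ℝ (Fin n))) 1 M := .of_le (n := ∞) (by simp)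
  have h1 : HasMFDerivWithinAt 𝓘(ℝ, ℝ) (𝓘(ℝ, EuclideanSpace ℝ (Fin n)))
      (AffineMap.lineMap a b : ℝ → EuclideanSpace ℝ (Fin n)) (Icc 0 1) t
      (ContinuousLinearMap.toSpanSingleton ℝ (b - a)) :=
    (AffineMap.hasDerivAt_lineMap (a := a) (b := b)
      (x := t)).hasFDerivAt.hasFDerivWithinAt.hasMFDerivWithinAt
  have h2 := (mdifferentiableWithinAt_extChartAt_symm
    (I := 𝓘(ℝ, EuclideanSpace ℝ (Fin n))) hy).hasMFDerivWithinAt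
  have h3 := h2.comp t h1 (fun _ _ ↦ by simp)
  rw [h3.mfderivWithin (uniqueMDiffWithinAt_iff_uniqueDiffWithinAt.2
    (uniqueDiffOn_Icc zero_lt_one t ht)), ofChart,
    TangentBundle.symmL_trivializationAt (symm_mem_source hy),
    (extChartAt (𝓘(ℝ, EuclideanSpace ℝ (Fin n))) p).right_inv hy]
  exact congrArg (mfderivWithin 𝓘(ℝ, EuclideanSpace ℝ (Fin n)) (𝓘(ℝ, EuclideanSpace ℝ (Fin n)))
    (extChartAt (𝓘(ℝ, EuclideanSpace ℝ (Fin n))) p).symm (range _) (AffineMap.lineMap a b t))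
    (one_smul ℝ (b - a))

/-- A bilinear form at `q` read in the chart at `p`. -/
theorem inCoordinates_form_apply {p q : M}
    (hq : q ∈ (chartAt (EuclideanSpace ℝ (Fin n)) p).source)
    (b : TangentSpace (𝓘(ℝ, EuclideanSpace ℝ (Fin n))) q →L[ℝ]
      TangentSpace (𝓘(ℝ, EuclideanSpace ℝ (Fin n))) q →L[ℝ] ℝ)
    (v w : EuclideanSpace ℝ (Fin n)) :
    ContinuousLinearMap.inCoordinates (EuclideanSpace ℝ (Fin n))
      (TangentSpace (𝓘(ℝ, EuclideanSpace ℝ (Fin n))))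
      (EuclideanSpace ℝ (Fin n) →L[ℝ] ℝ)
      (fun x : M ↦ TangentSpace (𝓘(ℝ, EuclideanSpace ℝ (Fin n))) x →L[ℝ] ℝ) p q p q b v w =
    b (ofChart p q v) (ofChart p q w) := by
  have := inCoordinates_apply_eq₂ (𝕜 := ℝ) (F₁ := EuclideanSpace ℝ (Fin n))
    (E₁ := (TangentSpace (𝓘(ℝ, EuclideanSpace ℝ (Fin n))) : M → Type _))
    (F₂ := EuclideanSpace ℝ (Fin n))
    (E₂ := (TangentSpace (𝓘(ℝ, EuclideanSpace ℝ (Fin n))) : M → Type _))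
    (F₃ := ℝ) (E₃ := fun _ : M ↦ ℝ)
    (x₀ := p) (x := q) (ϕ := b) (v := v) (w := w) hq hq (Set.mem_univ _)
  refine this.trans ?_
  rw [ofChart, Bundle.Trivialization.symmL_apply _ (by exact hq),
    Bundle.Trivialization.symmL_apply _ (by exact hq)]
  simp

namespace LorentzMetric

/-- The matrix of the metric at `q` in the chart at `p`, as a bilinear form on the model space. -/
noncomputable def atChart (g : LorentzMetric n k M) (p q : M) :
    EuclideanSpace ℝ (Fin n) →L[ℝ] EuclideanSpace ℝ (Fin n) →L[ℝ] ℝ :=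
  ContinuousLinearMap.inCoordinates (EuclideanSpace ℝ (Fin n))
    (TangentSpace (𝓘(ℝ, EuclideanSpace ℝ (Fin n))))
    (EuclideanSpace ℝ (Fin n) →L[ℝ] ℝ)
    (fun x : M ↦ TangentSpace (𝓘(ℝ, EuclideanSpace ℝ (Fin n))) x →L[ℝ] ℝ) p q p q (g.form q)

theorem atChart_apply (g : LorentzMetric n k M) {p q : M}
    (hq : q ∈ (chartAt (EuclideanSpace ℝ (Fin n)) p).source)
    (v w : EuclideanSpace ℝ (Fin n)) :
    g.atChart p q v w = g.form q (ofChart p q v) (ofChart p q w) :=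
  inCoordinates_form_apply hq (g.form q) v w

theorem form_eq_atChart (g : LorentzMetric n k M) {p q : M}
    (hq : q ∈ (chartAt (EuclideanSpace ℝ (Fin n)) p).source)
    (v w : TangentSpace (𝓘(ℝ, EuclideanSpace ℝ (Fin n))) q) :
    g.form q v w = g.atChart p q (toChart p q v) (toChart p q w) := by
  rw [g.atChart_apply hq, ofChart_toChart hq, ofChart_toChart hq]

theorem contMDiffAt_atChart (hk : 1 ≤ k) (g : LorentzMetric n k M) (p : M) :
    ContMDiffAt (𝓘(ℝ, EuclideanSpace ℝ (Fin n)))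
      𝓘(ℝ, EuclideanSpace ℝ (Fin n) →L[ℝ] EuclideanSpace ℝ (Fin n) →L[ℝ] ℝ) 1 (g.atChart p) p :=
  ((contMDiffAt_hom_bundle _).1
    (g.contMDiff.of_le (m := 1) (by exact_mod_cast hk)).contMDiffAt).2

/-- The metric in the chart at `p`, as a function of the coordinates. -/
noncomputable def coord (g : LorentzMetric n k M) (p : M) (y : EuclideanSpace ℝ (Fin n)) :
    EuclideanSpace ℝ (Fin n) →L[ℝ] EuclideanSpace ℝ (Fin n) →L[ℝ] ℝ :=
  g.atChart p ((extChartAt (𝓘(ℝ, EuclideanSpace ℝ (Fin n))) p).symm y)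

theorem coord_extChartAt (g : LorentzMetric n k M) {p q : M}
    (hq : q ∈ (chartAt (EuclideanSpace ℝ (Fin n)) p).source) :
    g.coord p (extChartAt (𝓘(ℝ, EuclideanSpace ℝ (Fin n))) p q) = g.atChart p q := by
  rw [coord, (extChartAt _ p).left_inv (by rwa [extChartAt_source])]

theorem coord_symm (g : LorentzMetric n k M) {p : M} {y : EuclideanSpace ℝ (Fin n)}
    (hy : y ∈ (extChartAt (𝓘(ℝ, EuclideanSpace ℝ (Fin n))) p).target)
    (v w : EuclideanSpace ℝ (Fin n)) : g.coord p y v w = g.coord p y w v := by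
  rw [coord, g.atChart_apply (symm_mem_source hy), g.atChart_apply (symm_mem_source hy), g.symm]

theorem contDiffAt_coord (hk : 1 ≤ k) (g : LorentzMetric n k M) (p : M) :
    ContDiffAt ℝ 1 (g.coord p) (extChartAt (𝓘(ℝ, EuclideanSpace ℝ (Fin n))) p p) := by
  rw [← contMDiffAt_iff_contDiffAt]
  have h1 : ContMDiffAt 𝓘(ℝ, EuclideanSpace ℝ (Fin n)) (𝓘(ℝ, EuclideanSpace ℝ (Fin n))) 1
      (extChartAt (𝓘(ℝ, EuclideanSpace ℝ (Fin n))) p).symm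
      (extChartAt (𝓘(ℝ, EuclideanSpace ℝ (Fin n))) p p) := by
    have : IsManifold (𝓘(ℝ, EuclideanSpace ℝ (Fin n))) 1 M := .of_le (n := ∞) (by simp)
    exact (contMDiffOn_extChartAt_symm p).contMDiffAt (extChartAt_target_mem_nhds p)
  refine ContMDiffAt.comp _ (g := g.atChart p) ?_ h1
  rw [extChartAt_to_inv]
  exact g.contMDiffAt_atChart hk p

end LorentzMetric

namespace TimeOrientedMetric

/-- The time orienting vector field in the chart at `p`, as a function of the coordinates. -/
noncomputable def timeCoord (S : TimeOrientedMetric n k M) (p : M)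
    (y : EuclideanSpace ℝ (Fin n)) : EuclideanSpace ℝ (Fin n) :=
  toChart p _ (S.timeField ((extChartAt (𝓘(ℝ, EuclideanSpace ℝ (Fin n))) p).symm y))

theorem continuousAt_toChart_timeField (S : TimeOrientedMetric n k M) (p : M) :
    ContinuousAt (fun q ↦ toChart p q (S.timeField q)) p := by
  have := (FiberBundle.continuousAt_totalSpace _ _).1 (S.continuous_timeField.continuousAt (x := p))
  refine this.2.congr ?_
  filter_upwards [chart_source_mem_nhds (EuclideanSpace ℝ (Fin n)) p] with q hq
  rw [toChart]
  exact (Bundle.Trivialization.continuousLinearMapAt_apply_of_mem ℝ _ (by exact hq) _).symm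

theorem continuousAt_timeCoord (S : TimeOrientedMetric n k M) (p : M) :
    ContinuousAt (S.timeCoord p) (extChartAt (𝓘(ℝ, EuclideanSpace ℝ (Fin n))) p p) := by
  have h1 := continuousAt_extChartAt_symm (I := 𝓘(ℝ, EuclideanSpace ℝ (Fin n))) p
  refine ContinuousAt.comp (g := fun q ↦ toChart p q (S.timeField q)) ?_ h1
  rw [extChartAt_to_inv]
  exact S.continuousAt_toChart_timeField p

/-- A vector which is timelike and future directed at the point with coordinates `y`. -/
def CoordTimelike (S : TimeOrientedMetric n k M) (p : M) (y v : EuclideanSpace ℝ (Fin n)) :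
    Prop :=
  S.metric.coord p y v v < 0 ∧ S.metric.coord p y v (S.timeCoord p y) < 0

theorem isFutureTimelike_ofChart (S : TimeOrientedMetric n k M) {p : M}
    {y v : EuclideanSpace ℝ (Fin n)}
    (hy : y ∈ (extChartAt (𝓘(ℝ, EuclideanSpace ℝ (Fin n))) p).target)
    (h : S.CoordTimelike p y v) :
    S.IsFutureTimelike (ofChart p
      ((extChartAt (𝓘(ℝ, EuclideanSpace ℝ (Fin n))) p).symm y) v) := by
  have hq := symm_mem_source hy
  refine ⟨?_, ?_⟩
  · rw [LorentzMetric.IsTimelike, ← S.metric.atChart_apply hq]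
    exact h.1
  · rw [S.metric.form_eq_atChart hq, toChart_ofChart hq]
    exact h.2

/-- Straight segments in a chart with timelike direction are timelike. -/
theorem timelikeSegment_of_coordTimelike (S : TimeOrientedMetric n k M) {p : M}
    {a b : EuclideanSpace ℝ (Fin n)}
    (hT : segment ℝ a b ⊆ (extChartAt (𝓘(ℝ, EuclideanSpace ℝ (Fin n))) p).target)
    (h : ∀ y ∈ segment ℝ a b, S.CoordTimelike p y (b - a)) :
    S.TimelikeSegment ((extChartAt (𝓘(ℝ, EuclideanSpace ℝ (Fin n))) p).symm a)
      ((extChartAt (𝓘(ℝ, EuclideanSpace ℝ (Fin n))) p).symm b) := by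
  have : IsManifold (𝓘(ℝ, EuclideanSpace ℝ (Fin n))) 1 M := .of_le (n := ∞) (by simp)
  have hseg (t : ℝ) (ht : t ∈ Icc (0 : ℝ) 1) : AffineMap.lineMap a b t ∈ segment ℝ a b := by
    rw [segment_eq_image_lineMap]
    exact mem_image_of_mem _ ht
  refine ⟨(extChartAt (𝓘(ℝ, EuclideanSpace ℝ (Fin n))) p).symm ∘ AffineMap.lineMap a b,
    ?_, by simp, by simp, fun t ht ↦ ?_⟩
  · have hline : ContDiff ℝ 1 (AffineMap.lineMap a b : ℝ → EuclideanSpace ℝ (Fin n)) := by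
      simp only [funext fun t : ℝ ↦ AffineMap.lineMap_apply_module' a b t]
      fun_prop
    exact (contMDiffOn_extChartAt_symm p).comp (t := (extChartAt _ p).target)
      hline.contMDiff.contMDiffOn fun t ht ↦ hT (hseg t ht)
  · rw [mfderivWithin_extChartAt_symm_lineMap ht (hT (hseg t ht))]
    exact S.isFutureTimelike_ofChart (hT (hseg t ht)) (h _ (hseg t ht))

end TimeOrientedMetric

end

/-! ### Lorentzian bilinear forms -/

section

variable {V : Type*} [AddCommGroup V] [Module ℝ V] [TopologicalSpace V]

/-- A symmetric form which is positive definite on the orthogonal complement of one vector is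
positive definite on the orthogonal complement of every timelike vector. -/
theorem pos_of_orthogonal_timelike {b : V →L[ℝ] V →L[ℝ] ℝ} (hb : ∀ v w, b v w = b w v)
    (hsig : ∃ v, b v v < 0 ∧ ∀ w, b v w = 0 → w ≠ 0 → 0 < b w w) {T z : V}
    (hT : b T T < 0) (hTz : b T z = 0) (hz : z ≠ 0) : 0 < b z z := by
  obtain ⟨v, -, hpos⟩ := hsig
  by_contra! hzz
  by_cases hvz : b v z = 0
  · exact (hpos z hvz hz).not_ge hzz
  -- a combination of `T` and `z` orthogonal to `v` would have nonpositive square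
  set c := b v T / b v z with hc
  have h1 : b v (T - c • z) = 0 := by
    simp only [map_sub, map_smul, smul_eq_mul, hc]
    field_simp
    ring
  have h2 : b (T - c • z) (T - c • z) = b T T + c ^ 2 * b z z := by
    simp only [map_sub, map_smul, smul_eq_mul, sub_apply,
      smul_apply, hTz, hb z T]
    ring
  have h3 : b (T - c • z) (T - c • z) < 0 := by
    rw [h2]
    nlinarith [mul_nonpos_of_nonneg_of_nonpos (sq_nonneg c) hzz]
  have h4 : T - c • z ≠ 0 := fun h0 ↦ by
    rw [h0] at h3
    simp at h3
  exact (hpos _ h1 h4).not_gt h3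

end

section

variable {E : Type*} [NormedAddCommGroup E] [NormedSpace ℝ E]

theorem exists_pos_mul_norm_sq_le [FiniteDimensional ℝ E] {q : E → ℝ} (hq : Continuous q)
    (hhom : ∀ (t : ℝ) v, q (t • v) = t ^ 2 * q v) (hpos : ∀ v, v ≠ 0 → 0 < q v) :
    ∃ c > 0, ∀ v, c * ‖v‖ ^ 2 ≤ q v := by
  rcases subsingleton_or_nontrivial E with hE | hE
  · refine ⟨1, one_pos, fun v ↦ ?_⟩
    have h0 := hhom 0 v
    rw [Subsingleton.elim v 0] at h0 ⊢
    simp at h0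
    simp [h0]
  have : ProperSpace E := FiniteDimensional.proper ℝ E
  obtain ⟨v₀, hv₀, hmin⟩ := (isCompact_sphere (0 : E) 1).exists_isMinOn
    (NormedSpace.sphere_nonempty.2 zero_le_one) hq.continuousOn
  have hv₀0 : v₀ ≠ 0 := by
    rintro rfl
    simp at hv₀
  refine ⟨q v₀, hpos _ hv₀0, fun v ↦ ?_⟩
  rcases eq_or_ne v 0 with rfl | hv
  · have h0 := hhom 0 0
    simp at h0
    simp [h0]
  have hn : 0 < ‖v‖ := norm_pos_iff.2 hv
  have h1 : q v₀ ≤ q (‖v‖⁻¹ • v) := hmin (by simp [norm_smul, hn.ne'])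
  rw [hhom, inv_pow] at h1
  calc q v₀ * ‖v‖ ^ 2 ≤ (‖v‖ ^ 2)⁻¹ * q v * ‖v‖ ^ 2 :=
        mul_le_mul_of_nonneg_right h1 (by positivity)
    _ = q v := by field_simp

theorem apply₂_le (b : E →L[ℝ] E →L[ℝ] ℝ) (v w : E) : |b v w| ≤ ‖b‖ * ‖v‖ * ‖w‖ :=
  b.le_opNorm₂ v w

/-- A Lorentzian form becomes positive definite after its sign is changed on a timelike line. -/
theorem exists_pos_mul_norm_sq_le_add_sq [FiniteDimensional ℝ E] {b : E →L[ℝ] E →L[ℝ] ℝ}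
    {e : E} (he : b e e < 0) (hsymm : ∀ v w, b v w = b w v)
    (hpos : ∀ z, b e z = 0 → z ≠ 0 → 0 < b z z) :
    ∃ c > 0, ∀ v, c * ‖v‖ ^ 2 ≤ b v v + 2 / (-b e e) * (b v e) ^ 2 := by
  exact exists_pos_mul_norm_sq_le
    (q := fun v ↦ b v v + 2 / (-b e e) * (b v e) ^ 2) (by fun_prop)
    (fun t v ↦ by simp; ring) (fun v hv ↦ by
      -- decompose `v` into its components along `e` and orthogonal to `e`
      set a := b v e / b e e with ha
      have hae : a * b e e = b v e := div_mul_cancel₀ _ he.ne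
      have hz : b e (v - a • e) = 0 := by
        simp only [map_sub, map_smul, smul_eq_mul, hae, hsymm e v, sub_self]
      have hzz : b (v - a • e) (v - a • e) = b v v - a ^ 2 * b e e := by
        simp only [map_sub, map_smul, smul_eq_mul, sub_apply,
          smul_apply, hsymm e v, ← hae]
        ring
      have h2 : b v v + 2 / (-b e e) * (b v e) ^ 2 =
          b (v - a • e) (v - a • e) + a ^ 2 * (-b e e) := by
        rw [hzz, ← hae]
        field_simp
        ring
      rw [h2]
      by_cases hz0 : v - a • e = 0
      · have ha0 : a ≠ 0 := fun ha0 ↦ hv (by simpa [ha0] using hz0)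
        have := mul_pos (pow_pos (abs_pos.2 ha0) 2) (neg_pos.2 he)
        rw [sq_abs] at this
        simpa [hz0] using this
      · exact add_pos_of_pos_of_nonneg (hpos _ hz hz0)
          (mul_nonneg (sq_nonneg _) (neg_pos.2 he).le))

/-- Almost causal vectors of a Lorentzian form have a component along a timelike vector `e` which
is bounded below. -/
theorem exists_le_abs_of_almost_causal [FiniteDimensional ℝ E] {b : E →L[ℝ] E →L[ℝ] ℝ}
    {e : E} (he : b e e < 0) (hsymm : ∀ v w, b v w = b w v)
    (hpos : ∀ z, b e z = 0 → z ≠ 0 → 0 < b z z) :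
    ∃ m > 0, ∀ v, b v v ≤ m * ‖v‖ ^ 2 → m * ‖v‖ ≤ |b v e| := by
  obtain ⟨c, hc, hcq⟩ := exists_pos_mul_norm_sq_le_add_sq he hsymm hpos
  have hA : 0 < 2 / (-b e e) := div_pos two_pos (neg_pos.2 he)
  refine ⟨min (c / 2) (√(c / 2 / (2 / (-b e e)))), by positivity, fun v hv ↦ ?_⟩
  have h1 : b v v ≤ c / 2 * ‖v‖ ^ 2 :=
    hv.trans (mul_le_mul_of_nonneg_right (min_le_left _ _) (sq_nonneg _))
  have h2 := hcq v
  have h3 : c / 2 / (2 / (-b e e)) * ‖v‖ ^ 2 ≤ (b v e) ^ 2 := by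
    rw [div_mul_eq_mul_div, div_le_iff₀ hA]
    linarith
  calc min (c / 2) (√(c / 2 / (2 / (-b e e)))) * ‖v‖
      ≤ √(c / 2 / (2 / (-b e e))) * ‖v‖ :=
        mul_le_mul_of_nonneg_right (min_le_right _ _) (norm_nonneg _)
    _ ≤ |b v e| := by
        refine abs_le_of_sq_le_sq' ?_ (abs_nonneg _) |>.2
        rw [sq_abs, mul_pow, Real.sq_sqrt (by positivity)]
        exact h3

/-- Uniform estimates for the almost causal vectors of the forms `b` and the timelike vectors `τ`
in a neighbourhood of a Lorentzian form `b₀` and a timelike vector `e`. -/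
theorem exists_cone_estimates [FiniteDimensional ℝ E] {b₀ : E →L[ℝ] E →L[ℝ] ℝ}
    {e : E} (he : b₀ e e < 0) (hsymm : ∀ v w, b₀ v w = b₀ w v)
    (hpos : ∀ z, b₀ e z = 0 → z ≠ 0 → 0 < b₀ z z) :
    ∃ m > 0, ∃ κ > 0, ∀ (b : E →L[ℝ] E →L[ℝ] ℝ) (τ : E), ‖b - b₀‖ ≤ κ → ‖τ - e‖ ≤ κ →
      (∀ v, b v v ≤ κ * ‖v‖ ^ 2 → b v τ ≤ κ * ‖v‖ → 2 * m * ‖v‖ ≤ -b₀ v e) ∧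
      (∀ v, m * ‖v‖ ≤ -b₀ v e → b v e ≤ -(m / 2 * ‖v‖) ∧ b v τ ≤ -(m / 2 * ‖v‖)) ∧
      b e e < 0 ∧ b e τ < 0 := by
  obtain ⟨m, hm, hmv⟩ := exists_le_abs_of_almost_causal he hsymm hpos
  set D := 2 + ‖e‖ + ‖b₀‖ with hD
  have hD2 : 2 ≤ D := by have := norm_nonneg e; have := norm_nonneg b₀; linarith
  have hD0 : 0 < D := by linarith
  set κ := min 1 (m / 4 / D) with hκ
  have hκ0 : 0 < κ := by positivity
  have hκ1 : κ ≤ 1 := min_le_left _ _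
  have hκD : κ * D ≤ m / 4 := by
    rw [← le_div_iff₀ hD0]; exact min_le_right _ _
  have hκm : 2 * κ ≤ m := by nlinarith
  have he0 : 0 < ‖e‖ := norm_pos_iff.2 fun h ↦ by simp [h] at he
  refine ⟨m / 2, by positivity, κ, hκ0, fun b τ hb hτ ↦ ?_⟩
  -- `b v e` and `b v τ` are close to `b₀ v e`
  have diff (v : E) : |b v e - b₀ v e| ≤ m / 4 * ‖v‖ := by
    have h1 : b v e - b₀ v e = (b - b₀) v e := by simp
    rw [h1]
    calc |(b - b₀) v e| ≤ ‖b - b₀‖ * ‖v‖ * ‖e‖ := apply₂_le _ _ _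
      _ ≤ κ * ‖v‖ * D := by
        gcongr
        have := norm_nonneg b₀
        linarith
      _ = κ * D * ‖v‖ := by ring
      _ ≤ m / 4 * ‖v‖ := by gcongr
  have diffτ (v : E) : |b v τ - b₀ v e| ≤ m / 4 * ‖v‖ := by
    have h1 : b v τ - b₀ v e = (b - b₀) v e + (b - b₀) v (τ - e) + b₀ v (τ - e) := by
      simp only [sub_apply, map_sub]
      ring
    have h2 : |(b - b₀) v e| ≤ κ * ‖v‖ * ‖e‖ := (apply₂_le _ _ _).trans (by gcongr)
    have h3 : |(b - b₀) v (τ - e)| ≤ 1 * ‖v‖ * κ :=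
      (apply₂_le _ _ _).trans (by gcongr; exact hb.trans hκ1)
    have h4 : |b₀ v (τ - e)| ≤ ‖b₀‖ * ‖v‖ * κ := (apply₂_le _ _ _).trans (by gcongr)
    have h5 : κ * D * ‖v‖ ≤ m / 4 * ‖v‖ := by gcongr
    have h6 : 0 ≤ κ * ‖v‖ := by positivity
    rw [h1]
    refine (abs_add_three _ _ _).trans ?_
    rw [hD] at h5
    nlinarith
  have two (v : E) (hv : m / 2 * ‖v‖ ≤ -b₀ v e) :
      b v e ≤ -(m / 2 / 2 * ‖v‖) ∧ b v τ ≤ -(m / 2 / 2 * ‖v‖) := by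
    have h1 := (abs_le.1 (diff v)).2
    have h2 := (abs_le.1 (diffτ v)).2
    constructor <;> linarith
  refine ⟨fun v hv hvτ ↦ ?_, two, ?_⟩
  · have h1 : b₀ v v ≤ m * ‖v‖ ^ 2 := by
      have h2 : b₀ v v = b v v - (b - b₀) v v := by simp
      have h3 : |(b - b₀) v v| ≤ κ * ‖v‖ * ‖v‖ := (apply₂_le _ _ _).trans (by gcongr)
      have h4 := (abs_le.1 h3).1
      nlinarith [sq_nonneg ‖v‖]
    have h2 := hmv v h1
    rcases eq_or_ne v 0 with rfl | hv0
    · simp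
    have hn : 0 < ‖v‖ := norm_pos_iff.2 hv0
    have h3 : b₀ v e < m * ‖v‖ := by
      have := (abs_le.1 (diffτ v)).1
      nlinarith
    rcases le_abs'.1 h2 with h | h <;> linarith
  · have h1 : m * ‖e‖ ≤ -b₀ e e := by
      have := hmv e (he.le.trans (by positivity))
      rwa [abs_of_neg he] at this
    have h2 := two e (by nlinarith)
    have h3 : 0 < m / 2 / 2 * ‖e‖ := by positivity
    constructor <;> linarith [h2.1, h2.2]

end

/-! ### Subdivision of curves -/

/-- If each parameter `s` of a curve has a neighbourhood in which `R` relates the earlier points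
to `γ s` and `γ s` to the later points, then the endpoints are joined by an `R`-chain. -/
theorem transGen_of_forall_eventually {α : Type*} {R : α → α → Prop} {γ : ℝ → α} {a b : ℝ}
    (hab : a < b) (h : ∀ s ∈ Icc a b, ∀ᶠ s' in 𝓝[Icc a b] s,
      (s' < s → R (γ s') (γ s)) ∧ (s < s' → R (γ s) (γ s'))) :
    Relation.TransGen R (γ a) (γ b) := by
  set A : Set ℝ := {x | ∀ s, a < s → s ≤ x → Relation.TransGen R (γ a) (γ s)} with hA
  have hclosed : IsClosed (A ∩ Icc a b) := by
    refine isClosed_of_closure_subset fun x hx ↦ ?_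
    have hxab : x ∈ Icc a b := closure_minimal inter_subset_right isClosed_Icc hx
    refine ⟨fun s has hsx ↦ ?_, hxab⟩
    obtain ⟨δ, hδ, hball⟩ := Metric.mem_nhdsWithin_iff.1 (h x hxab)
    rcases hsx.lt_or_eq with hsx | rfl
    · obtain ⟨y, hy, hyA, -⟩ := mem_closure_iff.1 hx _ isOpen_Ioi hsx
      exact hyA s has (le_of_lt hy)
    · obtain ⟨y, ⟨hys, hay⟩, hyA, hyab⟩ := mem_closure_iff.1 hx _
        (Metric.isOpen_ball.inter isOpen_Ioi) ⟨Metric.mem_ball_self hδ, has⟩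
      rcases le_or_gt s y with hsy | hsy
      · exact hyA s has hsy
      · exact (hyA y hay le_rfl).tail ((hball ⟨hys, hyab⟩).1 hsy)
  refine hclosed.Icc_subset_of_forall_exists_gt
    (fun s has hsa ↦ absurd has hsa.not_gt) (fun x hx y hxy ↦ ?_)
    (right_mem_Icc.2 hab.le) b hab le_rfl
  obtain ⟨δ, hδ, hball⟩ := Metric.mem_nhdsWithin_iff.1 (h x ⟨hx.2.1, hx.2.2.le⟩)
  set w := min y (min (x + δ / 2) b) with hw
  have hxw : x < w := lt_min hxy (lt_min (by linarith) hx.2.2)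
  refine ⟨w, fun s has hsw ↦ ?_, hxw, min_le_left _ _⟩
  rcases le_or_gt s x with hsx | hsx
  · exact hx.1 s has hsx
  have hsδ : s ≤ x + δ / 2 := hsw.trans ((min_le_right _ _).trans (min_le_left _ _))
  have hsb : s ≤ b := hsw.trans ((min_le_right _ _).trans (min_le_right _ _))
  have hstep : R (γ x) (γ s) := by
    refine (hball ⟨?_, has.le, hsb⟩).2 hsx
    rw [Metric.mem_ball, Real.dist_eq, abs_of_pos (sub_pos.2 hsx)]
    linarith
  rcases hx.2.1.eq_or_lt with rfl | hax
  · exact .single hstep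
  · exact (hx.1 x hax le_rfl).tail hstep

/-! ### Perturbation of almost causal chains in a chart -/

section

variable {n : ℕ} {k : ℕ∞} {M : Type u} [TopologicalSpace M]
  [ChartedSpace (EuclideanSpace ℝ (Fin n)) M]
  [IsManifold (𝓘(ℝ, EuclideanSpace ℝ (Fin n))) ∞ M]

local notation "𝔼" => EuclideanSpace ℝ (Fin n)
local notation "φ[" p "]" => extChartAt (𝓘(ℝ, EuclideanSpace ℝ (Fin n))) p

namespace TimeOrientedMetric

/-- The timelike direction at the centre of the chart at `p`. -/
noncomputable def axis (S : TimeOrientedMetric n k M) (p : M) : 𝔼 :=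
  S.timeCoord p (φ[p] p)

/-- A linear function on the model space which is positive on the future causal vectors at the
centre of the chart at `p`. -/
noncomputable def height (S : TimeOrientedMetric n k M) (p : M) (v : 𝔼) : ℝ :=
  -S.metric.coord p (φ[p] p) v (S.axis p)

theorem height_add (S : TimeOrientedMetric n k M) (p : M) (v w : 𝔼) :
    S.height p (v + w) = S.height p v + S.height p w := by
  simp [height]; ring

theorem height_smul (S : TimeOrientedMetric n k M) (p : M) (c : ℝ) (v : 𝔼) :
    S.height p (c • v) = c * S.height p v := by
  simp [height]

theorem continuous_height (S : TimeOrientedMetric n k M) (p : M) : Continuous (S.height p) := by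
  unfold height; fun_prop

theorem abs_height_le (S : TimeOrientedMetric n k M) (p : M) (v : 𝔼) :
    |S.height p v| ≤ ‖S.metric.coord p (φ[p] p)‖ * ‖S.axis p‖ * ‖v‖ := by
  rw [height, abs_neg]
  exact (apply₂_le _ _ _).trans_eq (by ring)

/-- A ball around the centre of a chart in which the metric is Lipschitz and the cones of almost
causal vectors are uniformly controlled by the linear function `height`. -/
structure GoodChart (S : TimeOrientedMetric n k M) (p : M) (r m κ L : ℝ) : Prop where
  r_pos : 0 < r
  m_pos : 0 < m
  κ_pos : 0 < κ
  L_nonneg : 0 ≤ L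
  subset_target : Metric.closedBall (φ[p] p) r ⊆ (φ[p]).target
  lipschitz : ∀ y ∈ Metric.closedBall (φ[p] p) r, ∀ z ∈ Metric.closedBall (φ[p] p) r,
    ‖S.metric.coord p y - S.metric.coord p z‖ ≤ L * ‖y - z‖
  le_height : ∀ y ∈ Metric.closedBall (φ[p] p) r, ∀ v, S.metric.coord p y v v ≤ κ * ‖v‖ ^ 2 →
    S.metric.coord p y v (S.timeCoord p y) ≤ κ * ‖v‖ → 2 * m * ‖v‖ ≤ S.height p v
  of_le_height : ∀ y ∈ Metric.closedBall (φ[p] p) r, ∀ v, m * ‖v‖ ≤ S.height p v →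
    S.metric.coord p y v (S.axis p) ≤ -(m / 2 * ‖v‖) ∧
      S.metric.coord p y v (S.timeCoord p y) ≤ -(m / 2 * ‖v‖)
  axis_timelike : ∀ y ∈ Metric.closedBall (φ[p] p) r, S.CoordTimelike p y (S.axis p)

theorem coord_center_axis_neg (S : TimeOrientedMetric n k M) (p : M) :
    S.metric.coord p (φ[p] p) (S.axis p) (S.axis p) < 0 := by
  have hp := mem_chart_source 𝔼 p
  rw [S.metric.coord_extChartAt hp, axis, timeCoord, S.metric.atChart_apply (by simp),
    extChartAt_to_inv, ofChart_toChart hp]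
  exact S.timelike_timeField p

theorem coord_center_pos (S : TimeOrientedMetric n k M) (p : M) {z : 𝔼}
    (h : S.metric.coord p (φ[p] p) (S.axis p) z = 0) (hz : z ≠ 0) :
    0 < S.metric.coord p (φ[p] p) z z := by
  have hp := mem_chart_source 𝔼 p
  rw [S.metric.coord_extChartAt hp, S.metric.atChart_apply hp] at h ⊢
  refine pos_of_orthogonal_timelike (S.metric.symm p) (S.metric.signature p) ?_ h fun h0 ↦ hz ?_
  · have := S.coord_center_axis_neg p
    rwa [S.metric.coord_extChartAt hp, S.metric.atChart_apply hp] at this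
  · rw [← toChart_ofChart hp z, h0, map_zero]

theorem exists_goodChart (hk : 1 ≤ k) (S : TimeOrientedMetric n k M) (p : M) {U : Set 𝔼}
    (hU : U ∈ 𝓝 (φ[p] p)) :
    ∃ r m κ L, S.GoodChart p r m κ L ∧ Metric.closedBall (φ[p] p) r ⊆ U := by
  obtain ⟨m, hm, κ, hκ, hest⟩ := exists_cone_estimates (S.coord_center_axis_neg p)
    (S.metric.coord_symm (mem_extChartAt_target p)) fun z h hz ↦ S.coord_center_pos p h hz
  have hcd := S.metric.contDiffAt_coord hk p
  obtain ⟨L, t, ht, hL⟩ := hcd.exists_lipschitzOnWith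
  have h1 : ∀ᶠ y in 𝓝 (φ[p] p), ‖S.metric.coord p y - S.metric.coord p (φ[p] p)‖ ≤ κ := by
    filter_upwards [Metric.tendsto_nhds.1 hcd.continuousAt.tendsto κ hκ] with y hy
    rw [dist_eq_norm] at hy
    exact hy.le
  have h2 : ∀ᶠ y in 𝓝 (φ[p] p), ‖S.timeCoord p y - S.axis p‖ ≤ κ := by
    filter_upwards [Metric.tendsto_nhds.1 (S.continuousAt_timeCoord p).tendsto κ hκ] with y hy
    rw [dist_eq_norm] at hy
    exact hy.le
  obtain ⟨r, hr, hball⟩ := Metric.nhds_basis_closedBall.mem_iff.1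
    (Filter.inter_mem (Filter.inter_mem (h1.and h2) ht)
      (Filter.inter_mem (extChartAt_target_mem_nhds (I := 𝓘(ℝ, 𝔼)) p) hU))
  have hest' (y) (hy : y ∈ Metric.closedBall (φ[p] p) r) :=
    hest _ _ (hball hy).1.1.1 (hball hy).1.1.2
  exact ⟨r, m, κ, L, {
    r_pos := hr
    m_pos := hm
    κ_pos := hκ
    L_nonneg := L.2
    subset_target := fun y hy ↦ (hball hy).2.1
    lipschitz := fun y hy z hz ↦ by
      simpa [dist_eq_norm] using hL.dist_le_mul y (hball hy).1.2 z (hball hz).1.2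
    le_height := fun y hy ↦ (hest' y hy).1
    of_le_height := fun y hy ↦ (hest' y hy).2.1
    axis_timelike := fun y hy ↦ (hest' y hy).2.2 }, fun y hy ↦ (hball hy).2.2⟩

/-- A small almost causal step inside half of a good chart; `ε` bounds both the length of the
step and the failure to be causal. -/
def AlmostCausalStep (S : TimeOrientedMetric n k M) (p : M) (r m ε : ℝ) (a b : 𝔼) : Prop :=
  a ∈ Metric.closedBall (φ[p] p) (r / 2) ∧ b ∈ Metric.closedBall (φ[p] p) (r / 2) ∧ a ≠ b ∧
    ‖b - a‖ ≤ ε ∧ S.metric.coord p a (b - a) (b - a) ≤ ε * ‖b - a‖ ^ 2 ∧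
    m * ‖b - a‖ ≤ S.height p (b - a)

variable {S : TimeOrientedMetric n k M} {p : M} {r m κ L : ℝ}

theorem GoodChart.half_subset (hG : S.GoodChart p r m κ L) :
    Metric.closedBall (φ[p] p) (r / 2) ⊆ Metric.closedBall (φ[p] p) r :=
  Metric.closedBall_subset_closedBall (by linarith [hG.r_pos])

theorem GoodChart.timelikeSegment (hG : S.GoodChart p r m κ L) {a b : 𝔼}
    (ha : a ∈ Metric.closedBall (φ[p] p) r) (hb : b ∈ Metric.closedBall (φ[p] p) r)
    (h : ∀ z ∈ segment ℝ a b, z ∈ Metric.closedBall (φ[p] p) r → S.CoordTimelike p z (b - a)) :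
    S.TimelikeSegment ((φ[p]).symm a) ((φ[p]).symm b) := by
  have hseg := (convex_closedBall (φ[p] p) r).segment_subset ha hb
  exact S.timelikeSegment_of_coordTimelike (hseg.trans hG.subset_target)
    fun y hy ↦ h y hy (hseg hy)

theorem GoodChart.timelikeSegment_axis (hG : S.GoodChart p r m κ L) {a b : 𝔼} {c : ℝ}
    (hc : 0 < c) (hab : b - a = c • S.axis p)
    (ha : a ∈ Metric.closedBall (φ[p] p) r) (hb : b ∈ Metric.closedBall (φ[p] p) r) :
    S.TimelikeSegment ((φ[p]).symm a) ((φ[p]).symm b) := by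
  refine hG.timelikeSegment ha hb fun z _ hz ↦ ?_
  obtain ⟨h1, h2⟩ := hG.axis_timelike z hz
  rw [hab]
  constructor
  · simp only [map_smul, smul_apply, smul_eq_mul]
    exact mul_neg_of_pos_of_neg hc (mul_neg_of_pos_of_neg hc h1)
  · simp only [map_smul, smul_apply, smul_eq_mul]
    exact mul_neg_of_pos_of_neg hc h2

/-- Adding a sufficient multiple of the axis to an almost causal vector makes it timelike, also
at nearby points. -/
theorem GoodChart.coordTimelike_add_axis (hG : S.GoodChart p r m κ L) {a u z : 𝔼}
    {ε η D c : ℝ} (ha : a ∈ Metric.closedBall (φ[p] p) r)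
    (hz : z ∈ Metric.closedBall (φ[p] p) r) (hu : u ≠ 0)
    (hau : S.metric.coord p a u u ≤ ε * ‖u‖ ^ 2) (hh : m * ‖u‖ ≤ S.height p u) (hεη : ε ≤ η)
    (hza : ‖z - a‖ ≤ D * η) (hc : 0 < c) (hcη : (1 + L * D) * η * ‖u‖ < c * m) :
    S.CoordTimelike p z (u + c • S.axis p) := by
  have hu0 : 0 < ‖u‖ := norm_pos_iff.2 hu
  obtain ⟨h1, h2⟩ := hG.of_le_height z hz u hh
  obtain ⟨h3, h4⟩ := hG.axis_timelike z hz
  have hm := hG.m_pos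
  constructor
  · have h5 : S.metric.coord p z u u ≤ (1 + L * D) * η * ‖u‖ ^ 2 := by
      have h6 : S.metric.coord p z u u = S.metric.coord p a u u +
          (S.metric.coord p z - S.metric.coord p a) u u := by simp
      have h7 : (S.metric.coord p z - S.metric.coord p a) u u ≤ L * (D * η) * ‖u‖ * ‖u‖ :=
        (le_abs_self _).trans <| (apply₂_le _ _ _).trans <| by
          have := (hG.lipschitz z hz a ha).trans (mul_le_mul_of_nonneg_left hza hG.L_nonneg)
          gcongr
      have h8 : ε * ‖u‖ ^ 2 ≤ η * ‖u‖ ^ 2 := by gcongr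
      rw [h6]
      nlinarith
    have h6 : S.metric.coord p z (u + c • S.axis p) (u + c • S.axis p) =
        S.metric.coord p z u u + 2 * c * S.metric.coord p z u (S.axis p) +
          c ^ 2 * S.metric.coord p z (S.axis p) (S.axis p) := by
      simp only [map_add, map_smul, add_apply, smul_apply, smul_eq_mul,
        S.metric.coord_symm (hG.subset_target hz) (S.axis p) u]
      ring
    have h7 : c * S.metric.coord p z u (S.axis p) ≤ c * -(m / 2 * ‖u‖) :=
      mul_le_mul_of_nonneg_left h1 hc.le
    have h8 : c ^ 2 * S.metric.coord p z (S.axis p) (S.axis p) < 0 :=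
      mul_neg_of_pos_of_neg (by positivity) h3
    have h9 : (1 + L * D) * η * ‖u‖ * ‖u‖ < c * m * ‖u‖ := mul_lt_mul_of_pos_right hcη hu0
    rw [h6]
    nlinarith
  · have h5 : S.metric.coord p z (u + c • S.axis p) (S.timeCoord p z) =
        S.metric.coord p z u (S.timeCoord p z) +
          c * S.metric.coord p z (S.axis p) (S.timeCoord p z) := by
      simp only [map_add, map_smul, add_apply, smul_apply, smul_eq_mul]
    have h6 : 0 < m / 2 * ‖u‖ := by positivity
    have h7 := mul_neg_of_pos_of_neg hc h4
    rw [h5]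
    linarith

theorem exp_sign_estimates {σ h : ℝ} (hσ : σ = 1 ∨ σ = -1) (h0 : 0 ≤ h) (h1 : h ≤ 1) :
    h / 3 ≤ σ * (Real.exp (σ * h) - 1) ∧ Real.exp (σ * h) ≤ 3 := by
  have he : Real.exp h ≤ 3 :=
    (Real.exp_le_exp.2 h1).trans (Real.exp_one_lt_d9.le.trans (by norm_num))
  have hle := Real.add_one_le_exp h
  rcases hσ with rfl | rfl
  · rw [one_mul, one_mul]
    exact ⟨by linarith, he⟩
  · have hneg : Real.exp (-1 * h) * Real.exp h = 1 := by rw [← Real.exp_add]; simp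
    have hpos := Real.exp_pos (-1 * h)
    have hlow : 1 / 3 ≤ Real.exp (-1 * h) := by nlinarith
    have : Real.exp (-1 * h) ≤ 1 := by nlinarith
    refine ⟨?_, by linarith⟩
    nlinarith

/-- The size of the displacement used to make almost causal chains timelike. -/
noncomputable def growth (S : TimeOrientedMetric n k M) (p : M) (σ Λ ρ : ℝ) (y : 𝔼) : ℝ :=
  ρ * Real.exp (σ * (Λ * S.height p (y - φ[p] p)))

/-- Displacement of the points of the model space along the axis, forward for `σ = 1` and
backward for `σ = -1`. -/
noncomputable def displace (S : TimeOrientedMetric n k M) (p : M) (σ Λ ρ : ℝ) (y : 𝔼) : 𝔼 :=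
  y + (σ * S.growth p σ Λ ρ y) • S.axis p

theorem growth_pos (S : TimeOrientedMetric n k M) (p : M) (σ Λ : ℝ) {ρ : ℝ} (hρ : 0 < ρ)
    (y : 𝔼) : 0 < S.growth p σ Λ ρ y :=
  mul_pos hρ (Real.exp_pos _)

theorem norm_displace_sub (S : TimeOrientedMetric n k M) (p : M) {σ : ℝ} (Λ : ℝ) {ρ : ℝ}
    (hσ : σ = 1 ∨ σ = -1) (hρ : 0 < ρ) (y : 𝔼) :
    ‖S.displace p σ Λ ρ y - y‖ = S.growth p σ Λ ρ y * ‖S.axis p‖ := by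
  have h1 : S.displace p σ Λ ρ y - y = (σ * S.growth p σ Λ ρ y) • S.axis p := by simp [displace]
  rw [h1, norm_smul, Real.norm_eq_abs, abs_mul, abs_of_pos (S.growth_pos p σ Λ hρ y)]
  rcases hσ with rfl | rfl <;> simp

theorem growth_add (S : TimeOrientedMetric n k M) (p : M) (σ Λ ρ : ℝ) (a b : 𝔼) :
    S.growth p σ Λ ρ b =
      S.growth p σ Λ ρ a * Real.exp (σ * (Λ * S.height p (b - a))) := by
  have h1 : b - φ[p] p = (a - φ[p] p) + (b - a) := by abel
  rw [growth, growth, h1, S.height_add, mul_add, mul_add, Real.exp_add, mul_assoc]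

/-- The displacement maps almost causal steps to timelike segments. The growth of the
displacement along a step makes up for the failure of the step to be causal and, since the metric
is Lipschitz, for the change of the metric caused by the displacement. -/
theorem GoodChart.timelikeSegment_displace (hG : S.GoodChart p r m κ L) {σ Λ ρ ε : ℝ} {a b : 𝔼}
    (hσ : σ = 1 ∨ σ = -1) (hΛ : 0 < Λ)
    (hΛm : 3 * (1 + L * (1 + 3 * ‖S.axis p‖)) < Λ * m ^ 2) (hρ : 0 < ρ)
    (hab : S.AlmostCausalStep p r m ε a b) (hε : ε ≤ S.growth p σ Λ ρ a)
    (hε1 : Λ * (‖S.metric.coord p (φ[p] p)‖ * ‖S.axis p‖ * ε) ≤ 1)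
    (hΨa : S.displace p σ Λ ρ a ∈ Metric.closedBall (φ[p] p) r)
    (hΨb : S.displace p σ Λ ρ b ∈ Metric.closedBall (φ[p] p) r) :
    S.TimelikeSegment ((φ[p]).symm (S.displace p σ Λ ρ a))
      ((φ[p]).symm (S.displace p σ Λ ρ b)) := by
  have hm := hG.m_pos
  obtain ⟨ha, hb, hne, hlen, hcau, hht⟩ := hab
  have hFb := S.growth_add p σ Λ ρ a b
  have hna := S.norm_displace_sub p Λ hσ hρ a
  have hnb := S.norm_displace_sub p Λ hσ hρ b
  have hη0 : 0 < S.growth p σ Λ ρ a := S.growth_pos p σ Λ hρ a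
  have hdir : S.displace p σ Λ ρ b - S.displace p σ Λ ρ a = (b - a) +
      (σ * S.growth p σ Λ ρ b - σ * S.growth p σ Λ ρ a) • S.axis p := by
    simp only [displace]
    module
  rw [hFb] at hdir hnb
  generalize S.growth p σ Λ ρ a = η at *
  generalize S.displace p σ Λ ρ a = a' at *
  generalize S.displace p σ Λ ρ b = b' at *
  set u := b - a with hu
  have hu0 : u ≠ 0 := sub_ne_zero.2 hne.symm
  have hun : 0 < ‖u‖ := norm_pos_iff.2 hu0
  set h := Λ * S.height p u with hh
  have hh0 : 0 < h := mul_pos hΛ ((mul_pos hm hun).trans_le hht)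
  have hh1 : h ≤ 1 := by
    have h1 := (le_abs_self _).trans (S.abs_height_le p u)
    refine le_trans ?_ hε1
    rw [hh]
    gcongr
    exact h1.trans (by gcongr)
  obtain ⟨hexp1, hexp2⟩ := exp_sign_estimates hσ hh0.le hh1
  set c := σ * (η * Real.exp (σ * h)) - σ * η with hc
  have hc3 : η * (h / 3) ≤ c := by
    have := mul_le_mul_of_nonneg_left hexp1 hη0.le
    rw [hc]
    linarith
  have hc0 : 0 < c := (by positivity : 0 < η * (h / 3)).trans_le hc3
  have hΨa' : ‖a' - a‖ ≤ (1 + 3 * ‖S.axis p‖) * η := by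
    rw [hna]
    nlinarith [norm_nonneg (S.axis p)]
  have hΨb' : ‖b' - a‖ ≤ (1 + 3 * ‖S.axis p‖) * η := by
    calc ‖b' - a‖ = ‖(b' - b) + u‖ := by congr 1; rw [hu]; abel
      _ ≤ ‖b' - b‖ + ‖u‖ := norm_add_le _ _
      _ ≤ η * 3 * ‖S.axis p‖ + η := by
          rw [hnb]
          have := hlen.trans hε
          gcongr
      _ = _ := by ring
  refine hG.timelikeSegment hΨa hΨb fun z hz hzr ↦ ?_
  rw [hdir]
  have hza : ‖z - a‖ ≤ (1 + 3 * ‖S.axis p‖) * η := by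
    rw [← mem_closedBall_iff_norm] at hΨa' hΨb' ⊢
    exact (convex_closedBall a _).segment_subset hΨa' hΨb' hz
  refine hG.coordTimelike_add_axis (hG.half_subset ha) hzr hu0 hcau hht hε hza hc0 ?_
  have h1 : η * (Λ * (m * ‖u‖) / 3) * m ≤ c * m := by
    refine mul_le_mul_of_nonneg_right (le_trans ?_ hc3) hm.le
    rw [hh]
    gcongr
  have h2 := mul_lt_mul_of_pos_right hΛm (by positivity : 0 < η * ‖u‖ / 3)
  linarith

theorem GoodChart.growth_bounds (hG : S.GoodChart p r m κ L) {σ Λ ε : ℝ}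
    (hσ : σ = 1 ∨ σ = -1) (hΛ : 0 < Λ) (hε : 0 < ε) {K : ℝ}
    (hK : K = Real.exp (Λ * (‖S.metric.coord p (φ[p] p)‖ * ‖S.axis p‖ * r))) {y : 𝔼}
    (hy : y ∈ Metric.closedBall (φ[p] p) (r / 2)) :
    ε ≤ S.growth p σ Λ (K * ε) y ∧ S.growth p σ Λ (K * ε) y ≤ K ^ 2 * ε := by
  have hr := hG.r_pos
  have hK0 : 0 < K := hK ▸ Real.exp_pos _
  have h1 : |S.height p (y - φ[p] p)| ≤ ‖S.metric.coord p (φ[p] p)‖ * ‖S.axis p‖ * r := by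
    refine (S.abs_height_le p _).trans ?_
    rw [mem_closedBall_iff_norm] at hy
    gcongr
    linarith
  have h2 : |σ * (Λ * S.height p (y - φ[p] p))| ≤
      Λ * (‖S.metric.coord p (φ[p] p)‖ * ‖S.axis p‖ * r) := by
    rw [abs_mul, abs_mul, abs_of_pos hΛ]
    rcases hσ with rfl | rfl <;> simp only [abs_one, abs_neg, one_mul] <;> gcongr
  obtain ⟨h3, h4⟩ := abs_le.1 h2
  have h5 := Real.exp_le_exp.2 h3
  have h6 := Real.exp_le_exp.2 h4
  rw [Real.exp_neg, ← hK] at h5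
  rw [← hK] at h6
  constructor
  · calc ε = K * ε * K⁻¹ := by field_simp
      _ ≤ _ := mul_le_mul_of_nonneg_left h5 (by positivity)
  · calc _ ≤ K * ε * K := mul_le_mul_of_nonneg_left h6 (by positivity)
      _ = K ^ 2 * ε := by ring

/-- Chains of almost causal steps are close to timelike curves. With a forward displacement the
initial point of the chain is in the past of the displaced chain, with a backward displacement
the final point is in its future. -/
theorem GoodChart.exists_perturbation (hG : S.GoodChart p r m κ L) :
    ∃ C > 0, ∃ ε₀ > 0, ∀ ε, 0 < ε → ε < ε₀ → ∀ a b, a ∈ Metric.closedBall (φ[p] p) (r / 2) →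
      Relation.ReflTransGen (S.AlmostCausalStep p r m ε) a b →
      (∃ b', ‖b' - b‖ ≤ C * ε ∧ b' ∈ Metric.closedBall (φ[p] p) r ∧
        ((φ[p]).symm a, (φ[p]).symm b') ∈ S.chronological) ∧
      ∃ a', ‖a' - a‖ ≤ C * ε ∧ a' ∈ Metric.closedBall (φ[p] p) r ∧
        ((φ[p]).symm a', (φ[p]).symm b) ∈ S.chronological := by
  have hm := hG.m_pos
  have hr := hG.r_pos
  have hL := hG.L_nonneg
  -- the growth rate needed by `timelikeSegment_displace`
  obtain ⟨Λ, hΛ0, hΛm⟩ : ∃ Λ > 0, 3 * (1 + L * (1 + 3 * ‖S.axis p‖)) < Λ * m ^ 2 := by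
    refine ⟨3 * (1 + L * (1 + 3 * ‖S.axis p‖)) / m ^ 2 + 1, by positivity, ?_⟩
    rw [add_mul, div_mul_cancel₀ _ (by positivity)]
    have : 0 < m ^ 2 := by positivity
    linarith
  -- the displacement varies by a factor of at most `K ^ 2` over the ball, so that its size stays
  -- between `ε` and `K ^ 2 * ε`
  obtain ⟨K, hK⟩ :
    ∃ K, K = Real.exp (Λ * (‖S.metric.coord p (φ[p] p)‖ * ‖S.axis p‖ * r)) := ⟨_, rfl⟩
  have hK0 : 0 < K := hK ▸ Real.exp_pos _
  have hN0 : 0 ≤ ‖S.metric.coord p (φ[p] p)‖ * ‖S.axis p‖ := by positivity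
  set N := ‖S.metric.coord p (φ[p] p)‖ * ‖S.axis p‖ with hN
  refine ⟨K ^ 2 * ‖S.axis p‖ + 1, by positivity,
    min (1 / (Λ * N + 1)) (r / (2 * (K ^ 2 * ‖S.axis p‖ + 1))),
    by positivity, fun ε hε0 hε a b ha hab ↦ ?_⟩
  have hε1 : Λ * (N * ε) ≤ 1 := by
    have := hε.trans_le (min_le_left _ _)
    rw [lt_div_iff₀ (by positivity)] at this
    linarith
  have hε2 : (K ^ 2 * ‖S.axis p‖ + 1) * ε ≤ r / 2 := by
    have := hε.le.trans (min_le_right _ _)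
    rw [le_div_iff₀ (by positivity)] at this
    linarith
  have hKε : 0 < K * ε := by positivity
  have hCε {σ : ℝ} (hσ : σ = 1 ∨ σ = -1) {y : 𝔼}
      (hy : y ∈ Metric.closedBall (φ[p] p) (r / 2)) :
      ‖S.displace p σ Λ (K * ε) y - y‖ ≤ (K ^ 2 * ‖S.axis p‖ + 1) * ε := by
    rw [S.norm_displace_sub p Λ hσ hKε y]
    have := mul_le_mul_of_nonneg_right (hG.growth_bounds hσ hΛ0 hε0 hK hy).2
      (norm_nonneg (S.axis p))
    linarith
  have hmem {σ : ℝ} (hσ : σ = 1 ∨ σ = -1) {y : 𝔼}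
      (hy : y ∈ Metric.closedBall (φ[p] p) (r / 2)) :
      S.displace p σ Λ (K * ε) y ∈ Metric.closedBall (φ[p] p) r := by
    have h1 := hCε hσ hy
    rw [mem_closedBall_iff_norm] at hy ⊢
    calc _ = ‖(S.displace p σ Λ (K * ε) y - y) + (y - φ[p] p)‖ := by congr 1; abel
      _ ≤ _ := norm_add_le _ _
      _ ≤ r := by linarith
  have hstep {σ : ℝ} (hσ : σ = 1 ∨ σ = -1) (x y : 𝔼) (hxy : S.AlmostCausalStep p r m ε x y) :
      S.TimelikeSegment ((φ[p]).symm (S.displace p σ Λ (K * ε) x))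
        ((φ[p]).symm (S.displace p σ Λ (K * ε) y)) :=
    hG.timelikeSegment_displace hσ hΛ0 hΛm hKε hxy
      (hG.growth_bounds hσ hΛ0 hε0 hK hxy.1).1 hε1 (hmem hσ hxy.1) (hmem hσ hxy.2.1)
  have hb : b ∈ Metric.closedBall (φ[p] p) (r / 2) := by
    rcases hab.cases_tail with rfl | ⟨c, -, hcb⟩
    exacts [ha, hcb.2.1]
  refine ⟨⟨_, hCε (.inl rfl) hb, hmem (.inl rfl) hb, ?_⟩,
    ⟨_, hCε (.inr rfl) ha, hmem (.inr rfl) ha, ?_⟩⟩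
  · refine Relation.TransGen.head' ?_
      (hab.lift (fun y ↦ (φ[p]).symm (S.displace p 1 Λ (K * ε) y)) (hstep (.inl rfl)))
    refine hG.timelikeSegment_axis (S.growth_pos p 1 Λ hKε a) ?_
      (hG.half_subset ha) (hmem (.inl rfl) ha)
    simp [displace]
  · refine Relation.TransGen.tail'
      (hab.lift (fun y ↦ (φ[p]).symm (S.displace p (-1) Λ (K * ε) y)) (hstep (.inr rfl))) ?_
    refine hG.timelikeSegment_axis (S.growth_pos p (-1) Λ hKε b) ?_
      (hmem (.inr rfl) hb) (hG.half_subset hb)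
    simp [displace]

end TimeOrientedMetric

end

/-! ### Openness of the chronological relation and the push-up property -/

theorem _root_.HasDerivWithinAt.eventually_slope_mem {E : Type*} [NormedAddCommGroup E]
    [NormedSpace ℝ E] {c : ℝ → E} {v : E} {A : Set ℝ} {s : ℝ} (h : HasDerivWithinAt c v A s)
    {O : Set E} (hO : O ∈ 𝓝 v) : ∀ᶠ s' in 𝓝[A] s, s' ≠ s → slope c s s' ∈ O := by
  have h1 := (hasDerivWithinAt_iff_tendsto_slope.1 h).eventually_mem hO
  rw [eventually_nhdsWithin_iff] at h1 ⊢
  filter_upwards [h1] with s' hs' hA hne using hs' ⟨hA, hne⟩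

section

variable {n : ℕ} {k : ℕ∞} {M : Type u} [TopologicalSpace M]
  [ChartedSpace (EuclideanSpace ℝ (Fin n)) M]
  [IsManifold (𝓘(ℝ, EuclideanSpace ℝ (Fin n))) ∞ M]

local notation "𝔼" => EuclideanSpace ℝ (Fin n)
local notation "φ[" p "]" => extChartAt (𝓘(ℝ, EuclideanSpace ℝ (Fin n))) p

namespace TimeOrientedMetric

theorem CoordTimelike.smul {S : TimeOrientedMetric n k M} {p : M} {y v : 𝔼}
    (h : S.CoordTimelike p y v) {c : ℝ} (hc : 0 < c) : S.CoordTimelike p y (c • v) := by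
  constructor
  · simp only [map_smul, smul_apply, smul_eq_mul]
    exact mul_neg_of_pos_of_neg hc (mul_neg_of_pos_of_neg hc h.1)
  · simp only [map_smul, smul_apply, smul_eq_mul]
    exact mul_neg_of_pos_of_neg hc h.2

theorem eventually_coordTimelike (hk : 1 ≤ k) (S : TimeOrientedMetric n k M) {p : M} {v : 𝔼}
    (h : S.CoordTimelike p (φ[p] p) v) :
    ∀ᶠ x : 𝔼 × 𝔼 in 𝓝 (φ[p] p, v), x.1 ∈ (φ[p]).target ∧ S.CoordTimelike p x.1 x.2 := by
  have h1 : ContinuousAt (fun x : 𝔼 × 𝔼 ↦ S.metric.coord p x.1) (φ[p] p, v) :=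
    ContinuousAt.comp (g := S.metric.coord p) (f := Prod.fst)
      (S.metric.contDiffAt_coord hk p).continuousAt continuousAt_fst
  have h2 : ContinuousAt (fun x : 𝔼 × 𝔼 ↦ S.timeCoord p x.1) (φ[p] p, v) :=
    ContinuousAt.comp (g := S.timeCoord p) (f := Prod.fst)
      (S.continuousAt_timeCoord p) continuousAt_fst
  have h3 := (h1.clm_apply continuousAt_snd).clm_apply continuousAt_snd
  have h4 := (h1.clm_apply continuousAt_snd).clm_apply h2
  have h5 : ∀ᶠ x : 𝔼 × 𝔼 in 𝓝 (φ[p] p, v), x.1 ∈ (φ[p]).target :=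
    continuousAt_fst.preimage_mem_nhds (extChartAt_target_mem_nhds (I := 𝓘(ℝ, 𝔼)) p)
  filter_upwards [h5,
    h3.eventually_lt_const h.1, h4.eventually_lt_const h.2] with x hx hx1 hx2 using ⟨hx, hx1, hx2⟩

theorem IsFutureTimelike.coordTimelike {S : TimeOrientedMetric n k M} {p q : M}
    (hq : q ∈ (chartAt 𝔼 p).source)
    {v : TangentSpace (𝓘(ℝ, EuclideanSpace ℝ (Fin n))) q} (h : S.IsFutureTimelike v) :
    S.CoordTimelike p (φ[p] q) (toChart p q v) := by
  have hinv : (φ[p]).symm (φ[p] q) = q := (φ[p]).left_inv (by rwa [extChartAt_source])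
  constructor
  · rw [S.metric.coord_extChartAt hq, ← S.metric.form_eq_atChart hq]
    exact h.1
  · rw [S.metric.coord_extChartAt hq, timeCoord, hinv, ← S.metric.form_eq_atChart hq]
    exact h.2

theorem IsFutureCausal.coord {S : TimeOrientedMetric n k M} {p q : M}
    (hq : q ∈ (chartAt 𝔼 p).source)
    {v : TangentSpace (𝓘(ℝ, EuclideanSpace ℝ (Fin n))) q} (h : S.IsFutureCausal v) :
    toChart p q v ≠ 0 ∧ S.metric.coord p (φ[p] q) (toChart p q v) (toChart p q v) ≤ 0 ∧
      S.metric.coord p (φ[p] q) (toChart p q v) (S.timeCoord p (φ[p] q)) < 0 := by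
  have hinv : (φ[p]).symm (φ[p] q) = q := (φ[p]).left_inv (by rwa [extChartAt_source])
  refine ⟨fun h0 ↦ h.1.1 ?_, ?_, ?_⟩
  · rw [← ofChart_toChart hq v, h0, map_zero]
  · rw [S.metric.coord_extChartAt hq, ← S.metric.form_eq_atChart hq]
    exact h.1.2
  · rw [S.metric.coord_extChartAt hq, timeCoord, hinv, ← S.metric.form_eq_atChart hq]
    exact h.2

theorem IsFutureTimelike.isFutureCausal {S : TimeOrientedMetric n k M} {q : M}
    {v : TangentSpace (𝓘(ℝ, EuclideanSpace ℝ (Fin n))) q} (h : S.IsFutureTimelike v) :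
    S.IsFutureCausal v :=
  ⟨⟨fun h0 ↦ by
    have := h.1
    rw [LorentzMetric.IsTimelike, h0, map_zero] at this
    exact lt_irrefl _ this, h.1.le⟩, h.2⟩

/-- Near a parameter at which a curve is timelike, its earlier points can be joined to all points
near `γ s` by straight timelike segments, and similarly for its later points. -/
theorem eventually_timelikeSegment (hk : 1 ≤ k) (S : TimeOrientedMetric n k M) {γ : ℝ → M}
    (hγ : ContMDiffOn 𝓘(ℝ, ℝ) (𝓘(ℝ, EuclideanSpace ℝ (Fin n))) 1 γ (Icc 0 1)) {s : ℝ}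
    (hs : s ∈ Icc (0 : ℝ) 1)
    (ht : S.IsFutureTimelike
      (mfderivWithin 𝓘(ℝ, ℝ) (𝓘(ℝ, EuclideanSpace ℝ (Fin n))) γ (Icc 0 1) s (1 : ℝ))) :
    ∀ᶠ s' in 𝓝[Icc 0 1] s,
      (s' < s → ∀ᶠ z in 𝓝 (γ s), S.TimelikeSegment (γ s') z) ∧
      (s < s' → ∀ᶠ z in 𝓝 (γ s), S.TimelikeSegment z (γ s')) := by
  have hp : γ s ∈ (chartAt 𝔼 (γ s)).source := mem_chart_source 𝔼 (γ s)
  have hd := hasDerivWithinAt_extChartAt_comp hγ hs hp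
  set v := toChart (γ s) (γ s)
    (mfderivWithin 𝓘(ℝ, ℝ) (𝓘(ℝ, EuclideanSpace ℝ (Fin n))) γ (Icc 0 1) s (1 : ℝ))
  set c := φ[γ s] ∘ γ with hc
  obtain ⟨r, hr, hball⟩ := Metric.eventually_nhds_iff_ball.1
    (S.eventually_coordTimelike hk (ht.coordTimelike hp))
  have hball' (y w : 𝔼) (hy : y ∈ Metric.ball (φ[γ s] (γ s)) r) (hw : w ∈ Metric.ball v r) :=
    hball (y, w) (by rw [← ball_prod_same]; exact ⟨hy, hw⟩)
  have hsrc : ∀ᶠ s' in 𝓝[Icc 0 1] s, γ s' ∈ (φ[γ s]).source :=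
    (hγ.continuousOn s hs).preimage_mem_nhdsWithin (extChartAt_source_mem_nhds (γ s))
  have hseg {a b : 𝔼} {h : ℝ} (hh : 0 < h) (ha : a ∈ Metric.ball (φ[γ s] (γ s)) r)
      (hb : b ∈ Metric.ball (φ[γ s] (γ s)) r) (hab : h⁻¹ • (b - a) ∈ Metric.ball v r) :
      S.TimelikeSegment ((φ[γ s]).symm a) ((φ[γ s]).symm b) := by
    have hsub := (convex_ball (φ[γ s] (γ s)) r).segment_subset ha hb
    refine S.timelikeSegment_of_coordTimelike (fun y hy ↦ (hball' y _ (hsub hy) hab).1)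
      fun y hy ↦ ?_
    have := (hball' y _ (hsub hy) hab).2.smul hh
    rwa [smul_inv_smul₀ hh.ne'] at this
  have hz1 : ∀ᶠ z in 𝓝 (γ s), z ∈ (φ[γ s]).source := extChartAt_source_mem_nhds (γ s)
  have hz2 : ∀ᶠ z in 𝓝 (γ s), φ[γ s] z ∈ Metric.ball (φ[γ s] (γ s)) r :=
    (continuousAt_extChartAt (γ s)).preimage_mem_nhds (Metric.ball_mem_nhds _ hr)
  filter_upwards [hsrc, hd.continuousWithinAt.preimage_mem_nhdsWithin (Metric.ball_mem_nhds _ hr),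
    hd.eventually_slope_mem (Metric.ball_mem_nhds v hr)] with s' hs' hcs' hslope
  constructor
  · intro hlt
    have h0 : 0 < s - s' := sub_pos.2 hlt
    have hmem : (s - s')⁻¹ • (φ[γ s] (γ s) - c s') ∈ Metric.ball v r := by
      have := hslope hlt.ne
      rwa [slope_comm, slope_def_module] at this
    have hcont : ContinuousAt (fun z ↦ (s - s')⁻¹ • (φ[γ s] z - c s')) (γ s) :=
      by
      have := continuousAt_extChartAt (I := 𝓘(ℝ, 𝔼)) (γ s)
      fun_prop
    have hz3 := hcont.preimage_mem_nhds (Metric.isOpen_ball.mem_nhds hmem)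
    filter_upwards [hz1, hz2, hz3] with z h1 h2 h3
    have := hseg h0 hcs' h2 h3
    rwa [(φ[γ s]).left_inv h1, hc, Function.comp_apply, (φ[γ s]).left_inv hs'] at this
  · intro hlt
    have h0 : 0 < s' - s := sub_pos.2 hlt
    have hmem : (s' - s)⁻¹ • (c s' - φ[γ s] (γ s)) ∈ Metric.ball v r := by
      have := hslope hlt.ne'
      rwa [slope_def_module] at this
    have hcont : ContinuousAt (fun z ↦ (s' - s)⁻¹ • (c s' - φ[γ s] z)) (γ s) :=
      by
      have := continuousAt_extChartAt (I := 𝓘(ℝ, 𝔼)) (γ s)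
      fun_prop
    have hz3 := hcont.preimage_mem_nhds (Metric.isOpen_ball.mem_nhds hmem)
    filter_upwards [hz1, hz2, hz3] with z h1 h2 h3
    have := hseg h0 h2 hcs' h3
    rwa [(φ[γ s]).left_inv h1, hc, Function.comp_apply, (φ[γ s]).left_inv hs'] at this

theorem chronological_of_lt (hk : 1 ≤ k) (S : TimeOrientedMetric n k M) {γ : ℝ → M}
    (hγ : ContMDiffOn 𝓘(ℝ, ℝ) (𝓘(ℝ, EuclideanSpace ℝ (Fin n))) 1 γ (Icc 0 1))
    (ht : ∀ t ∈ Icc (0 : ℝ) 1, S.IsFutureTimelike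
      (mfderivWithin 𝓘(ℝ, ℝ) (𝓘(ℝ, EuclideanSpace ℝ (Fin n))) γ (Icc 0 1) t (1 : ℝ)))
    {a b : ℝ} (ha : 0 ≤ a) (hab : a < b) (hb : b ≤ 1) : (γ a, γ b) ∈ S.chronological := by
  have hsub : Icc a b ⊆ Icc 0 1 := Icc_subset_Icc ha hb
  refine transGen_of_forall_eventually hab fun s hs ↦ ?_
  filter_upwards [nhdsWithin_mono s hsub
    (S.eventually_timelikeSegment hk hγ (hsub hs) (ht s (hsub hs)))] with s' hs'
  exact ⟨fun h ↦ (hs'.1 h).self_of_nhds, fun h ↦ (hs'.2 h).self_of_nhds⟩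

theorem isOpen_future_chronological (hk : 1 ≤ k) (S : TimeOrientedMetric n k M) (x : M) :
    IsOpen (futureOf S.chronological x) := by
  refine isOpen_iff_mem_nhds.2 fun z hz ↦ ?_
  obtain ⟨y, hxy, γ, hγ, rfl, rfl, ht⟩ := Relation.TransGen.tail'_iff.1 hz
  have h1 : ∀ᶠ s in 𝓝[<] (1 : ℝ), ∀ᶠ z in 𝓝 (γ 1), S.TimelikeSegment (γ s) z := by
    have h2 := S.eventually_timelikeSegment hk hγ (right_mem_Icc.2 zero_le_one)
      (ht 1 (right_mem_Icc.2 zero_le_one))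
    rw [nhdsWithin_Icc_eq_nhdsLE zero_lt_one] at h2
    filter_upwards [nhdsWithin_mono _ Iio_subset_Iic_self h2, self_mem_nhdsWithin] with s hs hs1
    exact hs.1 hs1
  obtain ⟨s, hs, hs0, hs1⟩ := (h1.and (Ioo_mem_nhdsLT zero_lt_one)).exists
  filter_upwards [hs] with z hz
  exact .tail (.trans_right hxy (S.chronological_of_lt hk hγ ht le_rfl hs0 hs1.le)) hz

theorem isOpen_past_chronological (hk : 1 ≤ k) (S : TimeOrientedMetric n k M) (x : M) :
    IsOpen (pastOf S.chronological x) := by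
  refine isOpen_iff_mem_nhds.2 fun z hz ↦ ?_
  obtain ⟨y, ⟨γ, hγ, rfl, rfl, ht⟩, hyx⟩ := Relation.TransGen.head'_iff.1 hz
  have h1 : ∀ᶠ s in 𝓝[>] (0 : ℝ), ∀ᶠ z in 𝓝 (γ 0), S.TimelikeSegment z (γ s) := by
    have h2 := S.eventually_timelikeSegment hk hγ (left_mem_Icc.2 zero_le_one)
      (ht 0 (left_mem_Icc.2 zero_le_one))
    rw [nhdsWithin_Icc_eq_nhdsGE zero_lt_one] at h2
    filter_upwards [nhdsWithin_mono _ Ioi_subset_Ici_self h2, self_mem_nhdsWithin] with s hs hs1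
    exact hs.2 hs1
  obtain ⟨s, hs, hs0, hs1⟩ := (h1.and (Ioo_mem_nhdsGT zero_lt_one)).exists
  filter_upwards [hs] with z hz
  exact .head hz (.trans_left (S.chronological_of_lt hk hγ ht hs0.le hs1 le_rfl) hyx)

variable {S : TimeOrientedMetric n k M} {p : M} {r m κ L : ℝ}

theorem GoodChart.continuousAt_coord (hG : S.GoodChart p r m κ L) {y : 𝔼}
    (hy : y ∈ Metric.ball (φ[p] p) r) : ContinuousAt (S.metric.coord p) y := by
  have hyd : dist y (φ[p] p) < r := hy
  refine continuousAt_of_locally_lipschitz (f := S.metric.coord p) (sub_pos.2 hyd) L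
    fun z hz ↦ ?_
  have hz' : z ∈ Metric.closedBall (φ[p] p) r := by
    have := dist_triangle z y (φ[p] p)
    rw [Metric.mem_closedBall]
    linarith
  rw [dist_eq_norm z y]
  exact (dist_eq_norm (S.metric.coord p z) (S.metric.coord p y)).trans_le
    (hG.lipschitz z hz' y (Metric.ball_subset_closedBall hy))

/-- Short pieces of a curve whose velocity is almost causal are almost causal steps. -/
theorem GoodChart.eventually_almostCausalStep (hG : S.GoodChart p r m κ L) {γ : ℝ → M}
    (hγ : ContMDiffOn 𝓘(ℝ, ℝ) (𝓘(ℝ, EuclideanSpace ℝ (Fin n))) 1 γ (Icc 0 1)) {s : ℝ}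
    (hs : s ∈ Icc (0 : ℝ) 1) (hsrc : γ s ∈ (chartAt 𝔼 p).source)
    (hball : φ[p] (γ s) ∈ Metric.ball (φ[p] p) (r / 2)) {ε : ℝ} (hε : 0 < ε) {v : 𝔼}
    (hv : v = toChart p (γ s)
      (mfderivWithin 𝓘(ℝ, ℝ) (𝓘(ℝ, EuclideanSpace ℝ (Fin n))) γ (Icc 0 1) s (1 : ℝ)))
    (hv0 : v ≠ 0) (hvv : S.metric.coord p (φ[p] (γ s)) v v < ε * ‖v‖ ^ 2)
    (hht : 2 * m * ‖v‖ ≤ S.height p v) :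
    ∀ᶠ s' in 𝓝[Icc 0 1] s,
      (s' < s → S.AlmostCausalStep p r m ε (φ[p] (γ s')) (φ[p] (γ s))) ∧
      (s < s' → S.AlmostCausalStep p r m ε (φ[p] (γ s)) (φ[p] (γ s'))) := by
  have hd := hasDerivWithinAt_extChartAt_comp hγ hs hsrc
  rw [← hv] at hd
  set c := φ[p] ∘ γ with hc
  have hcont : ContinuousAt (fun x : 𝔼 × 𝔼 ↦ S.metric.coord p x.1) (c s, v) :=
    ContinuousAt.comp (g := S.metric.coord p) (f := Prod.fst)
      (hG.continuousAt_coord (Metric.ball_subset_ball (by linarith [hG.r_pos]) hball))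
      continuousAt_fst
  have hW : ∀ᶠ x : 𝔼 × 𝔼 in 𝓝 (c s, v), S.metric.coord p x.1 x.2 x.2 < ε * ‖x.2‖ ^ 2 ∧
      m * ‖x.2‖ < S.height p x.2 ∧ x.2 ≠ 0 ∧ x.1 ∈ Metric.ball (φ[p] p) (r / 2) := by
    have h1 := (hcont.clm_apply continuousAt_snd).clm_apply continuousAt_snd
    have h2 : ContinuousAt (fun x : 𝔼 × 𝔼 ↦ ε * ‖x.2‖ ^ 2) (c s, v) := by fun_prop
    have h3 : ContinuousAt (fun x : 𝔼 × 𝔼 ↦ m * ‖x.2‖) (c s, v) := by fun_prop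
    have h4 : ContinuousAt (fun x : 𝔼 × 𝔼 ↦ S.height p x.2) (c s, v) :=
      ((S.continuous_height p).comp continuous_snd).continuousAt
    have h5 : m * ‖v‖ < S.height p v := by
      have := mul_pos hG.m_pos (norm_pos_iff.2 hv0)
      linarith
    filter_upwards [h1.eventually_lt h2 hvv, h3.eventually_lt h4 h5,
      continuousAt_snd.eventually_ne hv0,
      continuousAt_fst.preimage_mem_nhds (Metric.isOpen_ball.mem_nhds hball)]
      with x hx1 hx2 hx3 hx4 using ⟨hx1, hx2, hx3, hx4⟩
  obtain ⟨δ, hδ, hball'⟩ := Metric.eventually_nhds_iff_ball.1 hW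
  have key {a b w : 𝔼} {h : ℝ} (hh : 0 < h) (ha : a ∈ Metric.ball (c s) δ)
      (hb : b ∈ Metric.ball (c s) δ) (hw : w ∈ Metric.ball v δ) (hab : b - a = h • w)
      (hlen : ‖b - a‖ ≤ ε) : S.AlmostCausalStep p r m ε a b := by
    obtain ⟨h1, h2, h3, h4⟩ := hball' (a, w) (by rw [← ball_prod_same]; exact ⟨ha, hw⟩)
    obtain ⟨-, -, -, h5⟩ := hball' (b, w) (by rw [← ball_prod_same]; exact ⟨hb, hw⟩)
    refine ⟨Metric.ball_subset_closedBall h4, Metric.ball_subset_closedBall h5, ?_, hlen, ?_, ?_⟩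
    · rintro rfl
      rw [sub_self] at hab
      exact (smul_ne_zero hh.ne' h3) hab.symm
    · rw [hab, norm_smul, Real.norm_of_nonneg hh.le]
      simp only [map_smul, smul_apply, smul_eq_mul]
      calc h * (h * S.metric.coord p a w w) ≤ h * (h * (ε * ‖w‖ ^ 2)) := by gcongr
        _ = ε * (h * ‖w‖) ^ 2 := by ring
    · rw [hab, norm_smul, Real.norm_of_nonneg hh.le, S.height_smul]
      calc m * (h * ‖w‖) = h * (m * ‖w‖) := by ring
        _ ≤ h * S.height p w := by gcongr
  filter_upwards [hd.continuousWithinAt.preimage_mem_nhdsWithin (Metric.ball_mem_nhds _ hδ),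
    hd.continuousWithinAt.preimage_mem_nhdsWithin (Metric.ball_mem_nhds _ hε),
    hd.eventually_slope_mem (Metric.ball_mem_nhds v hδ)] with s' h1 h2 h3
  have h2' : ‖c s' - c s‖ ≤ ε := by rw [← dist_eq_norm]; exact le_of_lt h2
  constructor
  · intro hlt
    refine key (w := slope c s s') (sub_pos.2 hlt) h1 (Metric.mem_ball_self hδ) (h3 hlt.ne) ?_ ?_
    · rw [slope_comm, sub_smul_slope, vsub_eq_sub]; rfl
    · rw [norm_sub_rev]; exact h2'
  · intro hlt
    refine key (w := slope c s s') (sub_pos.2 hlt) (Metric.mem_ball_self hδ) h1 (h3 hlt.ne') ?_ h2'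
    rw [sub_smul_slope, vsub_eq_sub]; rfl

theorem GoodChart.transGen_almostCausalStep (hG : S.GoodChart p r m κ L) {γ : ℝ → M}
    (hγ : ContMDiffOn 𝓘(ℝ, ℝ) (𝓘(ℝ, EuclideanSpace ℝ (Fin n))) 1 γ (Icc 0 1))
    (ht : ∀ t ∈ Icc (0 : ℝ) 1, S.IsFutureCausal
      (mfderivWithin 𝓘(ℝ, ℝ) (𝓘(ℝ, EuclideanSpace ℝ (Fin n))) γ (Icc 0 1) t (1 : ℝ)))
    {a b : ℝ} (hab : a < b) (hsub : Icc a b ⊆ Icc 0 1)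
    (hloc : ∀ t ∈ Icc a b, γ t ∈ (chartAt 𝔼 p).source ∧
      φ[p] (γ t) ∈ Metric.ball (φ[p] p) (r / 2)) {ε : ℝ} (hε : 0 < ε) :
    Relation.ReflTransGen (S.AlmostCausalStep p r m ε) (φ[p] (γ a)) (φ[p] (γ b)) := by
  have hr := hG.r_pos
  refine (transGen_of_forall_eventually (γ := fun t ↦ φ[p] (γ t)) hab fun s hs ↦ ?_).to_reflTransGen
  obtain ⟨h1, h2⟩ := hloc s hs
  obtain ⟨hv0, hvv, hvt⟩ := (ht s (hsub hs)).coord h1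
  refine nhdsWithin_mono s hsub (hG.eventually_almostCausalStep hγ (hsub hs) h1 h2 hε rfl hv0 ?_ ?_)
  · exact hvv.trans_lt (mul_pos hε (pow_pos (norm_pos_iff.2 hv0) 2))
  · refine hG.le_height _ (Metric.ball_subset_closedBall
      (Metric.ball_subset_ball (by linarith) h2)) _ (hvv.trans ?_) (hvt.le.trans ?_)
    · have := hG.κ_pos; positivity
    · have := hG.κ_pos; positivity

/-- Local form of the push-up property along a causal curve: near each parameter, earlier points
chronologically precede everything that later points precede, and later points chronologically
follow everything that earlier points follow. -/
theorem eventually_push (hk : 1 ≤ k) (S : TimeOrientedMetric n k M) {γ : ℝ → M}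
    (hγ : ContMDiffOn 𝓘(ℝ, ℝ) (𝓘(ℝ, EuclideanSpace ℝ (Fin n))) 1 γ (Icc 0 1))
    (ht : ∀ t ∈ Icc (0 : ℝ) 1, S.IsFutureCausal
      (mfderivWithin 𝓘(ℝ, ℝ) (𝓘(ℝ, EuclideanSpace ℝ (Fin n))) γ (Icc 0 1) t (1 : ℝ)))
    {s : ℝ} (hs : s ∈ Icc (0 : ℝ) 1) :
    ∃ δ > 0, ∀ a ∈ Icc (0 : ℝ) 1, ∀ b ∈ Icc (0 : ℝ) 1, |a - s| < δ → |b - s| < δ → a < b →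
      ∀ z, ((γ b, z) ∈ S.chronological → (γ a, z) ∈ S.chronological) ∧
        ((z, γ a) ∈ S.chronological → (z, γ b) ∈ S.chronological) := by
  obtain ⟨r, m, κ, L, hG, -⟩ := S.exists_goodChart hk (γ s) Filter.univ_mem
  have hr := hG.r_pos
  have hV : ∀ᶠ q in 𝓝 (γ s), q ∈ (chartAt 𝔼 (γ s)).source ∧
      φ[γ s] q ∈ Metric.ball (φ[γ s] (γ s)) (r / 2) :=
    Filter.Eventually.and (chart_source_mem_nhds 𝔼 (γ s))
      ((continuousAt_extChartAt (γ s)).preimage_mem_nhds (Metric.ball_mem_nhds _ (half_pos hr)))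
  obtain ⟨δ, hδ, hδV⟩ := Metric.mem_nhdsWithin_iff.1
    ((hγ.continuousOn s hs).preimage_mem_nhdsWithin hV)
  refine ⟨δ, hδ, fun a ha b hb has hbs hab z ↦ ?_⟩
  have hsub : Icc a b ⊆ Icc 0 1 := Icc_subset_Icc ha.1 hb.2
  have hloc (t : ℝ) (htab : t ∈ Icc a b) : γ t ∈ (chartAt 𝔼 (γ s)).source ∧
      φ[γ s] (γ t) ∈ Metric.ball (φ[γ s] (γ s)) (r / 2) := by
    refine hδV ⟨?_, hsub htab⟩
    rw [Metric.mem_ball, Real.dist_eq, abs_lt]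
    rw [abs_lt] at has hbs
    constructor <;> linarith [htab.1, htab.2]
  obtain ⟨C, hC, ε₀, hε₀, hpert⟩ := hG.exists_perturbation
  have inv (t : ℝ) (htab : t ∈ Icc a b) : (φ[γ s]).symm (φ[γ s] (γ t)) = γ t :=
    (φ[γ s]).left_inv (by rw [extChartAt_source]; exact (hloc t htab).1)
  have ha' := left_mem_Icc.2 hab.le
  have hb' := right_mem_Icc.2 hab.le
  -- a set containing `γ t` contains the points with coordinates close to those of `γ t`
  have small (t : ℝ) (htab : t ∈ Icc a b) {O : Set M} (hO : IsOpen O) (hmem : γ t ∈ O) :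
      ∃ ε, 0 < ε ∧ ε < ε₀ ∧ ∀ y, ‖y - φ[γ s] (γ t)‖ ≤ C * ε → (φ[γ s]).symm y ∈ O := by
    have h1 : ContinuousAt (φ[γ s]).symm (φ[γ s] (γ t)) :=
      continuousAt_extChartAt_symm' (by rw [extChartAt_source]; exact (hloc t htab).1)
    obtain ⟨η, hη, hηO⟩ := Metric.eventually_nhds_iff_ball.1
      (h1.preimage_mem_nhds (hO.mem_nhds (by rwa [inv t htab])))
    refine ⟨min (ε₀ / 2) (η / (2 * C)), by positivity,
      (min_le_left _ _).trans_lt (half_lt_self hε₀), fun y hy ↦ hηO y ?_⟩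
    rw [mem_ball_iff_norm]
    calc _ ≤ C * (η / (2 * C)) := hy.trans (by gcongr; exact min_le_right _ _)
      _ = η / 2 := by field_simp
      _ < η := half_lt_self hη
  have hcl := Metric.ball_subset_closedBall (hloc a ha').2
  constructor
  · intro hz
    obtain ⟨ε, hε0, hε, hO⟩ := small b hb' (S.isOpen_past_chronological hk z) hz
    obtain ⟨⟨b', hb'1, -, hab'⟩, -⟩ := hpert ε hε0 hε _ _ hcl
      (hG.transGen_almostCausalStep hγ ht hab hsub hloc hε0)
    rw [inv a ha'] at hab'
    exact hab'.trans (hO b' hb'1)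
  · intro hz
    obtain ⟨ε, hε0, hε, hO⟩ := small a ha' (S.isOpen_future_chronological hk z) hz
    obtain ⟨-, a', ha'1, -, hab'⟩ := hpert ε hε0 hε _ _ hcl
      (hG.transGen_almostCausalStep hγ ht hab hsub hloc hε0)
    rw [inv b hb'] at hab'
    exact Relation.TransGen.trans (hO a' ha'1) hab'

theorem CausalSegment.push (hk : 1 ≤ k) {x y : M} (h : S.CausalSegment x y) (z : M) :
    ((y, z) ∈ S.chronological → (x, z) ∈ S.chronological) ∧
      ((z, x) ∈ S.chronological → (z, y) ∈ S.chronological) := by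
  obtain ⟨γ, hγ, rfl, rfl, ht⟩ := h
  let R : M → M → Prop := fun a b ↦ ∀ z, ((b, z) ∈ S.chronological → (a, z) ∈ S.chronological) ∧
    ((z, a) ∈ S.chronological → (z, b) ∈ S.chronological)
  have htrans : IsTrans M R := ⟨fun a b c hab hbc z ↦
    ⟨fun h ↦ (hab z).1 ((hbc z).1 h), fun h ↦ (hbc z).2 ((hab z).2 h)⟩⟩
  have key : Relation.TransGen R (γ 0) (γ 1) := by
    refine transGen_of_forall_eventually zero_lt_one fun s hs ↦ ?_
    obtain ⟨δ, hδ, hpush⟩ := S.eventually_push hk hγ ht hs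
    filter_upwards [self_mem_nhdsWithin, mem_nhdsWithin_of_mem_nhds (Metric.ball_mem_nhds s hδ)]
      with s' hs' hs'δ
    exact ⟨fun h ↦ hpush s' hs' s hs hs'δ (by simpa using hδ) h,
      fun h ↦ hpush s hs s' hs' (by simpa using hδ) hs'δ h⟩
  rw [Relation.transGen_eq_self] at key
  exact key z

theorem TimelikeSegment.causalSegment {x y : M} (h : S.TimelikeSegment x y) :
    S.CausalSegment x y := by
  obtain ⟨γ, hγ, h0, h1, ht⟩ := h
  exact ⟨γ, hγ, h0, h1, fun t htI ↦ (ht t htI).isFutureCausal⟩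

theorem chronological_subset_causal (S : TimeOrientedMetric n k M) :
    S.chronological ⊆ S.causal := fun _ h ↦
  Relation.TransGen.to_reflTransGen
    (Relation.TransGen.mono (fun _ _ ↦ TimelikeSegment.causalSegment) _ _ h)

/-- Every point is a limit of its chronological future and of its chronological past: perturb
the trivial chain. -/
theorem mem_closure_chronological (hk : 1 ≤ k) (S : TimeOrientedMetric n k M) (x : M) :
    x ∈ closure (futureOf S.chronological x) ∧ x ∈ closure (pastOf S.chronological x) := by
  obtain ⟨r, m, κ, L, hG, -⟩ := S.exists_goodChart hk x Filter.univ_mem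
  obtain ⟨C, hC, ε₀, hε₀, hpert⟩ := hG.exists_perturbation
  have hx : φ[x] x ∈ Metric.closedBall (φ[x] x) (r / 2) :=
    Metric.mem_closedBall_self (half_pos hG.r_pos).le
  have key {O : Set M} (hO : IsOpen O) (hxO : x ∈ O) :
      ∃ ε, 0 < ε ∧ ε < ε₀ ∧ ∀ y, ‖y - φ[x] x‖ ≤ C * ε → (φ[x]).symm y ∈ O := by
    obtain ⟨η, hη, hηO⟩ := Metric.eventually_nhds_iff_ball.1
      ((continuousAt_extChartAt_symm (I := 𝓘(ℝ, 𝔼)) x).preimage_mem_nhds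
        (hO.mem_nhds (by rwa [extChartAt_to_inv])))
    refine ⟨min (ε₀ / 2) (η / (2 * C)), by positivity,
      (min_le_left _ _).trans_lt (half_lt_self hε₀), fun y hy ↦ hηO y ?_⟩
    rw [mem_ball_iff_norm]
    calc _ ≤ C * (η / (2 * C)) := hy.trans (by gcongr; exact min_le_right _ _)
      _ = η / 2 := by field_simp
      _ < η := half_lt_self hη
  constructor <;> refine mem_closure_iff.2 fun O hO hxO ↦ ?_ <;>
    obtain ⟨ε, hε0, hε, hεO⟩ := key hO hxO <;>
    obtain ⟨⟨b, hb, -, hxb⟩, a, ha, -, hax⟩ := hpert ε hε0 hε _ _ hx .refl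
  · rw [extChartAt_to_inv] at hxb
    exact ⟨_, hεO b hb, hxb⟩
  · rw [extChartAt_to_inv] at hax
    exact ⟨_, hεO a ha, hax⟩

theorem isCausalPair (hk : 1 ≤ k) (S : TimeOrientedMetric n k M) :
    IsCausalPair S.chronological S.causal where
  isOpen_future := S.isOpen_future_chronological hk
  isOpen_past := S.isOpen_past_chronological hk
  subset := S.chronological_subset_causal
  refl _ := Relation.ReflTransGen.refl
  trans h₁ h₂ := Relation.ReflTransGen.trans h₁ h₂
  push_left {x y z} h₁ h₂ := by
    change Relation.ReflTransGen S.CausalSegment x y at h₁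
    induction h₁ with
    | refl => exact h₂
    | tail _ hbc ih => exact ih ((hbc.push hk z).1 h₂)
  push_right {x y z} h₁ h₂ := by
    change Relation.ReflTransGen S.CausalSegment y z at h₂
    induction h₂ with
    | refl => exact h₁
    | tail _ hbc ih => exact (hbc.push hk x).2 ih
  mem_closure_future x := (S.mem_closure_chronological hk x).1
  mem_closure_past x := (S.mem_closure_chronological hk x).2

end TimeOrientedMetric

end

/-! ### The closure of the causal relation is contained in the causal relation of wider metrics -/

section

variable {n : ℕ} {k : ℕ∞} {M : Type u} [TopologicalSpace M]
  [ChartedSpace (EuclideanSpace ℝ (Fin n)) M]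
  [IsManifold (𝓘(ℝ, EuclideanSpace ℝ (Fin n))) ∞ M]

local notation "𝔼" => EuclideanSpace ℝ (Fin n)
local notation "φ[" p "]" => extChartAt (𝓘(ℝ, EuclideanSpace ℝ (Fin n))) p

namespace TimeOrientedMetric

/-- Future directed causal vectors are future directed timelike for a wider metric: otherwise a
convex combination of the vector with the time orienting one, which is still causal, would be
orthogonal to the latter. -/
theorem IsFutureCausal.widen {S : TimeOrientedMetric n k M} {g' : LorentzMetric n k M}
    (h : g'.IsWiderThan S.metric) {x : M} {v : TangentSpace (𝓘(ℝ, EuclideanSpace ℝ (Fin n))) x}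
    (hv : S.IsFutureCausal v) : (S.widen g' h).IsFutureTimelike v := by
  refine ⟨h x v hv.1, ?_⟩
  change g'.form x v (S.timeField x) < 0
  obtain ⟨⟨hv0, hvv⟩, hvT⟩ := hv
  have hTT : S.metric.form x (S.timeField x) (S.timeField x) < 0 := S.timelike_timeField x
  have hTT' : g'.form x (S.timeField x) (S.timeField x) < 0 :=
    (S.widen g' h).timelike_timeField x
  set T := S.timeField x
  by_contra! ha
  set a := g'.form x v T
  set b := g'.form x T T
  have hwT : S.metric.form x ((-b) • v + a • T) T < 0 := by
    simp only [map_add, map_smul, add_apply, smul_apply, smul_eq_mul]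
    nlinarith [mul_pos_of_neg_of_neg hTT' hvT]
  have hww : S.metric.form x ((-b) • v + a • T) ((-b) • v + a • T) ≤ 0 := by
    simp only [map_add, map_smul, add_apply, smul_apply, smul_eq_mul, S.metric.symm x T v]
    have h1 := mul_nonpos_of_nonneg_of_nonpos (sq_nonneg b) hvv
    have h2 := mul_nonpos_of_nonneg_of_nonpos (mul_nonneg (neg_pos.2 hTT').le ha) hvT.le
    have h3 := mul_nonpos_of_nonneg_of_nonpos (sq_nonneg a) hTT.le
    linarith
  have hw0 : (-b) • v + a • T ≠ 0 := fun h0 ↦ by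
    rw [h0] at hwT
    simp at hwT
  have horth : g'.form x T ((-b) • v + a • T) = 0 := by
    simp only [map_add, map_smul, smul_eq_mul, g'.symm x T v]
    ring
  have h1 := pos_of_orthogonal_timelike (g'.symm x) (g'.signature x) hTT' horth hw0
  exact h1.not_gt (h x _ ⟨hw0, hww⟩)

/-- Locally, a tangent vector which is close to a causal vector of `S` at a nearby point is
timelike for `S'`. -/
theorem exists_robust_cone (hk : 1 ≤ k) {S S' : TimeOrientedMetric n k M}
    (hSS' : ∀ (x : M) (v : TangentSpace (𝓘(ℝ, EuclideanSpace ℝ (Fin n))) x),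
      S.IsFutureCausal v → S'.IsFutureTimelike v) (p : M) :
    ∃ ρ > 0, ∀ y ∈ Metric.closedBall (φ[p] p) ρ, ∀ y' ∈ Metric.closedBall (φ[p] p) ρ,
      y' ∈ (φ[p]).target ∧ ∀ v v' : 𝔼, v ≠ 0 → S.metric.coord p y v v ≤ 0 →
        S.metric.coord p y v (S.timeCoord p y) < 0 → ‖v' - v‖ ≤ ρ * ‖v‖ →
        S'.CoordTimelike p y' v' := by
  have hp := mem_chart_source 𝔼 p
  have key : ∀ᶠ x : 𝔼 × 𝔼 × 𝔼 in 𝓝 (φ[p] p, φ[p] p, 0), ∀ v ∈ Metric.sphere (0 : 𝔼) 1,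
      S.metric.coord p x.1 v v ≤ 0 → S.metric.coord p x.1 v (S.timeCoord p x.1) ≤ 0 →
        S'.CoordTimelike p x.2.1 (v + x.2.2) := by
    refine (isCompact_sphere (0 : 𝔼) 1).eventually_forall_of_forall_eventually fun v hv ↦ ?_
    have hv0 : v ≠ 0 := by
      rintro rfl
      simp at hv
    have h1 : ContinuousAt (fun x : (𝔼 × 𝔼 × 𝔼) × 𝔼 ↦ S.metric.coord p x.1.1)
        ((φ[p] p, φ[p] p, 0), v) :=
      ContinuousAt.comp (g := S.metric.coord p) (f := fun x : (𝔼 × 𝔼 × 𝔼) × 𝔼 ↦ x.1.1)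
        (S.metric.contDiffAt_coord hk p).continuousAt (by fun_prop)
    have h2 : ContinuousAt (fun x : (𝔼 × 𝔼 × 𝔼) × 𝔼 ↦ S.timeCoord p x.1.1)
        ((φ[p] p, φ[p] p, 0), v) :=
      ContinuousAt.comp (g := S.timeCoord p) (f := fun x : (𝔼 × 𝔼 × 𝔼) × 𝔼 ↦ x.1.1)
        (S.continuousAt_timeCoord p) (by fun_prop)
    have h3 := (h1.clm_apply continuousAt_snd).clm_apply continuousAt_snd
    have h4 := (h1.clm_apply continuousAt_snd).clm_apply h2
    rcases lt_or_ge 0 (S.metric.coord p (φ[p] p) v v) with h5 | h5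
    · filter_upwards [h3.eventually_const_lt h5] with x hx hx1
      exact absurd hx1 hx.not_ge
    rcases lt_or_ge 0 (S.metric.coord p (φ[p] p) v (S.timeCoord p (φ[p] p))) with h6 | h6
    · filter_upwards [h4.eventually_const_lt h6] with x hx _ hx1
      exact absurd hx1 hx.not_ge
    have h6' : S.metric.coord p (φ[p] p) v (S.axis p) < 0 := by
      refine h6.lt_of_ne fun h0 ↦ (S.coord_center_pos p ?_ hv0).not_ge h5
      rw [S.metric.coord_symm (mem_extChartAt_target p)]
      exact h0
    have h7 : S'.CoordTimelike p (φ[p] p) v := by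
      have h8 : S.IsFutureCausal (ofChart p p v) := by
        rw [S.metric.coord_extChartAt hp] at h5 h6'
        refine ⟨⟨fun h0 ↦ hv0 ?_, ?_⟩, ?_⟩
        · rw [← toChart_ofChart hp v, h0, map_zero]
        · rwa [← S.metric.atChart_apply hp]
        · rw [S.metric.form_eq_atChart hp, toChart_ofChart hp]
          rwa [axis, timeCoord, extChartAt_to_inv] at h6'
      have h9 := (hSS' p _ h8).coordTimelike hp
      rwa [toChart_ofChart hp] at h9
    have h8 : ContinuousAt (fun x : (𝔼 × 𝔼 × 𝔼) × 𝔼 ↦ (x.1.2.1, x.2 + x.1.2.2))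
        ((φ[p] p, φ[p] p, 0), v) := by fun_prop
    have h9 := S'.eventually_coordTimelike hk h7
    rw [ContinuousAt, add_zero] at h8
    filter_upwards [h8.eventually h9] with x hx _ _
    exact hx.2
  obtain ⟨ε, hε, hball⟩ := Metric.eventually_nhds_iff_ball.1 key
  obtain ⟨ε', hε', hball'⟩ := Metric.mem_nhds_iff.1
    (extChartAt_target_mem_nhds (I := 𝓘(ℝ, 𝔼)) p)
  refine ⟨min ε ε' / 2, by positivity, fun y hy y' hy' ↦ ⟨hball' ?_, ?_⟩⟩
  · exact Metric.closedBall_subset_ball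
      ((half_lt_self (lt_min hε hε')).trans_le (min_le_right _ _)) hy'
  intro v v' hv hvv hvt hvv'
  have hn : 0 < ‖v‖ := norm_pos_iff.2 hv
  have hlt : min ε ε' / 2 < ε := (half_lt_self (lt_min hε hε')).trans_le (min_le_left _ _)
  have hmem : (y, y', ‖v‖⁻¹ • (v' - v)) ∈ Metric.ball (φ[p] p, φ[p] p, (0 : 𝔼)) ε := by
    rw [← ball_prod_same, ← ball_prod_same]
    refine ⟨Metric.closedBall_subset_ball hlt hy, Metric.closedBall_subset_ball hlt hy', ?_⟩
    rw [mem_ball_zero_iff, norm_smul, norm_inv, norm_norm]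
    refine lt_of_le_of_lt ?_ hlt
    rwa [inv_mul_le_iff₀ hn, mul_comm]
  have hinv : 0 < ‖v‖⁻¹ := inv_pos.2 hn
  have h1 := hball _ hmem (‖v‖⁻¹ • v) (by simp [norm_smul, hn.ne'])
    (by
      simp only [map_smul, smul_apply, smul_eq_mul]
      exact mul_nonpos_of_nonneg_of_nonpos hinv.le
        (mul_nonpos_of_nonneg_of_nonpos hinv.le hvv))
    (by
      simp only [map_smul, smul_apply, smul_eq_mul]
      exact mul_nonpos_of_nonneg_of_nonpos hinv.le hvt.le)
  have h2 := h1.smul hn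
  rwa [← smul_add, smul_inv_smul₀ hn.ne', add_sub_cancel] at h2

/-- A cut-off translation in a chart. -/
noncomputable def bump (r : ℝ) (y₀ w y : 𝔼) : 𝔼 :=
  y + max 0 (1 - ‖y - y₀‖ / r) • w

theorem bump_of_notMem {r : ℝ} (hr : 0 < r) {y₀ w y : 𝔼} (hy : y ∉ Metric.closedBall y₀ r) :
    bump r y₀ w y = y := by
  rw [mem_closedBall_iff_norm, not_le] at hy
  rw [bump, max_eq_left, zero_smul, add_zero]
  rw [sub_nonpos, le_div_iff₀ hr]
  linarith

theorem norm_bump_sub_le {r : ℝ} (hr : 0 < r) (y₀ w y : 𝔼) : ‖bump r y₀ w y - y‖ ≤ ‖w‖ := by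
  rw [bump, add_sub_cancel_left, norm_smul, Real.norm_of_nonneg (le_max_left _ _)]
  refine mul_le_of_le_one_left (norm_nonneg _) (max_le zero_le_one ?_)
  have : 0 ≤ ‖y - y₀‖ / r := by positivity
  linarith

theorem norm_bump_sub_sub_le {r : ℝ} (hr : 0 < r) (y₀ w y y' : 𝔼) :
    ‖(bump r y₀ w y' - bump r y₀ w y) - (y' - y)‖ ≤ ‖w‖ / r * ‖y' - y‖ := by
  have h1 : (bump r y₀ w y' - bump r y₀ w y) - (y' - y) =
      (max 0 (1 - ‖y' - y₀‖ / r) - max 0 (1 - ‖y - y₀‖ / r)) • w := by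
    simp only [bump]
    module
  rw [h1, norm_smul, Real.norm_eq_abs]
  have h2 : |max 0 (1 - ‖y' - y₀‖ / r) - max 0 (1 - ‖y - y₀‖ / r)| ≤ ‖y' - y‖ / r := by
    refine (abs_max_sub_max_le_max _ _ _ _).trans ?_
    rw [sub_self, abs_zero, max_eq_right (abs_nonneg _)]
    have h3 : (1 - ‖y' - y₀‖ / r) - (1 - ‖y - y₀‖ / r) = (‖y - y₀‖ - ‖y' - y₀‖) / r := by ring
    rw [h3, abs_div, abs_of_pos hr]
    gcongr
    refine (abs_norm_sub_norm_le _ _).trans_eq ?_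
    rw [sub_sub_sub_cancel_right, norm_sub_rev]
  calc _ ≤ ‖y' - y‖ / r * ‖w‖ := by gcongr
    _ = _ := by ring

/-- If the cones of `S'` are wider than those of `S`, then a point `p'` close to `p` can be moved
to `p` by a map of the spacetime which is the identity outside a neighbourhood of `p` and which
maps the causal relation of `S` into that of `S'`. -/
theorem eventually_exists_deformation [T2Space M] (hk : 1 ≤ k) {S S' : TimeOrientedMetric n k M}
    (hSS' : ∀ (x : M) (v : TangentSpace (𝓘(ℝ, EuclideanSpace ℝ (Fin n))) x),
      S.IsFutureCausal v → S'.IsFutureTimelike v) {p : M} {U : Set M} (hU : U ∈ 𝓝 p) :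
    ∀ᶠ p' in 𝓝 p, ∃ Ψ : M → M, Ψ p' = p ∧ (∀ q ∉ U, Ψ q = q) ∧
      ∀ a b, (a, b) ∈ S.causal → (Ψ a, Ψ b) ∈ S'.causal := by
  classical
  obtain ⟨ρ₀, hρ₀, hcone₀⟩ := exists_robust_cone hk hSS' p
  obtain ⟨ρ, hρ, hρ1, hcone⟩ : ∃ ρ > 0, ρ ≤ 1 ∧ ∀ y ∈ Metric.closedBall (φ[p] p) ρ,
      ∀ y' ∈ Metric.closedBall (φ[p] p) ρ,
      y' ∈ (φ[p]).target ∧ ∀ v v' : 𝔼, v ≠ 0 → S.metric.coord p y v v ≤ 0 →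
        S.metric.coord p y v (S.timeCoord p y) < 0 → ‖v' - v‖ ≤ ρ * ‖v‖ →
        S'.CoordTimelike p y' v' := by
    have hle := Metric.closedBall_subset_closedBall (x := φ[p] p) (min_le_left ρ₀ 1)
    refine ⟨min ρ₀ 1, by positivity, min_le_right _ _, fun y hy y' hy' ↦
      ⟨(hcone₀ y (hle hy) y' (hle hy')).1, fun v v' h0 h1 h2 h3 ↦
        (hcone₀ y (hle hy) y' (hle hy')).2 v v' h0 h1 h2 (h3.trans ?_)⟩⟩
    gcongr
    exact min_le_left _ _
  obtain ⟨r₀, hr₀, hr₀U⟩ := Metric.nhds_basis_closedBall.mem_iff.1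
    ((continuousAt_extChartAt_symm (I := 𝓘(ℝ, 𝔼)) p).preimage_mem_nhds
      (by rwa [extChartAt_to_inv]))
  set r := min r₀ (ρ / 3) with hrdef
  have hr : 0 < r := by positivity
  have hrρ : 3 * r ≤ ρ := by have := min_le_right r₀ (ρ / 3); linarith
  have hrU : ∀ y ∈ Metric.closedBall (φ[p] p) r, (φ[p]).symm y ∈ U := fun y hy ↦
    hr₀U (Metric.closedBall_subset_closedBall (min_le_left _ _) hy)
  have hrt : ∀ y ∈ Metric.closedBall (φ[p] p) r, y ∈ (φ[p]).target := fun y hy ↦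
    have := Metric.closedBall_subset_closedBall (by linarith : r ≤ ρ) hy
    (hcone y this y this).1
  set F : Set M := (φ[p]).symm '' Metric.closedBall (φ[p] p) r with hF
  have hFclosed : IsClosed F := by
    refine ((isCompact_closedBall _ _).image_of_continuousOn ?_).isClosed
    exact (continuousOn_extChartAt_symm p).mono hrt
  have hsrc : ∀ᶠ p' in 𝓝 p, p' ∈ (φ[p]).source := extChartAt_source_mem_nhds p
  have hnear : ∀ᶠ p' in 𝓝 p, φ[p] p' ∈ Metric.ball (φ[p] p) (ρ * r / 8) :=
    (continuousAt_extChartAt p).preimage_mem_nhds (Metric.ball_mem_nhds _ (by positivity))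
  filter_upwards [hsrc, hnear] with p' hp's hp'
  rw [mem_ball_iff_norm] at hp'
  -- the translation vector for which the cut-off translation maps `p'` to `p`
  set χ := max 0 (1 - ‖φ[p] p' - φ[p] p‖ / r) with hχ
  have hχ2 : 1 / 2 ≤ χ := by
    refine le_max_of_le_right ?_
    have : ‖φ[p] p' - φ[p] p‖ / r ≤ 1 / 2 := by
      rw [div_le_iff₀ hr]
      nlinarith
    linarith
  set w := χ⁻¹ • (φ[p] p - φ[p] p') with hw
  have hw1 : ‖w‖ / r ≤ ρ / 4 := by
    rw [div_le_iff₀ hr, hw, norm_smul, norm_inv, Real.norm_of_nonneg (by linarith : 0 ≤ χ),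
      inv_mul_le_iff₀ (by linarith), norm_sub_rev]
    have : 1 / 2 * (ρ / 4 * r) ≤ χ * (ρ / 4 * r) := by gcongr
    linarith
  have hw2 : ‖w‖ ≤ r := by
    rw [div_le_iff₀ hr] at hw1
    nlinarith
  set f : 𝔼 → 𝔼 := bump r (φ[p] p) w with hf
  set Ψ : M → M := fun q ↦ if q ∈ (φ[p]).source then (φ[p]).symm (f (φ[p] q)) else q with hΨ
  have hΨF (q : M) (hq : q ∉ F) : Ψ q = q := by
    simp only [hΨ]
    split_ifs with hqs
    · rw [hf, bump_of_notMem hr, (φ[p]).left_inv hqs]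
      intro hmem
      exact hq ⟨_, hmem, (φ[p]).left_inv hqs⟩
    · rfl
  refine ⟨Ψ, ?_, fun q hq ↦ hΨF q ?_, ?_⟩
  · simp only [hΨ, if_pos hp's, hf, bump, ← hχ, hw]
    rw [smul_inv_smul₀ (by linarith : χ ≠ 0), add_sub_cancel, extChartAt_to_inv]
  · rintro ⟨y, hy, rfl⟩
    exact hq (hrU y hy)
  have hseg (a b : M) (hab : S.CausalSegment a b) :
      Relation.TransGen S'.TimelikeSegment (Ψ a) (Ψ b) := by
    obtain ⟨γ, hγ, rfl, rfl, ht⟩ := hab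
    refine transGen_of_forall_eventually (γ := Ψ ∘ γ) zero_lt_one fun s hs ↦ ?_
    by_cases hsF : γ s ∈ F
    · obtain ⟨y, hy, hys⟩ := hsF
      have hs1 : γ s ∈ (φ[p]).source := hys ▸ (φ[p]).map_target (hrt y hy)
      have hs2 : φ[p] (γ s) ∈ Metric.closedBall (φ[p] p) r := by
        rwa [← hys, (φ[p]).right_inv (hrt y hy)]
      have hs3 : γ s ∈ (chartAt 𝔼 p).source := by rwa [← extChartAt_source 𝓘(ℝ, 𝔼)]
      obtain ⟨hv0, hvv, hvt⟩ := (ht s hs).coord hs3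
      have hd := hasDerivWithinAt_extChartAt_comp hγ hs hs3
      set v := toChart p (γ s)
        (mfderivWithin 𝓘(ℝ, ℝ) (𝓘(ℝ, EuclideanSpace ℝ (Fin n))) γ (Icc 0 1) s (1 : ℝ))
      have hn : 0 < ‖v‖ := norm_pos_iff.2 hv0
      set c := φ[p] ∘ γ with hc
      have hfmem {y : 𝔼} (hy : y ∈ Metric.closedBall (φ[p] p) (2 * r)) :
          f y ∈ Metric.closedBall (φ[p] p) ρ := by
        have h1 := norm_bump_sub_le hr (φ[p] p) w y
        rw [mem_closedBall_iff_norm] at hy ⊢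
        calc ‖f y - φ[p] p‖ ≤ ‖f y - y‖ + ‖y - φ[p] p‖ := norm_sub_le_norm_sub_add_norm_sub _ _ _
          _ ≤ ρ := by linarith
      have key {y y' w' : 𝔼} {h : ℝ} (hh : 0 < h)
          (hy : y ∈ Metric.closedBall (φ[p] p) (2 * r))
          (hy' : y' ∈ Metric.closedBall (φ[p] p) (2 * r))
          (hw' : w' ∈ Metric.ball v (ρ / 2 * ‖v‖)) (hyy' : y' - y = h • w') :
          S'.TimelikeSegment ((φ[p]).symm (f y)) ((φ[p]).symm (f y')) := by
        have hsub := (convex_closedBall (φ[p] p) ρ).segment_subset (hfmem hy) (hfmem hy')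
        have hsρ : φ[p] (γ s) ∈ Metric.closedBall (φ[p] p) ρ :=
          Metric.closedBall_subset_closedBall (by linarith) hs2
        refine S'.timelikeSegment_of_coordTimelike (fun z hz ↦ (hcone z (hsub hz) z (hsub hz)).1)
          fun z hz ↦ ?_
        have h1 := norm_bump_sub_sub_le hr (φ[p] p) w y y'
        rw [mem_ball_iff_norm] at hw'
        have h2 : S'.CoordTimelike p z (h⁻¹ • (f y' - f y)) := by
          refine (hcone _ hsρ z (hsub hz)).2 v _ hv0 hvv hvt ?_
          have h3 : h⁻¹ • (f y' - f y) - v =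
              h⁻¹ • ((f y' - f y) - (y' - y)) + (w' - v) := by
            rw [hyy', smul_sub h⁻¹ (f y' - f y) (h • w'), inv_smul_smul₀ hh.ne']
            abel
          have h4 : ‖w'‖ ≤ 2 * ‖v‖ := by
            have : ‖w'‖ ≤ ‖w' - v‖ + ‖v‖ := by simpa using norm_add_le (w' - v) v
            nlinarith
          have h5 : ‖h⁻¹ • ((f y' - f y) - (y' - y))‖ ≤ ρ / 4 * (2 * ‖v‖) := by
            rw [norm_smul, norm_inv, Real.norm_of_nonneg hh.le, inv_mul_le_iff₀ hh]
            refine h1.trans ?_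
            rw [hyy', norm_smul h w', Real.norm_of_nonneg hh.le]
            calc ‖w‖ / r * (h * ‖w'‖) ≤ ρ / 4 * (h * (2 * ‖v‖)) := by gcongr
              _ = _ := by ring
          rw [h3]
          refine (norm_add_le _ _).trans ?_
          linarith
        have h3 := h2.smul hh
        rwa [smul_inv_smul₀ hh.ne'] at h3
      have e1 : ∀ᶠ s' in 𝓝[Icc 0 1] s, γ s' ∈ (φ[p]).source :=
        (hγ.continuousOn s hs).preimage_mem_nhdsWithin
          ((isOpen_extChartAt_source p).mem_nhds hs1)
      have e2 : ∀ᶠ s' in 𝓝[Icc 0 1] s, c s' ∈ Metric.ball (φ[p] p) (2 * r) :=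
        hd.continuousWithinAt.preimage_mem_nhdsWithin (Metric.isOpen_ball.mem_nhds
          (Metric.closedBall_subset_ball (by linarith) hs2))
      have e3 := hd.eventually_slope_mem
        (Metric.ball_mem_nhds v (by positivity : 0 < ρ / 2 * ‖v‖))
      have hs4 := Metric.closedBall_subset_closedBall (by linarith : r ≤ 2 * r) hs2
      filter_upwards [e1, e2, e3] with s' h1 h2 h3
      have h2' := Metric.ball_subset_closedBall h2
      simp only [Function.comp_apply, hΨ, if_pos hs1, if_pos h1]
      constructor
      · intro hlt
        refine key (w' := slope c s s') (sub_pos.2 hlt) h2' hs4 (h3 hlt.ne) ?_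
        rw [slope_comm, sub_smul_slope, vsub_eq_sub]; rfl
      · intro hlt
        refine key (w' := slope c s s') (sub_pos.2 hlt) hs4 h2' (h3 hlt.ne') ?_
        rw [sub_smul_slope, vsub_eq_sub]; rfl
    · have e1 : ∀ᶠ s' in 𝓝[Icc 0 1] s, γ s' ∈ Fᶜ :=
        (hγ.continuousOn s hs).preimage_mem_nhdsWithin (hFclosed.isOpen_compl.mem_nhds hsF)
      filter_upwards [e1, S'.eventually_timelikeSegment hk hγ hs (hSS' _ _ (ht s hs))]
        with s' h1 h2
      simp only [Function.comp_apply, hΨF _ hsF, hΨF _ h1]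
      exact ⟨fun h ↦ (h2.1 h).self_of_nhds, fun h ↦ (h2.2 h).self_of_nhds⟩
  intro a b hab
  change Relation.ReflTransGen S.CausalSegment a b at hab
  induction hab with
  | refl => exact Relation.ReflTransGen.refl
  | @tail b c _ hbc ih =>
    have h1 : (Ψ b, Ψ c) ∈ S'.chronological := hseg _ _ hbc
    exact Relation.ReflTransGen.trans ih (S'.chronological_subset_causal h1)

end TimeOrientedMetric

/-- The sum of a Lorentzian metric and a wider one, which lies between them. -/
noncomputable def LorentzMetric.sum (g g' : LorentzMetric n k M) (h : g'.IsWiderThan g)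
    (hT : ∀ x, ∃ T : TangentSpace (𝓘(ℝ, EuclideanSpace ℝ (Fin n))) x, g.form x T T < 0) :
    LorentzMetric n k M where
  form x := g.form x + g'.form x
  symm x v w := by simp only [add_apply, g.symm x v w, g'.symm x v w]
  signature x := by
    obtain ⟨T, hT⟩ := hT x
    have hT0 : T ≠ 0 := by
      rintro rfl
      simp at hT
    have hT' : g'.form x T T < 0 := h x T ⟨hT0, hT.le⟩
    refine ⟨T, add_neg hT hT', fun w hTw hw ↦ ?_⟩
    simp only [add_apply] at hTw ⊢
    by_contra! hww
    -- the component of `w` orthogonal to `T` for `g'` is spacelike for both metrics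
    set c := g'.form x T w / g'.form x T T with hc
    have hcT : c * g'.form x T T = g'.form x T w := div_mul_cancel₀ _ hT'.ne
    have horth : g'.form x T (w - c • T) = 0 := by
      simp only [map_sub, map_smul, smul_eq_mul, hcT, sub_self]
    have hz : w - c • T ≠ 0 := fun h0 ↦ by
      rw [sub_eq_zero] at h0
      rw [h0] at hTw
      simp only [map_smul, smul_eq_mul] at hTw
      have : c = 0 := by
        by_contra hc0
        have h1 : c * (g.form x T T + g'.form x T T) = 0 := by linarith
        rcases mul_eq_zero.1 h1 with h2 | h2
        · exact hc0 h2
        · linarith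
      exact hw (by rw [h0, this, zero_smul])
    have h1 := pos_of_orthogonal_timelike (g'.symm x) (g'.signature x) hT' horth hz
    have h2 : 0 < g.form x (w - c • T) (w - c • T) := by
      by_contra! h3
      exact h1.not_gt (h x _ ⟨hz, h3⟩)
    have h3 : g.form x (w - c • T) (w - c • T) + g'.form x (w - c • T) (w - c • T) =
        (g.form x w w + g'.form x w w) + c ^ 2 * (g.form x T T + g'.form x T T) -
          2 * c * (g.form x T w + g'.form x T w) := by
      simp only [map_sub, map_smul, sub_apply, smul_apply, smul_eq_mul, g.symm x w T,
        g'.symm x w T]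
      ring
    have h4 : c ^ 2 * (g.form x T T + g'.form x T T) ≤ 0 :=
      mul_nonpos_of_nonneg_of_nonpos (sq_nonneg c) (by linarith)
    rw [hTw] at h3
    linarith
  contMDiff := g.contMDiff.add_section g'.contMDiff

theorem TimeOrientedMetric.closure_causal_subset [T2Space M] (hk : 1 ≤ k)
    (S : TimeOrientedMetric n k M) : closure S.causal ⊆ S.seifert := by
  rintro ⟨x, z⟩ hxz g' h
  rcases eq_or_ne x z with rfl | hne
  · exact .refl
  set g₁ := S.metric.sum g' h fun x ↦ ⟨_, S.timelike_timeField x⟩ with hg₁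
  have h₁ : g₁.IsWiderThan S.metric := fun x v hv ↦ add_neg_of_nonpos_of_neg hv.2 (h x v hv)
  have h₂ : g'.IsWiderThan (S.widen g₁ h₁).metric := by
    intro x v hv
    by_contra hv'
    have h3 : g'.form x v v ≥ 0 := not_lt.1 hv'
    have h4 : 0 < S.metric.form x v v := by
      by_contra! h5
      exact hv' (h x v ⟨hv.1, h5⟩)
    have h5 : S.metric.form x v v + g'.form x v v ≤ 0 := hv.2
    linarith
  obtain ⟨U, V, hU, hV, hxU, hzV, hUV⟩ := t2_separation hne
  have e1 := eventually_exists_deformation hk (S := S) (S' := S.widen g₁ h₁)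
    (fun _ _ hv ↦ hv.widen h₁) (hU.mem_nhds hxU)
  have e2 := eventually_exists_deformation hk (S := S.widen g₁ h₁) (S' := S.widen g' h)
    (fun _ _ hv ↦ hv.widen h₂) (hV.mem_nhds hzV)
  have e3 : ∀ᶠ z' in 𝓝 z, z' ∈ V := hV.mem_nhds hzV
  have e4 := e1.prod_nhds (e2.and e3)
  obtain ⟨⟨x', z'⟩, ⟨⟨Φ, hΦ, hΦU, hΦJ⟩, ⟨Ψ, hΨ, hΨV, hΨJ⟩, hz'⟩, hxz'⟩ :=
    ((mem_closure_iff_frequently.1 hxz).and_eventually e4).exists.imp fun _ h ↦ h.symm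
  have h5 := hΦJ _ _ hxz'
  rw [hΦ, hΦU z' fun hzU ↦ disjoint_left.1 hUV hzU hz'] at h5
  have h6 := hΨJ _ _ h5
  rwa [hΨ, hΨV x (disjoint_left.1 hUV hxU)] at h6

end

/-! ### Slightly wider metrics -/

section

variable {V : Type*} [AddCommGroup V] [Module ℝ V] [TopologicalSpace V]

/-- Subtracting a sufficiently small positive definite form from a Lorentzian form yields a
Lorentzian form. -/
theorem pos_sub_of_orthogonal [IsTopologicalAddGroup V] {b R : V →L[ℝ] V →L[ℝ] ℝ}
    (hR : ∀ v w, R v w = R w v) (hRpos : ∀ v, v ≠ 0 → 0 < R v v) {T : V} (hT : b T T < 0)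
    (hRb : ∀ v, 3 * R v v ≤ b v v + 2 / (-b T T) * (b T v) ^ 2) {w : V}
    (hw : (b - R) T w = 0) (hw0 : w ≠ 0) : 0 < (b - R) w w := by
  have hT0 : T ≠ 0 := by
    rintro rfl
    simp at hT
  have hRT := hRpos T hT0
  have hRw := hRpos w hw0
  simp only [sub_apply] at hw ⊢
  -- the Cauchy-Schwarz inequality for `R`
  have hCS : (R T w) ^ 2 ≤ R T T * R w w := by
    have h1 : R (R T T • w - R T w • T) (R T T • w - R T w • T) =
        R T T * (R T T * R w w - (R T w) ^ 2) := by
      simp only [map_sub, map_smul, sub_apply, smul_apply, smul_eq_mul, hR w T]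
      ring
    have h2 : 0 ≤ R (R T T • w - R T w • T) (R T T • w - R T w • T) := by
      by_cases h : R T T • w - R T w • T = 0
      · rw [h]; simp
      · exact (hRpos _ h).le
    rw [h1] at h2
    linarith [nonneg_of_mul_nonneg_right h2 hRT]
  have hq : 0 < -b T T := neg_pos.2 hT
  have hRTq : 3 * R T T ≤ -b T T := by
    have h1 := hRb T
    have h2 : 2 / (-b T T) * (b T T) ^ 2 = 2 * (-b T T) := by
      field_simp
    linarith
  have h1 : 2 / (-b T T) * (b T w) ^ 2 ≤ 2 / 3 * R w w := by
    rw [sub_eq_zero.1 hw, div_mul_eq_mul_div, div_le_iff₀ hq]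
    have : 3 * R T T * R w w ≤ -b T T * R w w := by gcongr
    nlinarith
  have h2 := hRb w
  linarith

end

section

variable {n : ℕ} {k : ℕ∞} {M : Type u} [TopologicalSpace M]
  [ChartedSpace (EuclideanSpace ℝ (Fin n)) M]
  [IsManifold (𝓘(ℝ, EuclideanSpace ℝ (Fin n))) ∞ M]

local notation "𝔼" => EuclideanSpace ℝ (Fin n)
local notation "φ[" p "]" => extChartAt (𝓘(ℝ, EuclideanSpace ℝ (Fin n))) p

namespace TimeOrientedMetric

/-- The quadratic form obtained from a Lorentzian metric by changing its sign on the line of the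
time orienting vector field. -/
noncomputable def wickSq (S : TimeOrientedMetric n k M) {x : M}
    (v : TangentSpace (𝓘(ℝ, EuclideanSpace ℝ (Fin n))) x) : ℝ :=
  S.metric.form x v v + 2 / (-S.metric.form x (S.timeField x) (S.timeField x)) *
    (S.metric.form x (S.timeField x) v) ^ 2

theorem exists_le_wickSq (hk : 1 ≤ k) (S : TimeOrientedMetric n k M) (p : M) :
    ∃ c > 0, ∀ᶠ x in 𝓝 p, ∀ v : TangentSpace (𝓘(ℝ, EuclideanSpace ℝ (Fin n))) x,
      c * ‖toChart p x v‖ ^ 2 ≤ S.wickSq v := by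
  have hp := mem_chart_source 𝔼 p
  have haxis : S.axis p = toChart p p (S.timeField p) := by
    rw [axis, timeCoord, extChartAt_to_inv]
  have he := S.coord_center_axis_neg p
  obtain ⟨c, hc, hcle⟩ := exists_pos_mul_norm_sq_le_add_sq he
    (S.metric.coord_symm (mem_extChartAt_target p)) fun z h hz ↦ S.coord_center_pos p h hz
  rw [S.metric.coord_extChartAt hp, haxis] at he hcle
  set H : M × 𝔼 → ℝ := fun x ↦ S.metric.atChart p x.1 x.2 x.2 +
    2 / (-S.metric.atChart p x.1 (toChart p x.1 (S.timeField x.1))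
      (toChart p x.1 (S.timeField x.1))) *
    (S.metric.atChart p x.1 x.2 (toChart p x.1 (S.timeField x.1))) ^ 2 with hH
  have hcont (v : 𝔼) : ContinuousAt H (p, v) := by
    have h1 : ContinuousAt (fun x : M × 𝔼 ↦ S.metric.atChart p x.1) (p, v) :=
      ContinuousAt.comp (g := S.metric.atChart p) (f := Prod.fst)
        (S.metric.contMDiffAt_atChart hk p).continuousAt continuousAt_fst
    have h2 : ContinuousAt (fun x : M × 𝔼 ↦ toChart p x.1 (S.timeField x.1)) (p, v) :=
      ContinuousAt.comp (g := fun q ↦ toChart p q (S.timeField q)) (f := Prod.fst)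
        (S.continuousAt_toChart_timeField p) continuousAt_fst
    have h3 := (h1.clm_apply continuousAt_snd).clm_apply continuousAt_snd
    have h4 := (h1.clm_apply continuousAt_snd).clm_apply h2
    have h5 := ((h1.clm_apply h2).clm_apply h2).neg
    exact h3.add ((continuousAt_const.div h5 (neg_pos.2 he).ne').mul (h4.pow 2))
  have key : ∀ᶠ x in 𝓝 p, ∀ v ∈ Metric.sphere (0 : 𝔼) 1, c / 2 < H (x, v) := by
    refine (isCompact_sphere (0 : 𝔼) 1).eventually_forall_of_forall_eventually fun v hv ↦ ?_
    refine (hcont v).eventually_const_lt ?_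
    have := hcle v
    rw [mem_sphere_zero_iff_norm.1 hv] at this
    exact (by linarith : c / 2 < c * 1 ^ 2).trans_le this
  refine ⟨c / 2, by positivity, ?_⟩
  filter_upwards [key, chart_source_mem_nhds 𝔼 p] with x hx hxs v
  have h1 : S.wickSq v = H (x, toChart p x v) := by
    simp only [wickSq, hH]
    rw [S.metric.form_eq_atChart hxs v v, S.metric.symm x _ v,
      S.metric.form_eq_atChart hxs v (S.timeField x),
      S.metric.form_eq_atChart hxs (S.timeField x) (S.timeField x)]
  rw [h1]
  set u := toChart p x v
  rcases eq_or_ne u 0 with hu | hu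
  · simp [hu, hH]
  have hn : 0 < ‖u‖ := norm_pos_iff.2 hu
  have h2 := (hx (‖u‖⁻¹ • u) (by simp [norm_smul, hn.ne'])).le
  have h3 : H (x, u) = ‖u‖ ^ 2 * H (x, ‖u‖⁻¹ • u) := by
    simp only [hH, map_smul, smul_apply, smul_eq_mul]
    field_simp
  rw [h3, mul_comm]
  gcongr

/-- Comparison of two charts. -/
theorem exists_norm_toChart_le {p x₀ : M} (hx₀ : x₀ ∈ (chartAt 𝔼 p).source) :
    ∃ N : ℝ, 0 ≤ N ∧ ∀ᶠ x in 𝓝 x₀, ∀ v : TangentSpace (𝓘(ℝ, EuclideanSpace ℝ (Fin n))) x,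
      ‖toChart x₀ x v‖ ≤ N * ‖toChart p x v‖ := by
  set e := trivializationAt 𝔼 (TangentSpace (𝓘(ℝ, EuclideanSpace ℝ (Fin n))) : M → Type _) p
  set e' := trivializationAt 𝔼 (TangentSpace (𝓘(ℝ, EuclideanSpace ℝ (Fin n))) : M → Type _) x₀
  have hmem : (chartAt 𝔼 p).source ∩ (chartAt 𝔼 x₀).source ∈ 𝓝 x₀ :=
    Filter.inter_mem ((chartAt 𝔼 p).open_source.mem_nhds hx₀) (chart_source_mem_nhds 𝔼 x₀)
  have h1 : ContinuousAt (fun x ↦ (e.coordChangeL ℝ e' x : 𝔼 →L[ℝ] 𝔼)) x₀ :=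
    (continuousOn_coordChange (R := ℝ) e e').continuousAt hmem
  refine ⟨‖(e.coordChangeL ℝ e' x₀ : 𝔼 →L[ℝ] 𝔼)‖ + 1, by positivity, ?_⟩
  filter_upwards [hmem, h1.norm.eventually_lt_const (lt_add_one _)] with x hx hxN v
  have h2 : toChart x₀ x v = e.coordChangeL ℝ e' x (toChart p x v) := by
    rw [e.coordChangeL_apply e' (by exact hx)]
    have h3 : e.symm x (toChart p x v) = v := by
      have := ofChart_toChart hx.1 v
      rwa [ofChart, Bundle.Trivialization.symmL_apply _ (by exact hx.1)] at this
    rw [h3, toChart]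
    exact Bundle.Trivialization.continuousLinearMapAt_apply_of_mem ℝ _ (by exact hx.2) _
  rw [h2]
  refine ((e.coordChangeL ℝ e' x : 𝔼 →L[ℝ] 𝔼).le_opNorm _).trans ?_
  gcongr

/-- A multiple of the scalar product of the model space. -/
noncomputable def modelForm (n : ℕ) (c : ℝ) :
    EuclideanSpace ℝ (Fin n) →L[ℝ] EuclideanSpace ℝ (Fin n) →L[ℝ] ℝ :=
  c • innerSL ℝ

theorem modelForm_apply (c : ℝ) (v w : 𝔼) : modelForm n c v w = c * inner ℝ v w := rfl

/-- A multiple of the Euclidean metric in a chart. -/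
noncomputable def flatForm (p : M) (c : ℝ) (x : M) :
    TangentSpace (𝓘(ℝ, EuclideanSpace ℝ (Fin n))) x →L[ℝ]
      TangentSpace (𝓘(ℝ, EuclideanSpace ℝ (Fin n))) x →L[ℝ] ℝ :=
  (ContinuousLinearMap.precomp ℝ (toChart p x)).comp ((modelForm n c).comp (toChart p x))

theorem flatForm_apply (p : M) (c : ℝ) {x : M}
    (v w : TangentSpace (𝓘(ℝ, EuclideanSpace ℝ (Fin n))) x) :
    flatForm p c x v w = c * inner ℝ (toChart p x v) (toChart p x w) := by
  exact modelForm_apply c _ _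

set_option synthInstance.maxHeartbeats 200000 in
theorem contMDiffOn_flatForm (p : M) (c : ℝ) :
    ContMDiffOn (𝓘(ℝ, EuclideanSpace ℝ (Fin n)))
      ((𝓘(ℝ, EuclideanSpace ℝ (Fin n))).prod
        𝓘(ℝ, EuclideanSpace ℝ (Fin n) →L[ℝ] EuclideanSpace ℝ (Fin n) →L[ℝ] ℝ)) (k : ℕ∞ω)
      (fun x : M ↦ Bundle.TotalSpace.mk'
        (EuclideanSpace ℝ (Fin n) →L[ℝ] EuclideanSpace ℝ (Fin n) →L[ℝ] ℝ) x
        (flatForm (n := n) p c x))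
      (chartAt 𝔼 p).source := by
  have hsub : (chartAt 𝔼 p).source ⊆ (trivializationAt (𝔼 →L[ℝ] 𝔼 →L[ℝ] ℝ)
      (fun x : M ↦ TangentSpace (𝓘(ℝ, EuclideanSpace ℝ (Fin n))) x →L[ℝ]
        TangentSpace (𝓘(ℝ, EuclideanSpace ℝ (Fin n))) x →L[ℝ] ℝ) p).baseSet := by
    intro x hx
    simp only [hom_trivializationAt_baseSet]
    exact ⟨hx, hx, mem_univ _⟩
  refine (Bundle.Trivialization.contMDiffOn_section_iff
    (trivializationAt (𝔼 →L[ℝ] 𝔼 →L[ℝ] ℝ)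
      (fun x : M ↦ TangentSpace (𝓘(ℝ, EuclideanSpace ℝ (Fin n))) x →L[ℝ]
        TangentSpace (𝓘(ℝ, EuclideanSpace ℝ (Fin n))) x →L[ℝ] ℝ) p)
    (chartAt 𝔼 p).open_source hsub).2 ?_
  refine contMDiffOn_const (c := modelForm n c) |>.congr fun x hx ↦ ?_
  rw [hom_trivializationAt_apply]
  ext v w
  rw [inCoordinates_form_apply hx, flatForm_apply, toChart_ofChart hx, toChart_ofChart hx,
    modelForm_apply]

/-- The small positive definite forms which may be subtracted from the metric at `x`. -/
def smallForms (S : TimeOrientedMetric n k M) {ι : Type*} (p : ι → M) (C : ι → Set M)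
    (δ : ι → ℝ) (x : M) : Set (TangentSpace (𝓘(ℝ, EuclideanSpace ℝ (Fin n))) x →L[ℝ]
      TangentSpace (𝓘(ℝ, EuclideanSpace ℝ (Fin n))) x →L[ℝ] ℝ) :=
  {R | (∀ v w, R v w = R w v) ∧ (∀ v, v ≠ 0 → 0 < R v v) ∧ (∀ v, 3 * R v v ≤ S.wickSq v) ∧
    ∀ i, x ∈ C i → ∀ v, R v v ≤ δ i * ‖toChart (p i) x v‖ ^ 2 ∧
      R v (S.timeField x) ≤ δ i * ‖toChart (p i) x v‖}

theorem convex_smallForms (S : TimeOrientedMetric n k M) {ι : Type*} (p : ι → M) (C : ι → Set M)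
    (δ : ι → ℝ) (x : M) : Convex ℝ (S.smallForms p C δ x) := by
  rintro R ⟨h1, h2, h3, h4⟩ R' ⟨h1', h2', h3', h4'⟩ a b ha hb hab
  have hle {r r' s : ℝ} (hr : r ≤ s) (hr' : r' ≤ s) : a * r + b * r' ≤ s := by
    calc a * r + b * r' ≤ a * s + b * s := by gcongr
      _ = s := by rw [← add_mul, hab, one_mul]
  refine ⟨fun v w ↦ ?_, fun v hv ↦ ?_, fun v ↦ ?_, fun i hi v ↦ ⟨?_, ?_⟩⟩ <;>
    simp only [add_apply, smul_apply, smul_eq_mul]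
  · rw [h1, h1']
  · exact convex_Ioi (0 : ℝ) (h2 v hv) (h2' v hv) ha hb hab
  · have := hle (h3 v) (h3' v)
    linarith
  · exact hle (h4 i hi v).1 (h4' i hi v).1
  · exact hle (h4 i hi v).2 (h4' i hi v).2

theorem exists_eventually_flatForm_mem (hk : 1 ≤ k)
    (S : TimeOrientedMetric n k M) {ι : Type*} (p : ι → M) (C : ι → Set M)
    (hC : LocallyFinite C) (hCcl : ∀ i, IsClosed (C i))
    (hCs : ∀ i, C i ⊆ (chartAt 𝔼 (p i)).source) (δ : ι → ℝ) (hδ : ∀ i, 0 < δ i) (x₀ : M) :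
    ∃ c, ∀ᶠ x in 𝓝 x₀, x ∈ (chartAt 𝔼 x₀).source ∧ flatForm x₀ c x ∈ S.smallForms p C δ x := by
  obtain ⟨c₀, hc₀, hwick⟩ := S.exists_le_wickSq hk x₀
  have hfin : {i | x₀ ∈ C i}.Finite := hC.point_finite x₀
  choose! N hN0 hN using fun i (hi : x₀ ∈ C i) ↦ exists_norm_toChart_le (hCs i hi)
  set K := ‖toChart x₀ x₀ (S.timeField x₀)‖ + 1
  have hK : ∀ᶠ x in 𝓝 x₀, ‖toChart x₀ x (S.timeField x)‖ < K :=
    (S.continuousAt_toChart_timeField x₀).norm.eventually_lt_const (lt_add_one _)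
  have hsmall (A : ℝ) {B : ℝ} (hB : 0 < B) : ∀ᶠ c in 𝓝[>] (0 : ℝ), c * A < B := by
    have : ContinuousAt (fun c : ℝ ↦ c * A) 0 := by fun_prop
    exact nhdsWithin_le_nhds (this.eventually_lt_const (by simpa using hB))
  have hpos : ∀ᶠ c in 𝓝[>] (0 : ℝ), 0 < c := self_mem_nhdsWithin
  obtain ⟨c, hc, hcc₀, hcN⟩ := (hpos.and ((hsmall 3 hc₀).and
    ((Filter.eventually_all_finite hfin).2 fun i _ ↦
      (hsmall (N i ^ 2) (hδ i)).and (hsmall (N i * K) (hδ i))))).exists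
  refine ⟨c, ?_⟩
  filter_upwards [chart_source_mem_nhds 𝔼 x₀, hwick, hK, hC.eventually_subset hCcl x₀,
    (Filter.eventually_all_finite hfin).2 hN] with x hx h1 h2 h3 h4
  refine ⟨hx, fun v w ↦ ?_, fun v hv ↦ ?_, fun v ↦ ?_, fun i hi v ↦ ⟨?_, ?_⟩⟩
  · rw [flatForm_apply, flatForm_apply, real_inner_comm]
  · rw [flatForm_apply, real_inner_self_eq_norm_sq]
    have : toChart x₀ x v ≠ 0 := fun h0 ↦ hv (by rw [← ofChart_toChart hx v, h0, map_zero])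
    positivity
  · rw [flatForm_apply, real_inner_self_eq_norm_sq]
    refine le_trans ?_ (h1 v)
    rw [← mul_assoc]
    gcongr
    linarith
  · have hi' := h3 hi
    rw [flatForm_apply, real_inner_self_eq_norm_sq]
    have := hN0 i hi'
    calc c * ‖toChart x₀ x v‖ ^ 2 ≤ c * (N i * ‖toChart (p i) x v‖) ^ 2 := by
          gcongr
          exact h4 i hi' v
      _ = c * N i ^ 2 * ‖toChart (p i) x v‖ ^ 2 := by ring
      _ ≤ _ := by
          gcongr
          exact (hcN i hi').1.le
  · have hi' := h3 hi
    rw [flatForm_apply]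
    have := hN0 i hi'
    calc c * inner ℝ (toChart x₀ x v) (toChart x₀ x (S.timeField x)) ≤
          c * (‖toChart x₀ x v‖ * ‖toChart x₀ x (S.timeField x)‖) := by
          gcongr
          exact real_inner_le_norm _ _
      _ ≤ c * ((N i * ‖toChart (p i) x v‖) * K) := by
          gcongr
          exact h4 i hi' v
      _ = c * (N i * K) * ‖toChart (p i) x v‖ := by ring
      _ ≤ _ := by
          gcongr
          exact (hcN i hi').2.le

set_option synthInstance.maxHeartbeats 200000 in
set_option maxHeartbeats 1000000 in
/-- There are wider metrics whose causal vectors are, over each set of a locally finite family of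
closed sets contained in chart domains, as close to being causal as desired. -/
theorem exists_isWiderThan [T2Space M] [SigmaCompactSpace M] (hk : 1 ≤ k)
    (S : TimeOrientedMetric n k M) {ι : Type*} (p : ι → M) (C : ι → Set M)
    (hC : LocallyFinite C) (hCcl : ∀ i, IsClosed (C i))
    (hCs : ∀ i, C i ⊆ (chartAt 𝔼 (p i)).source) (δ : ι → ℝ) (hδ : ∀ i, 0 < δ i) :
    ∃ (g' : LorentzMetric n k M) (h : g'.IsWiderThan S.metric), ∀ i, ∀ x ∈ C i,
      ∀ v : TangentSpace (𝓘(ℝ, EuclideanSpace ℝ (Fin n))) x, (S.widen g' h).IsFutureCausal v →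
        S.metric.form x v v ≤ δ i * ‖toChart (p i) x v‖ ^ 2 ∧
        S.metric.form x v (S.timeField x) ≤ δ i * ‖toChart (p i) x v‖ := by
  obtain ⟨R, hR⟩ := exists_contMDiffSection_forall_mem_convex_of_local
    (n := k) (F_fiber := 𝔼 →L[ℝ] 𝔼 →L[ℝ] ℝ) (𝓘(ℝ, EuclideanSpace ℝ (Fin n)))
    (fun x : M ↦ TangentSpace (𝓘(ℝ, EuclideanSpace ℝ (Fin n))) x →L[ℝ]
      TangentSpace (𝓘(ℝ, EuclideanSpace ℝ (Fin n))) x →L[ℝ] ℝ) (S.smallForms p C δ)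
    (S.convex_smallForms p C δ) fun x₀ ↦ by
      obtain ⟨c, hc⟩ := S.exists_eventually_flatForm_mem hk p C hC hCcl hCs δ hδ x₀
      exact ⟨_, hc, flatForm x₀ c, (contMDiffOn_flatForm x₀ c).mono fun x hx ↦ hx.1,
        fun x hx ↦ hx.2⟩
  let g' : LorentzMetric n k M :=
    { form := fun x ↦ S.metric.form x - R x
      symm := fun x v w ↦ by
        simp only [sub_apply]
        rw [S.metric.symm x v w, (hR x).1 v w]
      signature := fun x ↦ by
        have hT : S.metric.form x (S.timeField x) (S.timeField x) < 0 := S.timelike_timeField x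
        have hT0 : S.timeField x ≠ 0 := by
          intro h0
          rw [h0] at hT
          simp at hT
        refine ⟨S.timeField x, ?_, fun w hw hw0 ↦ ?_⟩
        · simp only [sub_apply]
          linarith [(hR x).2.1 _ hT0]
        · exact pos_sub_of_orthogonal (hR x).1 (hR x).2.1 hT (hR x).2.2.1 hw hw0
      contMDiff := S.metric.contMDiff.sub_section R.contMDiff }
  have h : g'.IsWiderThan S.metric := by
    rintro x v ⟨hv0, hvv⟩
    have := (hR x).2.1 v hv0
    change S.metric.form x v v - R x v v < 0
    linarith
  refine ⟨g', h, fun i x hx v hv ↦ ?_⟩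
  obtain ⟨⟨hv0, hvv⟩, hvT⟩ := hv
  change S.metric.form x v v - R x v v ≤ 0 at hvv
  change S.metric.form x v (S.timeField x) - R x v (S.timeField x) < 0 at hvT
  obtain ⟨h1, h2⟩ := (hR x).2.2.2 i hx v
  constructor <;> linarith

end TimeOrientedMetric

end

/-! ### Continuous time functions increase along the Seifert relation -/

section

variable {n : ℕ} {k : ℕ∞} {M : Type u} [TopologicalSpace M]
  [ChartedSpace (EuclideanSpace ℝ (Fin n)) M]
  [IsManifold (𝓘(ℝ, EuclideanSpace ℝ (Fin n))) ∞ M]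

local notation "𝔼" => EuclideanSpace ℝ (Fin n)
local notation "φ[" p "]" => extChartAt (𝓘(ℝ, EuclideanSpace ℝ (Fin n))) p

namespace TimeOrientedMetric

/-- A pair of points of `C` whose coordinates form an almost causal step. -/
def AlmostCausalStepIn (S : TimeOrientedMetric n k M) (p : M) (r m ε : ℝ) (C : Set M)
    (a b : M) : Prop :=
  a ∈ C ∧ b ∈ C ∧ S.AlmostCausalStep p r m ε (φ[p] a) (φ[p] b)

/-- As `ε` tends to zero, the pairs of points of a compact set which are joined by `ε`-almost
causal chains accumulate only at the closure of the causal relation. -/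
theorem GoodChart.exists_chain_mem {S : TimeOrientedMetric n k M} {p : M} {r m κ L : ℝ}
    (hG : S.GoodChart p r m κ L) {C : Set M} (hC : IsCompact C)
    (hCs : ∀ a ∈ C, a ∈ (φ[p]).source ∧ φ[p] a ∈ Metric.closedBall (φ[p] p) (r / 2))
    {O : Set (M × M)} (hO : IsOpen O)
    (hCO : ∀ a ∈ C, ∀ b ∈ C, (a, b) ∈ closure S.causal → (a, b) ∈ O) :
    ∃ ε > 0, ∀ a ∈ C, ∀ b ∈ C,
      Relation.ReflTransGen (S.AlmostCausalStepIn p r m ε C) a b → (a, b) ∈ O := by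
  have key : ∃ ε₀ > 0, ∀ ε, 0 < ε → ε < ε₀ → ∀ x ∈ (C ×ˢ C) \ O,
      ¬ Relation.ReflTransGen (S.AlmostCausalStepIn p r m ε C) x.1 x.2 := by
    refine ((hC.prod hC).diff hO).induction_on
      (p := fun K ↦ ∃ ε₀ > 0, ∀ ε, 0 < ε → ε < ε₀ → ∀ x ∈ K,
        ¬ Relation.ReflTransGen (S.AlmostCausalStepIn p r m ε C) x.1 x.2) ?_ ?_ ?_ ?_
    · exact ⟨1, one_pos, by simp⟩
    · rintro K K' hKK' ⟨ε₀, h0, h⟩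
      exact ⟨ε₀, h0, fun ε hε hεε₀ x hx ↦ h ε hε hεε₀ x (hKK' hx)⟩
    · rintro K K' ⟨ε₀, h0, h⟩ ⟨ε₁, h1, h'⟩
      refine ⟨min ε₀ ε₁, lt_min h0 h1, fun ε hε hεε₀ x hx ↦ ?_⟩
      rcases hx with hx | hx
      · exact h ε hε (hεε₀.trans_le (min_le_left _ _)) x hx
      · exact h' ε hε (hεε₀.trans_le (min_le_right _ _)) x hx
    rintro ⟨a₀, b₀⟩ ⟨⟨ha₀, hb₀⟩, hx⟩
    have hnot : (closure S.causal)ᶜ ∈ 𝓝 (a₀, b₀) :=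
      isClosed_closure.isOpen_compl.mem_nhds fun h ↦ hx (hCO a₀ ha₀ b₀ hb₀ h)
    obtain ⟨A, hA, B, hB, hAB⟩ := mem_nhds_prod_iff.1 hnot
    obtain ⟨c, hc, ε₀, hε₀, hpert⟩ := hG.exists_perturbation
    have hinv : (φ[p]).symm (φ[p] b₀) = b₀ := (φ[p]).left_inv (hCs b₀ hb₀).1
    obtain ⟨η, hη, hηB⟩ := Metric.eventually_nhds_iff_ball.1
      ((continuousAt_extChartAt_symm' (hCs b₀ hb₀).1).preimage_mem_nhds (by rwa [hinv]))
    have hB' : ∀ᶠ b in 𝓝 b₀, φ[p] b ∈ Metric.ball (φ[p] b₀) (η / 2) :=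
      (continuousAt_extChartAt' (hCs b₀ hb₀).1).preimage_mem_nhds
        (Metric.ball_mem_nhds _ (half_pos hη))
    refine ⟨_, inter_mem_nhdsWithin _ (prod_mem_nhds hA hB'), min ε₀ (η / (2 * c)),
      by positivity, ?_⟩
    rintro ε hε hεε₀ ⟨a, b⟩ ⟨⟨⟨ha, -⟩, -⟩, haA, hbB⟩ hchain
    have hchain' := hchain.lift φ[p] fun _ _ h ↦ h.2.2
    obtain ⟨⟨b', hb', -, hab'⟩, -⟩ := hpert ε hε (hεε₀.trans_le (min_le_left _ _)) _ _
      (hCs a ha).2 hchain'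
    rw [(φ[p]).left_inv (hCs a ha).1] at hab'
    refine hAB (mk_mem_prod haA (hηB b' ?_)) (subset_closure (S.chronological_subset_causal hab'))
    have h1 : c * ε < η / 2 := by
      have := hεε₀.trans_le (min_le_right _ _)
      rw [lt_div_iff₀ (by positivity)] at this
      linarith
    have h2 : φ[p] b ∈ Metric.ball (φ[p] b₀) (η / 2) := hbB
    rw [mem_ball_iff_norm] at h2 ⊢
    calc ‖b' - φ[p] b₀‖ ≤ ‖b' - φ[p] b‖ + ‖φ[p] b - φ[p] b₀‖ :=
          norm_sub_le_norm_sub_add_norm_sub _ _ _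
      _ < η := by linarith
  obtain ⟨ε₀, hε₀, h⟩ := key
  refine ⟨ε₀ / 2, half_pos hε₀, fun a ha b hb hab ↦ ?_⟩
  by_contra hO'
  exact h (ε₀ / 2) (half_pos hε₀) (half_lt_self hε₀) (a, b) ⟨⟨ha, hb⟩, hO'⟩ hab

/-- A continuous function which is strictly increasing on the closure of the causal relation
is increasing on Seifert's relation. A causal curve of a metric which is only slightly wider is, in
each chart of a suitable atlas, an almost causal chain; such a chain cannot decrease the function
by more than a given amount, and it strictly increases the function whenever it crosses the
region between two level sets of a bump function. -/
theorem le_of_mem_seifert [T2Space M] [SigmaCompactSpace M] (hk : 1 ≤ k)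
    (S : TimeOrientedMetric n k M) {t : M → ℝ} (ht : Continuous t)
    (htime : ∀ a b, (a, b) ∈ closure S.causal → a ≠ b → t a < t b) {x z : M}
    (hxz : (x, z) ∈ S.seifert) : t x ≤ t z := by
  refine le_of_forall_pos_le_add fun δ hδ ↦ ?_
  choose r m κ L hG _ using fun p : M ↦ S.exists_goodChart hk p Filter.univ_mem
  set U : M → Set M := fun p ↦
    {q | q ∈ (chartAt 𝔼 p).source ∧ φ[p] q ∈ Metric.ball (φ[p] p) (r p / 2)} with hU
  have hUn (p : M) : U p ∈ 𝓝 p :=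
    Filter.inter_mem (chart_source_mem_nhds 𝔼 p) ((continuousAt_extChartAt p).preimage_mem_nhds
      (Metric.ball_mem_nhds _ (half_pos (hG p).r_pos)))
  obtain ⟨ι, f, hf⟩ := SmoothBumpCovering.exists_isSubordinate 𝓘(ℝ, 𝔼)
    (isClosed_univ (X := M)) (U := U) fun p _ ↦ hUn p
  have hfc (i : ι) : Continuous (f i) := (f i).continuous
  set C : ι → Set M := fun i ↦ tsupport (f i) with hC
  have hCU (i : ι) : C i ⊆ U (f.c i) := hf i
  have hCfin : LocallyFinite C := f.locallyFinite.closure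
  have hCcl (i : ι) : IsClosed (C i) := isClosed_tsupport _
  have hmemC {i : ι} {q : M} (hq : f i q ≠ 0) : q ∈ C i := subset_tsupport _ hq
  -- chains in a single chart
  have hε (i : ι) : ∃ ε > 0, ∀ a ∈ C i, ∀ b ∈ C i, Relation.ReflTransGen
      (S.AlmostCausalStepIn (f.c i) (r (f.c i)) (m (f.c i)) ε (C i)) a b →
      t a - δ < t b ∧ (f i a ≠ 1 ∨ 1 / 2 < f i b ∨ t a < t b) := by
    have hO : IsOpen {x : M × M | t x.1 - δ < t x.2 ∧
        (f i x.1 ≠ 1 ∨ 1 / 2 < f i x.2 ∨ t x.1 < t x.2)} := by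
      have h1 := (hfc i).comp continuous_fst (Y := M) (X := M × M)
      have h2 := (hfc i).comp continuous_snd (Y := M) (X := M × M)
      have h3 := ht.comp continuous_fst (Y := M) (X := M × M)
      have h4 := ht.comp continuous_snd (Y := M) (X := M × M)
      exact (isOpen_lt (h3.sub continuous_const) h4).inter
        ((isOpen_ne_fun h1 continuous_const).union
          ((isOpen_lt continuous_const h2).union (isOpen_lt h3 h4)))
    refine (hG (f.c i)).exists_chain_mem (f i).hasCompactSupport (fun a ha ↦ ?_) hO ?_
    · exact ⟨by rw [extChartAt_source]; exact (hCU i ha).1,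
        Metric.ball_subset_closedBall (hCU i ha).2⟩
    · intro a _ b _ hab
      rcases eq_or_ne a b with rfl | hne
      · refine ⟨sub_lt_self _ hδ, ?_⟩
        by_cases h1 : f i a = 1
        · exact .inr (.inl (by rw [h1]; norm_num))
        · exact .inl h1
      · have := htime a b hab hne
        exact ⟨by simp only; linarith, .inr (.inr this)⟩
  choose ε hε0 hεt using hε
  obtain ⟨g', h, hg'⟩ := S.exists_isWiderThan hk f.c C hCfin hCcl
    (fun i q hq ↦ (hCU i hq).1) (fun i ↦ min (κ (f.c i)) (ε i / 2))
    fun i ↦ lt_min (hG _).κ_pos (half_pos (hε0 i))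
  let D (i : ι) : M → M → Prop :=
    S.AlmostCausalStepIn (f.c i) (r (f.c i)) (m (f.c i)) (ε i) (C i)
  -- causal curves of the wider metric are chains of steps which are almost causal in all charts
  have hsteps (a b : M) (hab : (S.widen g' h).CausalSegment a b) :
      Relation.TransGen (fun a b ↦ ∀ i, 1 / 2 ≤ f i a → D i a b) a b := by
    obtain ⟨γ, hγ, rfl, rfl, hγc⟩ := hab
    refine transGen_of_forall_eventually zero_lt_one fun s hs ↦ ?_
    have hγs := hγ.continuousOn s hs
    have e1 : ∀ᶠ s' in 𝓝[Icc 0 1] s, {i | γ s' ∈ C i} ⊆ {i | γ s ∈ C i} :=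
      hγs.eventually (hCfin.eventually_subset hCcl (γ s))
    have e2 : ∀ᶠ s' in 𝓝[Icc 0 1] s, ∀ i ∈ {i | γ s ∈ C i},
        (s' < s → S.AlmostCausalStep (f.c i) (r (f.c i)) (m (f.c i)) (ε i)
          (φ[f.c i] (γ s')) (φ[f.c i] (γ s))) ∧
        (s < s' → S.AlmostCausalStep (f.c i) (r (f.c i)) (m (f.c i)) (ε i)
          (φ[f.c i] (γ s)) (φ[f.c i] (γ s'))) := by
      refine (Filter.eventually_all_finite (hCfin.point_finite (γ s))).2 fun i hi ↦ ?_
      have hi' := hCU i hi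
      have hv0 := ((hγc s hs).coord hi'.1).1
      obtain ⟨h1, h2⟩ := hg' i _ hi _ (hγc s hs)
      have hinv : (φ[f.c i]).symm (φ[f.c i] (γ s)) = γ s :=
        (φ[f.c i]).left_inv (by rw [extChartAt_source]; exact hi'.1)
      rw [S.metric.form_eq_atChart hi'.1, ← S.metric.coord_extChartAt hi'.1] at h1 h2
      have hτ : toChart (f.c i) (γ s) (S.timeField (γ s)) =
          S.timeCoord (f.c i) (φ[f.c i] (γ s)) := by rw [timeCoord, hinv]
      rw [hτ] at h2
      have hn := norm_pos_iff.2 hv0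
      refine (hG (f.c i)).eventually_almostCausalStep hγ hs hi'.1 hi'.2 (hε0 i) rfl hv0 ?_ ?_
      · refine h1.trans_lt (mul_lt_mul_of_pos_right ?_ (pow_pos hn 2))
        exact (min_le_right _ _).trans_lt (half_lt_self (hε0 i))
      · refine (hG (f.c i)).le_height _ ((hG (f.c i)).half_subset
          (Metric.ball_subset_closedBall hi'.2)) _ (h1.trans ?_) (h2.trans ?_)
        · exact mul_le_mul_of_nonneg_right (min_le_left _ _) (sq_nonneg _)
        · exact mul_le_mul_of_nonneg_right (min_le_left _ _) (norm_nonneg _)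
    have e3 : ∀ᶠ s' in 𝓝[Icc 0 1] s, ∀ i ∈ {i | γ s ∈ C i},
        1 / 2 ≤ f i (γ s) → γ s' ∈ C i := by
      refine (Filter.eventually_all_finite (hCfin.point_finite (γ s))).2 fun i hi ↦ ?_
      by_cases hhalf : 1 / 2 ≤ f i (γ s)
      · have h1 : ∀ᶠ q in 𝓝 (γ s), 0 < f i q :=
          (hfc i).continuousAt.eventually_const_lt (by linarith)
        filter_upwards [hγs.eventually h1] with s' hs' _ using hmemC hs'.ne'
      · exact .of_forall fun _ h ↦ absurd h hhalf
    filter_upwards [e1, e2, e3] with s' h1 h2 h3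
    constructor
    · intro hlt i hi
      have hs'C : γ s' ∈ C i := hmemC (by linarith)
      exact ⟨hs'C, h1 hs'C, (h2 i (h1 hs'C)).1 hlt⟩
    · intro hlt i hi
      have hsC : γ s ∈ C i := hmemC (by linarith)
      exact ⟨hsC, h3 i hsC hi, (h2 i hsC).2 hlt⟩
  have hchain : Relation.ReflTransGen (fun a b ↦ ∀ i, 1 / 2 ≤ f i a → D i a b) x z := by
    have h1 : Relation.ReflTransGen (S.widen g' h).CausalSegment x z := hxz g' h
    clear hxz
    induction h1 with
    | refl => exact .refl
    | tail _ hbc ih => exact ih.trans (hsteps _ _ hbc).to_reflTransGen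
  -- the current point is joined in one chart to an earlier point where the bump function is `1`
  have hinv : ∃ i a, f i a = 1 ∧ t x ≤ t a ∧ 1 / 2 ≤ f i z ∧ Relation.ReflTransGen (D i) a z := by
    clear hxz
    induction hchain with
    | refl =>
      have h1 := f.apply_ind x (mem_univ x)
      exact ⟨_, x, h1, le_rfl, by rw [h1]; norm_num, .refl⟩
    | @tail b c _ hbc ih =>
      obtain ⟨i, a, hia, hta, hib, hab⟩ := ih
      have hstep := hbc i hib
      have hac := hab.tail hstep
      rcases le_or_gt (1 / 2) (f i c) with hic | hic
      · exact ⟨i, a, hia, hta, hic, hac⟩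
      · have h1 := (hεt i a (hmemC (by rw [hia]; exact one_ne_zero)) c hstep.2.1 hac).2
        have h2 : t a < t c := by
          rcases h1 with h1 | h1 | h1
          · exact absurd hia h1
          · exact absurd h1 hic.not_gt
          · exact h1
        have h3 := f.apply_ind c (mem_univ c)
        exact ⟨_, c, h3, hta.trans h2.le, by rw [h3]; norm_num, .refl⟩
  obtain ⟨i, a, hia, hta, hiz, haz⟩ := hinv
  have := (hεt i a (hmemC (by rw [hia]; exact one_ne_zero)) z (hmemC (by linarith)) haz).1
  linarith

end TimeOrientedMetric

end

/-! ### Reflectivity conditions and Seifert's relation -/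

theorem mem_closure_of_mem_closure_past {X : Type u} [TopologicalSpace X] {J : Set (X × X)}
    {x z : X} (hx : x ∈ closure (pastOf J z)) : (x, z) ∈ closure J :=
  map_mem_closure (f := fun y ↦ (y, z)) (by fun_prop) hx fun _ hy ↦ hy

theorem reflecting_preimage_swap_iff {X : Type u} [TopologicalSpace X] {J : Set (X × X)} :
    (∀ x z, (x, z) ∈ closure (Prod.swap ⁻¹' J) → z ∈ closure (futureOf (Prod.swap ⁻¹' J) x)) ↔
      ∀ x z, (x, z) ∈ closure J → x ∈ closure (pastOf J z) := by
  rw [closure_preimage_swap]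
  exact ⟨fun h x z hxz ↦ h z x hxz, fun h x z hxz ↦ h z x hxz⟩

section

variable {n : ℕ} {k : ℕ∞} {M : Type u} [TopologicalSpace M]
  [ChartedSpace (EuclideanSpace ℝ (Fin n)) M]
  [IsManifold (𝓘(ℝ, EuclideanSpace ℝ (Fin n))) ∞ M]

namespace TimeOrientedMetric

/-- If the closure of the causal relation is antisymmetric and described by continuous monotone
functions, then it contains Seifert's relation. -/
theorem seifert_subset_closure [T2Space M] [SecondCountableTopology M] (hk : 1 ≤ k)
    (S : TimeOrientedMetric n k M)
    (hanti : ∀ x z, (x, z) ∈ closure S.causal → (z, x) ∈ closure S.causal → x = z)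
    (hsep : ∀ x z, (x, z) ∉ closure S.causal → ∃ s : M → ℝ, Continuous s ∧
      (∀ y, s y ∈ Icc (0 : ℝ) 1) ∧ (∀ a b, (a, b) ∈ closure S.causal → s a ≤ s b) ∧ s z < s x) :
    S.seifert ⊆ closure S.causal := by
  have : LocallyCompactSpace M := ChartedSpace.locallyCompactSpace (EuclideanSpace ℝ (Fin n)) M
  rintro ⟨x, z⟩ hxz
  by_contra hnot
  obtain ⟨t, ht, htime, hlt⟩ := exists_strictMono_separating hanti hsep hnot
  exact (S.le_of_mem_seifert hk ht htime hxz).not_gt hlt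

theorem seifert_subset_closure_of_futureReflecting [T2Space M] [SecondCountableTopology M]
    (hk : 1 ≤ k) (S : TimeOrientedMetric n k M) (hd : S.IsDistinguishing)
    (hr : S.IsFutureReflecting) : S.seifert ⊆ closure S.causal := by
  have : LocallyCompactSpace M := ChartedSpace.locallyCompactSpace (EuclideanSpace ℝ (Fin n)) M
  exact S.seifert_subset_closure hk
    (fun _ _ ↦ (S.isCausalPair hk).antisymm_of_futureReflecting hr hd.1)
    fun _ _ ↦ (S.isCausalPair hk).exists_monotone_separating hr

theorem seifert_subset_closure_of_pastReflecting [T2Space M] [SecondCountableTopology M]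
    (hk : 1 ≤ k) (S : TimeOrientedMetric n k M) (hd : S.IsDistinguishing)
    (hr : S.IsPastReflecting) : S.seifert ⊆ closure S.causal := by
  have : LocallyCompactSpace M := ChartedSpace.locallyCompactSpace (EuclideanSpace ℝ (Fin n)) M
  refine S.seifert_subset_closure hk (fun x z hxz hzx ↦ ?_)
    fun _ _ ↦ (S.isCausalPair hk).exists_monotone_separating_of_past hr
  refine (S.isCausalPair hk).swap.antisymm_of_futureReflecting
    (reflecting_preimage_swap_iff.2 hr) hd.2 ?_ ?_ <;> rw [closure_preimage_swap]
  exacts [hzx, hxz]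

theorem isFutureReflecting_of_seifert [T2Space M] (hk : 1 ≤ k) (S : TimeOrientedMetric n k M)
    (h : ∀ x, closure (futureOf S.causal x) = futureOf S.seifert x) : S.IsFutureReflecting := by
  intro x z hxz
  rw [h x]
  exact S.closure_causal_subset hk hxz

theorem isPastReflecting_of_seifert [T2Space M] (hk : 1 ≤ k) (S : TimeOrientedMetric n k M)
    (h : ∀ x, closure (pastOf S.causal x) = pastOf S.seifert x) : S.IsPastReflecting := by
  intro x z hxz
  rw [h z]
  exact S.closure_causal_subset hk hxz

theorem closure_causal_eq_sorkinWoolgar (hk : 1 ≤ k) (S : TimeOrientedMetric n k M)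
    (h : S.IsFutureReflecting ∨ S.IsPastReflecting) : closure S.causal = S.sorkinWoolgar := by
  have hS := S.isCausalPair hk
  rcases h with h | h
  · exact hS.closure_eq_closedTransHull h
  · have h1 := hS.swap.closure_eq_closedTransHull (reflecting_preimage_swap_iff.2 h)
    rw [closure_preimage_swap, closedTransHull_preimage_swap] at h1
    exact preimage_injective.2 Prod.swap_surjective h1

theorem pastReflecting_tfae (hk : 1 ≤ k) (S : TimeOrientedMetric n k M) :
    [S.IsPastReflecting,
      ∀ x, S.commonPast (futureOf S.chronological x) = pastOf S.chronological x,
      ∀ x, closure (pastOf S.causal x) = pastOf S.sorkinWoolgar x].TFAE := by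
  have h := (S.isCausalPair hk).swap.futureReflecting_tfae
  rw [reflecting_preimage_swap_iff, closedTransHull_preimage_swap] at h
  exact h

end TimeOrientedMetric

end

end Causality

theorem mainTheorem11 (n : ℕ) (hn : 2 ≤ n) (k : ℕ∞) (hk : 2 ≤ k)
    (M : Type u) [TopologicalSpace M] [T2Space M] [SecondCountableTopology M] [ConnectedSpace M]
    [ChartedSpace (EuclideanSpace ℝ (Fin n)) M]
    [IsManifold (𝓘(ℝ, EuclideanSpace ℝ (Fin n))) ∞ M]
    (S : Causality.TimeOrientedMetric n k M) :
    -- equivalence of (i), (ii), (iii), future and past case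
    [S.IsFutureReflecting,
      ∀ x, S.commonFuture (Causality.pastOf S.chronological x) =
        Causality.futureOf S.chronological x,
      ∀ x, closure (Causality.futureOf S.causal x) =
        Causality.futureOf S.sorkinWoolgar x].TFAE ∧
    [S.IsPastReflecting,
      ∀ x, S.commonPast (Causality.futureOf S.chronological x) =
        Causality.pastOf S.chronological x,
      ∀ x, closure (Causality.pastOf S.causal x) =
        Causality.pastOf S.sorkinWoolgar x].TFAE ∧
    -- (iv) implies (i)
    ((∀ x, closure (Causality.futureOf S.causal x) = Causality.futureOf S.seifert x) →
      S.IsFutureReflecting) ∧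
    ((∀ x, closure (Causality.pastOf S.causal x) = Causality.pastOf S.seifert x) →
      S.IsPastReflecting) ∧
    -- (i) and distinction imply (iv), if `K`-causality coincides with stable causality
    (Causality.KCausalityCoincidesWithStableCausality.{u} n k → S.IsDistinguishing →
      (S.IsFutureReflecting →
        ∀ x, closure (Causality.futureOf S.causal x) = Causality.futureOf S.seifert x) ∧
      (S.IsPastReflecting →
        ∀ x, closure (Causality.pastOf S.causal x) = Causality.pastOf S.seifert x)) ∧
    -- consequences for the relations on `M × M`
    (S.IsFutureReflecting ∨ S.IsPastReflecting → closure S.causal = S.sorkinWoolgar) ∧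
    ((∀ x, closure (Causality.futureOf S.causal x) = Causality.futureOf S.seifert x) ∨
        (∀ x, closure (Causality.pastOf S.causal x) = Causality.pastOf S.seifert x) →
      closure S.causal = S.sorkinWoolgar ∧ S.sorkinWoolgar = S.seifert) := by
  have hk1 : 1 ≤ k := le_trans (by norm_num) hk
  have iv_of (hsub : S.seifert ⊆ closure S.causal) (hr : S.IsFutureReflecting) (x : M) :
      closure (Causality.futureOf S.causal x) = Causality.futureOf S.seifert x := by
    ext z
    exact ⟨fun hz ↦ S.closure_causal_subset hk1
      (Causality.IsCausalPair.mem_closure_of_mem_closure_future hz), fun hz ↦ hr x z (hsub hz)⟩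
  have iv_of_past (hsub : S.seifert ⊆ closure S.causal) (hr : S.IsPastReflecting) (x : M) :
      closure (Causality.pastOf S.causal x) = Causality.pastOf S.seifert x := by
    ext z
    exact ⟨fun hz ↦ S.closure_causal_subset hk1
      (Causality.mem_closure_of_mem_closure_past hz), fun hz ↦ hr z x (hsub hz)⟩
  refine ⟨(S.isCausalPair hk1).futureReflecting_tfae, S.pastReflecting_tfae hk1,
    S.isFutureReflecting_of_seifert hk1, S.isPastReflecting_of_seifert hk1,
    fun _ hd ↦ ⟨fun hr ↦ iv_of (S.seifert_subset_closure_of_futureReflecting hk1 hd hr) hr,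
      fun hr ↦ iv_of_past (S.seifert_subset_closure_of_pastReflecting hk1 hd hr) hr⟩,
    S.closure_causal_eq_sorkinWoolgar hk1, fun h ↦ ?_⟩
  have hK : closure S.causal = S.sorkinWoolgar := S.closure_causal_eq_sorkinWoolgar hk1
    (h.imp (S.isFutureReflecting_of_seifert hk1) (S.isPastReflecting_of_seifert hk1))
  refine ⟨hK, hK ▸ (S.closure_causal_subset hk1).antisymm ?_⟩
  rintro ⟨x, z⟩ hxz
  rcases h with h | h
  · have hz : z ∈ closure (Causality.futureOf S.causal x) := by rw [h x]; exact hxz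
    exact Causality.IsCausalPair.mem_closure_of_mem_closure_future hz
  · have hx : x ∈ closure (Causality.pastOf S.causal z) := by rw [h z]; exact hxz
    exact Causality.mem_closure_of_mem_closure_past hx
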